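/- Theorem 2. A paw is a triangle together with one further vertex that is adjacent to exactly one vertex of the triangle, and a graph is paw-free if it has no induced subgraph isomorphic to a paw. In Paw-free Edge Deletion the input is a finite simple graph $G$ and an integer $k\ge 0$, and the question is whether there is a set $E_-$ of at most $k$ edges of $G$ such that $G-E_-$ is paw-free. This problem, parameterized by $k$, has an $O(k^4)$-vertex kernel: there are a function $f$ with $f(k)=O(k^4)$ as $k\to\infty$ and a polynomial-time algorithm that, given an instance $(G,k)$, outputs an instance $(G',k')$ of the problem with $k'\le k$ and $|V(G')|\le f(k)$ such that $(G,k)$ is a yes-instance if and only if $(G',k')$ is a yes-instance. -/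

import Mathlib

namespace PawKernel

/-! ### Paw-free graphs and the edge deletion problem -/

/-- The paw: the triangle `0 1 2` together with the pendant edge `0 3`. -/
def paw : SimpleGraph (Fin 4) :=
  SimpleGraph.fromEdgeSet {s(0, 1), s(0, 2), s(1, 2), s(0, 3)}

/-- A graph is paw-free if it has no induced subgraph isomorphic to the paw. -/
def PawFree {V : Type*} (G : SimpleGraph V) : Prop :=
  ¬ SimpleGraph.IsIndContained paw G

/-- `(G, k)` is a yes-instance of the paw-free edge deletion problem: deleting some set of at
most `k` edges of `G` (and no vertices) leaves a paw-free graph. -/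
def PawFreeEdgeDeletion {V : Type*} (G : SimpleGraph V) (k : ℕ) : Prop :=
  ∃ E : Finset (Sym2 V), (E : Set (Sym2 V)) ⊆ G.edgeSet ∧ E.card ≤ k ∧
    PawFree (G.deleteEdges (E : Set (Sym2 V)))

/-! ### The machine model: structured programs for a random access machine

The machine has registers `reg 0, reg 1, …` and arrays `arr 0, arr 1, …`, each cell holding a
natural number. A program mentions only finitely many registers and arrays, and arrays are
addressed indirectly through registers. The only arithmetic is addition and truncated
subtraction, so that one step lengthens the numbers in memory by at most a bit and unit cost is
polynomially equivalent to the running time of a Turing machine. -/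

/-- Memory contents. -/
structure State where
  /-- the contents of the registers -/
  reg : ℕ → ℕ
  /-- `arr a i` is the content of cell `i` of array `a` -/
  arr : ℕ → ℕ → ℕ

/-- Elementary instructions. -/
inductive Instr where
  /-- `reg r := c` -/
  | const (r c : ℕ)
  /-- `reg r := reg x` -/
  | move (r x : ℕ)
  /-- `reg r := reg x + reg y` -/
  | add (r x y : ℕ)
  /-- `reg r := reg x - reg y`, and `0` if `reg x < reg y` -/
  | sub (r x y : ℕ)
  /-- `reg r := arr a (reg x)` -/
  | load (r a x : ℕ)
  /-- `arr a (reg x) := reg y` -/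
  | store (a x y : ℕ)

/-- Assign `v` to register `r`. -/
def State.setReg (s : State) (r v : ℕ) : State :=
  { s with reg := Function.update s.reg r v }

/-- Assign `v` to cell `i` of array `a`. -/
def State.setArr (s : State) (a i v : ℕ) : State :=
  { s with arr := Function.update s.arr a (Function.update (s.arr a) i v) }

/-- The effect of an elementary instruction. -/
def Instr.eval : Instr → State → State
  | .const r c, s => s.setReg r c
  | .move r x, s => s.setReg r (s.reg x)
  | .add r x y, s => s.setReg r (s.reg x + s.reg y)
  | .sub r x y, s => s.setReg r (s.reg x - s.reg y)
  | .load r a x, s => s.setReg r (s.arr a (s.reg x))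
  | .store a x y, s => s.setArr a (s.reg x) (s.reg y)

/-- Programs. -/
inductive Prog where
  /-- do nothing -/
  | skip
  /-- an elementary instruction -/
  | instr (i : Instr)
  /-- `p`, then `q` -/
  | seq (p q : Prog)
  /-- if `reg r ≠ 0` then `p` else `q` -/
  | cond (r : ℕ) (p q : Prog)
  /-- while `reg r ≠ 0` do `p` -/
  | loop (r : ℕ) (p : Prog)

/-- `Exec p s t s'`: the program `p`, started in `s`, halts in `s'` after exactly `t` steps.
Every elementary instruction, every `skip` and every evaluation of the test of a conditional or
of a loop is one step. -/
inductive Exec : Prog → State → ℕ → State → Prop where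
  | skip (s : State) : Exec .skip s 1 s
  | instr (i : Instr) (s : State) : Exec (.instr i) s 1 (i.eval s)
  | seq {p q : Prog} {s₀ s₁ s₂ : State} {t₁ t₂ : ℕ} :
      Exec p s₀ t₁ s₁ → Exec q s₁ t₂ s₂ → Exec (.seq p q) s₀ (t₁ + t₂) s₂
  | cond_true {r : ℕ} {p q : Prog} {s s' : State} {t : ℕ} :
      s.reg r ≠ 0 → Exec p s t s' → Exec (.cond r p q) s (t + 1) s'
  | cond_false {r : ℕ} {p q : Prog} {s s' : State} {t : ℕ} :
      s.reg r = 0 → Exec q s t s' → Exec (.cond r p q) s (t + 1) s'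
  | loop_done {r : ℕ} {p : Prog} {s : State} :
      s.reg r = 0 → Exec (.loop r p) s 1 s
  | loop_step {r : ℕ} {p : Prog} {s₀ s₁ s₂ : State} {t₁ t₂ : ℕ} :
      s₀.reg r ≠ 0 → Exec p s₀ t₁ s₁ → Exec (.loop r p) s₁ t₂ s₂ →
        Exec (.loop r p) s₀ (t₁ + t₂ + 1) s₂

/-! ### Instances in memory -/

open Classical in
/-- The initial memory on input `(G, k)`: the number `n` of vertices in register `0`, the number
`k` in register `1`, the adjacency matrix of `G` in array `0`, row by row, and `0` elsewhere. -/
noncomputable def inputState {n : ℕ} (G : SimpleGraph (Fin n)) (k : ℕ) : State where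
  reg r := if r = 0 then n else if r = 1 then k else 0
  arr a m :=
    if a = 0 ∧ ∃ i j : Fin n, G.Adj i j ∧ m = (i : ℕ) * n + (j : ℕ) then 1 else 0

open Classical in
/-- The memory `s` holds the output `(G, k)`: register `0` is the number `n` of vertices,
register `1` is `k`, and array `0` starts with the adjacency matrix of `G`, row by row. -/
def State.Outputs (s : State) {n : ℕ} (G : SimpleGraph (Fin n)) (k : ℕ) : Prop :=
  s.reg 0 = n ∧ s.reg 1 = k ∧
    ∀ i j : Fin n, s.arr 0 ((i : ℕ) * n + (j : ℕ)) = if G.Adj i j then 1 else 0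

/-- The length of the input `(G, k)` in bits, for `G` on `n` vertices: the adjacency matrix and
the binary expansion of `k`. -/
def inputLength (n k : ℕ) : ℕ := n * n + Nat.size k

/-! ### Kernels -/

/-- The problem `Q` on pairs of a finite graph and a natural number, parameterized by the number,
has a kernel with at most `f k` vertices: some program transforms every instance `(G, k)`, in time
polynomial in its length, into an equivalent instance `(G', k')` with `k' ≤ k` in which `G'` has at
most `f k` vertices. -/
def HasVertexKernel (Q : ∀ {n : ℕ}, SimpleGraph (Fin n) → ℕ → Prop) (f : ℕ → ℕ) : Prop :=
  ∃ (p : Prog) (T : Polynomial ℕ), ∀ (n : ℕ) (G : SimpleGraph (Fin n)) (k : ℕ),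
    ∃ (t : ℕ) (s : State) (n' : ℕ) (G' : SimpleGraph (Fin n')) (k' : ℕ),
      Exec p (inputState G k) t s ∧ t ≤ T.eval (inputLength n k) ∧ s.Outputs G' k' ∧
        (Q G k ↔ Q G' k') ∧ k' ≤ k ∧ n' ≤ f k

end PawKernel

/-! A component of a paw-free graph is either triangle-free or complete multipartite
(`PawFree.falseTwins`). Four reduction rules rest on this and on pigeonhole arguments against a
solution of at most k edges. A vertex x is isolated if, for all a b c that span a paw with x, more
than k vertices could stand in for x (`Replaceable.isolate_iff`). A vertex of a complete
multipartite component is isolated, because no paw meets that component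
(`InMultipartiteComponent.isolate_iff`). A whole part is isolated if very many vertices lie in
parallel parts of moderate size, because some parallel part is then untouched by the solution and
can replace it (`InManyParts.isolate_iff`). An edge opposite to more than k paw centres must be
deleted, and the parameter drops by one (`Forced.deleteEdges_iff`).

Suppose that no rule applies and that E is a solution, with H = G - E. At most 2k vertices are
touched by E, so only untouched, non-isolated vertices have to be counted. A component of H with a
triangle contains a touched vertex by the second rule. Its untouched vertices are false twins of
each other inside a touched part, or true twins forming singleton parts, or lie in larger untouched
parts. The first rule bounds the first two kinds by O(k) each, the third rule bounds the last by
O(k^2), and the total is O(k^3) (`Solved.card_nearTriangle_le`).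

For an untouched x in a triangle-free component of H, failure of the first rule gives a b c that
span a paw with x in G and leave x at most k companions. If a b c are all touched, there are O(k^3)
triples and O(k) such x for each. Otherwise the triangle of that paw has lost an edge pq to E, and x
belongs to a set of size O(k^2) determined by p and q. This uses that pq is not forced
(`Solved.charged`). Both cases contribute O(k^4), and `Irreducible.card_le` adds everything up.

The algorithm caps k at n^2, applies the rules until nothing changes, answers with the paw and
parameter 0 if too many non-isolated vertices remain, and otherwise drops the isolated vertices. To
run it on the machine, rules and outputs are written as arithmetic expressions with bounded sums.
Compilation of expressions and statements is proved correct once, with a running time polynomial in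
a bound for the registers (`Expr.compile_spec`, `Stmt.compile_spec`). -/

noncomputable section

namespace PawKernel

open Classical

/-! ### Paws and solutions -/

section Paw

variable {V V' : Type*}

/-- `a b c` is a triangle of `G` and `d` is adjacent to `a` only. -/
def IsPaw (G : SimpleGraph V) (a b c d : V) : Prop :=
  G.Adj a b ∧ G.Adj a c ∧ G.Adj b c ∧ G.Adj a d ∧ d ≠ b ∧ d ≠ c ∧ ¬ G.Adj b d ∧ ¬ G.Adj c d

theorem paw_adj (i j : Fin 4) : paw.Adj i j ↔
    (s(i, j) = s(0, 1) ∨ s(i, j) = s(0, 2) ∨ s(i, j) = s(1, 2) ∨ s(i, j) = s(0, 3)) := by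
  simp only [paw, SimpleGraph.fromEdgeSet_adj, Set.mem_insert_iff, Set.mem_singleton_iff]
  revert i j
  decide

theorem pawFree_iff {G : SimpleGraph V} : PawFree G ↔ ∀ a b c d, ¬ IsPaw G a b c d := by
  constructor
  · rintro h a b c d ⟨hab, hac, hbc, had, hdb, hdc, hbd, hcd⟩
    refine h ⟨⟨⟨![a, b, c, d], ?_⟩, ?_⟩⟩
    · intro i j hij
      have := hab.ne
      have := hac.ne
      have := hbc.ne
      have := had.ne
      fin_cases i <;> fin_cases j <;> simp_all
    · intro i j
      rw [paw_adj]
      change G.Adj (![a, b, c, d] i) (![a, b, c, d] j) ↔ _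
      have := hab.symm
      have := hac.symm
      have := hbc.symm
      have := had.symm
      have : ¬ G.Adj d b := fun h => hbd h.symm
      have : ¬ G.Adj d c := fun h => hcd h.symm
      fin_cases i <;> fin_cases j <;> simp_all
  · rintro h ⟨f⟩
    refine h (f 0) (f 1) (f 2) (f 3) ⟨?_, ?_, ?_, ?_, ?_, ?_, ?_, ?_⟩
    · exact f.map_rel_iff.2 ((paw_adj _ _).2 (by decide))
    · exact f.map_rel_iff.2 ((paw_adj _ _).2 (by decide))
    · exact f.map_rel_iff.2 ((paw_adj _ _).2 (by decide))
    · exact f.map_rel_iff.2 ((paw_adj _ _).2 (by decide))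
    · exact fun h => absurd (f.injective h) (by decide)
    · exact fun h => absurd (f.injective h) (by decide)
    · exact fun h => absurd ((paw_adj _ _).1 (f.map_rel_iff.1 h)) (by decide)
    · exact fun h => absurd ((paw_adj _ _).1 (f.map_rel_iff.1 h)) (by decide)

/-- A map that preserves and reflects adjacency on the vertices of a paw yields a paw. -/
theorem IsPaw.map {G : SimpleGraph V} {G' : SimpleGraph V'} {a b c d : V} (h : IsPaw G a b c d)
    (f : V → V') (hdb : f d ≠ f b) (hdc : f d ≠ f c)
    (hf : ∀ u v, u ≠ v → (u = a ∨ u = b ∨ u = c ∨ u = d) → (v = a ∨ v = b ∨ v = c ∨ v = d) →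
      (G'.Adj (f u) (f v) ↔ G.Adj u v)) : IsPaw G' (f a) (f b) (f c) (f d) := by
  obtain ⟨h1, h2, h3, h4, h5, h6, h7, h8⟩ := h
  refine ⟨(hf a b h1.ne (by simp) (by simp)).2 h1, (hf a c h2.ne (by simp) (by simp)).2 h2,
    (hf b c h3.ne (by simp) (by simp)).2 h3, (hf a d h4.ne (by simp) (by simp)).2 h4, hdb, hdc,
    mt (hf b d h5.symm (by simp) (by simp)).1 h7, mt (hf c d h6.symm (by simp) (by simp)).1 h8⟩

/-- Deleting a non-edge has no effect, so later solutions need not be checked to consist of edges.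
-/
theorem pawFreeEdgeDeletion_iff {G : SimpleGraph V} {k : ℕ} : PawFreeEdgeDeletion G k ↔
    ∃ E : Finset (Sym2 V), E.card ≤ k ∧ PawFree (G.deleteEdges (E : Set (Sym2 V))) := by
  constructor
  · rintro ⟨E, -, h⟩
    exact ⟨E, h⟩
  · rintro ⟨E, hE, h⟩
    refine ⟨E.filter (· ∈ G.edgeSet), by intro e; simp, (Finset.card_filter_le _ _).trans hE, ?_⟩
    convert h using 1
    ext u v
    simp +contextual [SimpleGraph.deleteEdges_adj]

theorem PawFreeEdgeDeletion.mono {G : SimpleGraph V} {k l : ℕ} (hkl : k ≤ l)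
    (h : PawFreeEdgeDeletion G k) : PawFreeEdgeDeletion G l := by
  obtain ⟨E, h1, h2, h3⟩ := h
  exact ⟨E, h1, h2.trans hkl, h3⟩

/-- This is the constant no-instance that the kernelization outputs when too many vertices survive.
-/
theorem not_pawFreeEdgeDeletion_paw : ¬ PawFreeEdgeDeletion paw 0 := by
  rintro ⟨E, -, hE, h⟩
  obtain rfl : E = ∅ := Finset.card_eq_zero.1 (Nat.le_zero.1 hE)
  refine h ?_
  simp only [Finset.coe_empty, SimpleGraph.deleteEdges_empty]
  exact SimpleGraph.IsIndContained.refl _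

/-- Passing to an induced subgraph that contains all edges does not change the answer. -/
theorem pawFreeEdgeDeletion_of_embedding {G : SimpleGraph V} {G' : SimpleGraph V'} {k : ℕ}
    (f : G' ↪g G) (hf : ∀ u v, G.Adj u v → u ∈ Set.range f) :
    PawFreeEdgeDeletion G k ↔ PawFreeEdgeDeletion G' k := by
  rw [pawFreeEdgeDeletion_iff, pawFreeEdgeDeletion_iff]
  constructor
  · rintro ⟨E, hE, h⟩
    refine ⟨E.preimage (Sym2.map f) (Sym2.map.injective f.injective).injOn,
      ?_, ?_⟩
    · rw [Finset.card_preimage]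
      exact (Finset.card_filter_le _ _).trans hE
    · rw [pawFree_iff] at h ⊢
      intro a b c d hP
      refine h _ _ _ _ (hP.map f ?_ ?_ ?_)
      · exact f.injective.ne hP.2.2.2.2.1
      · exact f.injective.ne hP.2.2.2.2.2.1
      · intro u v _ _ _
        simp [SimpleGraph.deleteEdges_adj]
  · rintro ⟨E, hE, h⟩
    refine ⟨E.image (Sym2.map f), Finset.card_image_le.trans hE, ?_⟩
    rw [pawFree_iff] at h ⊢
    intro a b c d hP
    have hr : ∀ u v, (G.deleteEdges (E.image (Sym2.map f) : Set (Sym2 V))).Adj u v →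
        ∃ x, f x = u := fun u v huv => hf u v (SimpleGraph.deleteEdges_le _ huv)
    obtain ⟨a, rfl⟩ := hr _ _ hP.1
    obtain ⟨b, rfl⟩ := hr _ _ hP.1.symm
    obtain ⟨c, rfl⟩ := hr _ _ hP.2.1.symm
    obtain ⟨d, rfl⟩ := hr _ _ hP.2.2.2.1.symm
    have key : ∀ u v, (G.deleteEdges (E.image (Sym2.map f) : Set (Sym2 V))).Adj (f u) (f v) ↔
        (G'.deleteEdges (E : Set (Sym2 V'))).Adj u v := by
      intro u v
      rw [SimpleGraph.deleteEdges_adj, SimpleGraph.deleteEdges_adj, f.map_adj_iff,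
        ← Sym2.map_mk, Finset.coe_image,
        (Sym2.map.injective f.injective).mem_set_image]
    simp only [IsPaw, key, f.injective.ne_iff] at hP
    exact h _ _ _ _ hP

end Paw

/-! ### Reduction rules -/

section Rules

variable {V : Type*}

/-- Remove all edges at the vertices of `S`. -/
def isolate (G : SimpleGraph V) (S : Set V) : SimpleGraph V where
  Adj u v := G.Adj u v ∧ u ∉ S ∧ v ∉ S
  symm := ⟨fun _ _ h => ⟨h.1.symm, h.2.2, h.2.1⟩⟩
  loopless := ⟨fun _ h => h.1.ne rfl⟩

theorem isolate_le (G : SimpleGraph V) (S : Set V) : isolate G S ≤ G := fun _ _ h => h.1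

theorem isPaw_isolate {G : SimpleGraph V} {S : Set V} {E : Set (Sym2 V)} {a b c d : V} :
    IsPaw ((isolate G S).deleteEdges E) a b c d ↔
      IsPaw (G.deleteEdges E) a b c d ∧ a ∉ S ∧ b ∉ S ∧ c ∉ S ∧ d ∉ S := by
  simp only [IsPaw, SimpleGraph.deleteEdges_adj, isolate]
  tauto

/-- Common frame for the vertex rules. A solution of the isolated graph may be assumed to avoid `S`.
It then suffices to find a set `E'`, possibly equal to `E`, such that every paw surviving `E'` can
be traded for a paw surviving `E` away from `S`. -/
theorem pawFreeEdgeDeletion_isolate {G : SimpleGraph V} {S : Set V} {k : ℕ}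
    (h : ∀ E : Finset (Sym2 V), E.card ≤ k → (∀ e ∈ E, ∀ x ∈ S, x ∉ e) →
      ∃ E' : Finset (Sym2 V), E'.card ≤ k ∧ ∀ a b c d,
        IsPaw (G.deleteEdges (E' : Set (Sym2 V))) a b c d → ∃ a' b' c' d',
          IsPaw (G.deleteEdges (E : Set (Sym2 V))) a' b' c' d' ∧
            a' ∉ S ∧ b' ∉ S ∧ c' ∉ S ∧ d' ∉ S) :
    PawFreeEdgeDeletion G k ↔ PawFreeEdgeDeletion (isolate G S) k := by
  rw [pawFreeEdgeDeletion_iff, pawFreeEdgeDeletion_iff]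
  constructor
  · rintro ⟨E, hE, hG⟩
    refine ⟨E, hE, ?_⟩
    rw [pawFree_iff] at hG ⊢
    exact fun a b c d hP => hG _ _ _ _ (isPaw_isolate.1 hP).1
  · rintro ⟨E, hE, hG⟩
    obtain ⟨E', hE', h'⟩ := h (E.filter fun e => ∀ x ∈ S, x ∉ e)
      ((Finset.card_filter_le _ _).trans hE) (by simp)
    refine ⟨E', hE', ?_⟩
    rw [pawFree_iff] at hG ⊢
    intro a b c d hP
    obtain ⟨a, b, c, d, h1, ha, hb, hc, hd⟩ := h' a b c d hP
    refine hG a b c d (isPaw_isolate.2 ⟨?_, ha, hb, hc, hd⟩)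
    refine h1.map id h1.2.2.2.2.1 h1.2.2.2.2.2.1 ?_
    have hS : ∀ u, (u = a ∨ u = b ∨ u = c ∨ u = d) → u ∉ S := by
      rintro u (rfl | rfl | rfl | rfl) <;> assumption
    intro u v _ hu hv
    have hu := hS u hu
    have hv := hS v hv
    have : ∀ x ∈ S, x ∉ s(u, v) := by
      intro x hx hxe
      rcases Sym2.mem_iff.1 hxe with rfl | rfl
      · exact hu hx
      · exact hv hx
    simp only [SimpleGraph.deleteEdges_adj, Finset.coe_filter, Set.mem_ofPred_eq, id]
    tauto

theorem IsPaw.replace {H : SimpleGraph V} {a b c d x y : V} (h : IsPaw H a b c d)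
    (hy : y ≠ a ∧ y ≠ b ∧ y ≠ c ∧ y ≠ d) (hxy : y ≠ x)
    (hH : ∀ w, (w = a ∨ w = b ∨ w = c ∨ w = d) → w ≠ x → (H.Adj y w ↔ H.Adj x w)) :
    ∃ a' b' c' d', IsPaw H a' b' c' d' ∧ a' ≠ x ∧ b' ≠ x ∧ c' ≠ x ∧ d' ≠ x := by
  set f : V → V := fun v => if v = x then y else v with hf
  have hne : ∀ v, f v ≠ x := by
    intro v
    simp only [hf]
    split_ifs with h
    · exact hxy
    · exact h
  have hinj : ∀ u v, u ≠ v → (u = a ∨ u = b ∨ u = c ∨ u = d) →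
      (v = a ∨ v = b ∨ v = c ∨ v = d) → f u ≠ f v := by
    intro u v huv hu hv
    have : y ≠ u := by rintro rfl; tauto
    have : y ≠ v := by rintro rfl; tauto
    simp only [hf]
    split_ifs with h1 h2 h2
    · exact absurd (h1.trans h2.symm) huv
    · assumption
    · exact Ne.symm ‹_›
    · exact huv
  refine ⟨f a, f b, f c, f d, h.map f ?_ ?_ ?_, hne _, hne _, hne _, hne _⟩
  · exact hinj _ _ h.2.2.2.2.1 (by simp) (by simp)
  · exact hinj _ _ h.2.2.2.2.2.1 (by simp) (by simp)
  · intro u v huv hu hv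
    simp only [hf]
    split_ifs with h1 h2 h2
    · exact absurd (h1.trans h2.symm) huv
    · rw [hH v hv h2, h1]
    · rw [H.adj_comm, hH u hu h1, h2, H.adj_comm]
    · rfl

/-- The subgraph induced by `x a b c` has a spanning paw. -/
def SpansPaw (G : SimpleGraph V) (x a b c : V) : Prop :=
  b ≠ x ∧ c ≠ x ∧ c ≠ a ∧ c ≠ b ∧
    ((G.Adj x a ∧ G.Adj x b ∧ G.Adj a b ∧ (G.Adj c x ∨ G.Adj c a)) ∨
      (G.Adj a b ∧ G.Adj b c ∧ G.Adj a c ∧ G.Adj x a))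

/-- `y` is different from `x a b c` and has the same neighbours among `a b c` as `x`. -/
def Mimics (G : SimpleGraph V) (x a b c y : V) : Prop :=
  y ≠ x ∧ y ≠ a ∧ y ≠ b ∧ y ≠ c ∧
    (G.Adj y a ↔ G.Adj x a) ∧ (G.Adj y b ↔ G.Adj x b) ∧ (G.Adj y c ↔ G.Adj x c)

/-- Every potential paw at `x` survives the removal of `x` in more than `k` copies. -/
def Replaceable [Fintype V] (G : SimpleGraph V) (k : ℕ) (x : V) : Prop :=
  ∀ a b c, SpansPaw G x a b c → k < (Finset.univ.filter (Mimics G x a b c)).card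

/-- A mimic is none of `a b c`, so an edge joining it to one of them determines the mimic. Hence `E`
spoils at most `E.card` mimics, fewer than there are. -/
theorem exists_avoiding [Fintype V] {G : SimpleGraph V} {k : ℕ} {x a b c : V}
    (h : k < (Finset.univ.filter (Mimics G x a b c)).card) {E : Finset (Sym2 V)}
    (hE : E.card ≤ k) :
    ∃ y, Mimics G x a b c y ∧ ∀ w, (w = a ∨ w = b ∨ w = c) → s(y, w) ∉ E := by
  by_contra! hcon
  choose! g hg hgE using hcon
  refine absurd (Finset.card_le_card_of_injOn (s := Finset.univ.filter (Mimics G x a b c)) (t := E)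
    (fun y => s(y, g y)) ?_ ?_) (by omega)
  · intro y hy
    exact hgE y (by simpa using hy)
  · intro y hy z hz hyz
    have hy : Mimics G x a b c y := by simpa using hy
    have hz : Mimics G x a b c z := by simpa using hz
    rcases Sym2.eq_iff.1 hyz with h | h
    · exact h.1
    · have h1 := hg z hz
      rw [← h.1] at h1
      obtain ⟨-, h2, h3, h4, -⟩ := hy
      tauto

/-- An induced paw of `G - E` through `x` is a spanning, not necessarily induced, paw of `G`, which
is why `SpansPaw` ignores non-edges. Some mimic of `x` has no deleted edge to the other three
vertices and takes the place of `x`. -/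
theorem Replaceable.isolate_iff [Fintype V] {G : SimpleGraph V} {k : ℕ} {x : V}
    (h : Replaceable G k x) :
    PawFreeEdgeDeletion G k ↔ PawFreeEdgeDeletion (isolate G {x}) k := by
  refine pawFreeEdgeDeletion_isolate fun E hE hx => ⟨E, hE, fun a b c d hP => ?_⟩
  have hx : ∀ v, s(x, v) ∉ E := fun v hv => hx _ hv x rfl (by simp)
  have key : ∀ p q r, SpansPaw G x p q r →
      (∀ w, (w = a ∨ w = b ∨ w = c ∨ w = d) ↔ (w = x ∨ w = p ∨ w = q ∨ w = r)) →
      ∃ a' b' c' d', IsPaw (G.deleteEdges (E : Set (Sym2 V))) a' b' c' d' ∧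
            a' ∉ ({x} : Set V) ∧ b' ∉ ({x} : Set V) ∧ c' ∉ ({x} : Set V) ∧ d' ∉ ({x} : Set V) := by
    intro p q r hpqr hset
    obtain ⟨y, hy, hyE⟩ := exists_avoiding (h p q r hpqr) hE
    have hya : ¬ (y = a ∨ y = b ∨ y = c ∨ y = d) := by
      rw [hset]
      obtain ⟨h1, h2, h3, h4, -⟩ := hy
      tauto
    simp only [Set.mem_singleton_iff]
    refine hP.replace (x := x) (y := y) (by tauto) hy.1 fun w hw hwx => ?_
    have hw : w = p ∨ w = q ∨ w = r := by
      have := (hset w).1 hw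
      tauto
    have h1 := hyE w hw
    have h2 := hx w
    have h3 : G.Adj y w ↔ G.Adj x w := by
      obtain ⟨-, -, -, -, h3, h4, h5⟩ := hy
      rcases hw with rfl | rfl | rfl <;> assumption
    simp only [SimpleGraph.deleteEdges_adj, Finset.mem_coe]
    tauto
  have le : ∀ u v, (G.deleteEdges (E : Set (Sym2 V))).Adj u v → G.Adj u v :=
    fun u v h => (SimpleGraph.deleteEdges_le _ h)
  obtain ⟨hab, hac, hbc, had, hdb, hdc, -, -⟩ := id hP
  replace hab := le _ _ hab
  replace hac := le _ _ hac
  replace hbc := le _ _ hbc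
  replace had := le _ _ had
  have nab := hab.ne
  have nac := hac.ne
  have nbc := hbc.ne
  have nad := had.ne
  -- The position of `x` decides the disjunct of `SpansPaw`: in the triangle it is the first, with
  -- the names of the other two corners chosen so that the pendant vertex hangs on `x` or on the
  -- first of them. As the pendant vertex it is the second.
  by_cases hxa : x = a
  · subst hxa
    exact key b c d ⟨nac.symm, nad.symm, hdb, hdc, .inl ⟨hab, hac, hbc, .inl had.symm⟩⟩ (by tauto)
  by_cases hxb : x = b
  · subst hxb
    exact key a c d ⟨nbc.symm, hdb, nad.symm, hdc, .inl ⟨hab.symm, hbc, hac, .inr had.symm⟩⟩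
      (by tauto)
  by_cases hxc : x = c
  · subst hxc
    exact key a b d ⟨nbc, hdc, nad.symm, hdb,
      .inl ⟨hac.symm, hbc.symm, hab, .inr had.symm⟩⟩ (by tauto)
  by_cases hxd : x = d
  · subst hxd
    exact key a b c ⟨hdb.symm, hdc.symm, nac.symm, nbc.symm,
      .inr ⟨hab, hbc, hac, had.symm⟩⟩ (by tauto)
  · exact ⟨a, b, c, d, hP, Ne.symm hxa, Ne.symm hxb, Ne.symm hxc, Ne.symm hxd⟩

/-- `x` and `y` are false twins (or equal). -/
def FalseTwins (G : SimpleGraph V) (x y : V) : Prop := ∀ z, G.Adj x z ↔ G.Adj y z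

theorem FalseTwins.symm {G : SimpleGraph V} {x y : V} (h : FalseTwins G x y) :
    FalseTwins G y x := fun z => (h z).symm

theorem FalseTwins.trans {G : SimpleGraph V} {x y z : V} (h : FalseTwins G x y)
    (h' : FalseTwins G y z) : FalseTwins G x z := fun w => (h w).trans (h' w)

theorem FalseTwins.refl (G : SimpleGraph V) (x : V) : FalseTwins G x x := fun _ => Iff.rfl

theorem FalseTwins.not_adj {G : SimpleGraph V} {x y : V} (h : FalseTwins G x y) :
    ¬ G.Adj x y := fun hxy => ((h y).1 hxy).ne rfl

/-- The relation of being adjacent or false twins. -/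
def NearOrTwin (G : SimpleGraph V) (x y : V) : Prop := G.Adj x y ∨ FalseTwins G x y

/-- The neighbours and false twins of `x` form a complete multipartite component. -/
def InMultipartiteComponent (G : SimpleGraph V) (x : V) : Prop :=
  ∀ y, NearOrTwin G x y → ∀ z, (NearOrTwin G x z ↔ NearOrTwin G y z)

/-- Being near `x` is closed under adjacency, so a paw lies entirely inside or entirely outside this
class. After dropping from `E` all edges that meet the class, it is again complete multipartite and
contains no paw. Outside the class nothing has changed. -/
theorem InMultipartiteComponent.isolate_iff {G : SimpleGraph V} {k : ℕ} {x : V}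
    (h : InMultipartiteComponent G x) :
    PawFreeEdgeDeletion G k ↔ PawFreeEdgeDeletion (isolate G {x}) k := by
  refine pawFreeEdgeDeletion_isolate fun E hE hx =>
    ⟨E.filter fun e => ∀ v, NearOrTwin G x v → v ∉ e, (Finset.card_filter_le _ _).trans hE,
      fun a b c d hP => ?_⟩
  set E' := E.filter fun e => ∀ v, NearOrTwin G x v → v ∉ e with hE'
  have closed : ∀ u v, G.Adj u v → (NearOrTwin G x u ↔ NearOrTwin G x v) := by
    intro u v huv
    exact ⟨fun hu => (h u hu v).2 (.inl huv), fun hv => (h v hv u).2 (.inl huv.symm)⟩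
  have le : ∀ u v, (G.deleteEdges (E' : Set (Sym2 V))).Adj u v → G.Adj u v :=
    fun u v h => (SimpleGraph.deleteEdges_le _ h)
  obtain ⟨hab, hac, hbc, had, hdb, hdc, hbd, hcd⟩ := id hP
  have cb := closed _ _ (le _ _ hab)
  have cc := closed _ _ (le _ _ hac)
  have cd := closed _ _ (le _ _ had)
  have same : ∀ u v, NearOrTwin G x u →
      ((G.deleteEdges (E' : Set (Sym2 V))).Adj u v ↔ G.Adj u v) := by
    intro u v hu
    rw [SimpleGraph.deleteEdges_adj, and_iff_left]
    simp only [hE', Finset.coe_filter, Set.mem_ofPred_eq, not_and, not_forall]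
    exact fun _ => ⟨u, hu, by simp⟩
  by_cases ha : NearOrTwin G x a
  · exfalso
    have hb := cb.1 ha
    have hd := cd.1 ha
    have hc := cc.1 ha
    rw [same _ _ hb] at hbd hbc
    rw [same _ _ hc] at hcd
    -- The non-neighbours `b` and `d` would be false twins, but `c` is adjacent to `b` and not to
    -- `d`.
    rcases (h b hb d).1 hd with h1 | h1
    · exact hbd h1
    · exact hcd ((h1 c).1 hbc).symm
  · have hxS : ∀ u, (u = a ∨ u = b ∨ u = c ∨ u = d) → ¬ NearOrTwin G x u := by
      rintro u (rfl | rfl | rfl | rfl) <;> tauto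
    have hne : ∀ u, (u = a ∨ u = b ∨ u = c ∨ u = d) → u ∉ ({x} : Set V) := by
      rintro u hu rfl
      exact hxS _ hu (.inr (FalseTwins.refl _ _))
    refine ⟨a, b, c, d, hP.map id hdb hdc ?_, hne _ (by simp), hne _ (by simp), hne _ (by simp),
      hne _ (by simp)⟩
    intro u v _ hu hv
    have : ∀ w, NearOrTwin G x w → w ∉ s(u, v) := by
      intro w hw hwe
      rcases Sym2.mem_iff.1 hwe with rfl | rfl
      · exact hxS _ hu hw
      · exact hxS _ hv hw
    simp only [SimpleGraph.deleteEdges_adj, hE', Finset.coe_filter, Set.mem_ofPred_eq, id]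
    tauto

/-- The number of false twins of `x`, including `x`. -/
def twinCount [Fintype V] (G : SimpleGraph V) (x : V) : ℕ :=
  (Finset.univ.filter (FalseTwins G x)).card

/-- `y` lies in another part than `x` of a complete multipartite module with `x`, and that part
is neither a singleton nor large. -/
def ParallelPart [Fintype V] (G : SimpleGraph V) (k : ℕ) (x y : V) : Prop :=
  G.Adj x y ∧ (∀ z, NearOrTwin G x z ↔ NearOrTwin G y z) ∧ 2 ≤ twinCount G y ∧
    twinCount G y ≤ k + 5

/-- There are many parts parallel to that of `x`. -/
def InManyParts [Fintype V] (G : SimpleGraph V) (k : ℕ) (x : V) : Prop :=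
  (2 * k + 5) * (k + 5) ≤ (Finset.univ.filter (ParallelPart G k x)).card

/-- The vertices of the edges in `E`. -/
def touched (E : Finset (Sym2 V)) : Finset V := E.biUnion Sym2.toFinset

theorem mem_touched {E : Finset (Sym2 V)} {v : V} : v ∈ touched E ↔ ∃ e ∈ E, v ∈ e := by
  simp [touched, Sym2.mem_toFinset]

theorem mem_touched_left {E : Finset (Sym2 V)} {u v : V} (h : s(u, v) ∈ E) : u ∈ touched E :=
  mem_touched.2 ⟨_, h, by simp⟩

theorem mem_touched_right {E : Finset (Sym2 V)} {u v : V} (h : s(u, v) ∈ E) : v ∈ touched E :=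
  mem_touched.2 ⟨_, h, by simp⟩

theorem card_touched_le (E : Finset (Sym2 V)) : (touched E).card ≤ 2 * E.card := by
  rw [mul_comm]
  refine Finset.card_biUnion_le_card_mul _ _ _ fun e _ => ?_
  rw [Sym2.card_toFinset]
  split_ifs <;> omega

/-- A paw meets the twin class of `x` in an independent set, hence in at most two vertices, and if
in two then one is the pendant vertex. A parallel class with two vertices that avoids both `E` and
the paw can replace them. -/
theorem InManyParts.isolate_iff [Fintype V] {G : SimpleGraph V} {k : ℕ} {x : V}
    (h : InManyParts G k x) :
    PawFreeEdgeDeletion G k ↔ PawFreeEdgeDeletion (isolate G {y | FalseTwins G x y}) k := by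
  refine pawFreeEdgeDeletion_isolate fun E hE hx => ⟨E, hE, fun a b c d hP => ?_⟩
  have hx : ∀ u v, FalseTwins G x u → s(u, v) ∉ E := fun u v hu hv => hx _ hv u hu (by simp)
  -- Vertices touched by `E` or lying on the paw number at most 2k + 4, and each rules out one twin
  -- class of at most k + 5 vertices. This is less than the (2k + 5)(k + 5) available vertices.
  obtain ⟨y, hy, hyT⟩ : ∃ y, ParallelPart G k x y ∧
      ∀ z ∈ touched E ∪ {a, b, c, d}, ¬ FalseTwins G y z := by
    by_contra! hcon
    have hsub : Finset.univ.filter (ParallelPart G k x) ⊆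
        ((touched E ∪ {a, b, c, d}).filter fun z => twinCount G z ≤ k + 5).biUnion
          fun z => Finset.univ.filter (FalseTwins G z) := by
      intro y hy
      have hy : ParallelPart G k x y := by simpa using hy
      obtain ⟨z, hz, hyz⟩ := hcon y hy
      simp only [Finset.mem_biUnion, Finset.mem_filter, Finset.mem_univ, true_and]
      refine ⟨z, ⟨hz, ?_⟩, hyz.symm⟩
      refine le_trans (le_of_eq ?_) hy.2.2.2
      simp only [twinCount]
      congr 1
      ext w
      simp only [Finset.mem_filter, Finset.mem_univ, true_and]
      exact ⟨fun h => hyz.trans h, fun h => hyz.symm.trans h⟩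
    have h1 := (Finset.card_le_card hsub).trans
      (Finset.card_biUnion_le_card_mul _ _ (k + 5) fun z hz => (Finset.mem_filter.1 hz).2)
    have h2 := Finset.card_filter_le (touched E ∪ {a, b, c, d}) fun z => twinCount G z ≤ k + 5
    have h3 := Finset.card_union_le (touched E) {a, b, c, d}
    have h4 := card_touched_le E
    have h5 : ({a, b, c, d} : Finset V).card ≤ 4 := Finset.card_le_four
    have h6 : ((touched E ∪ {a, b, c, d}).filter fun z => twinCount G z ≤ k + 5).card <
      2 * k + 5 := by omega
    have := Nat.mul_lt_mul_of_pos_right h6 (by omega : 0 < k + 5)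
    unfold InManyParts at h
    omega
  obtain ⟨y₁, y₂, hy₁, hy₂, hne⟩ : ∃ y₁ y₂, FalseTwins G y y₁ ∧ FalseTwins G y y₂ ∧ y₁ ≠ y₂ := by
    obtain ⟨y₁, h1, y₂, h2, h⟩ := Finset.one_lt_card.1 hy.2.2.1
    exact ⟨y₁, y₂, by simpa using h1, by simpa using h2, h⟩
  have hyE : ∀ u v, FalseTwins G y u → s(u, v) ∉ E := fun u v hu hv =>
    hyT u (Finset.mem_union_left _ (mem_touched_left hv)) hu
  have hyP : ∀ u, (u = a ∨ u = b ∨ u = c ∨ u = d) → ¬ FalseTwins G y u := fun u hu =>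
    hyT u (Finset.mem_union_right _ (by simpa using hu))
  have hxy : ∀ u, FalseTwins G x u → ¬ FalseTwins G y u := by
    intro u h1 h2
    exact (h1.trans h2.symm).not_adj hy.1
  -- The pendant vertex gets its own image, so that it stays distinct from the image of a triangle
  -- vertex.
  set g : V → V := fun v => if v = d then y₂ else y₁ with hg
  have hgy : ∀ v, FalseTwins G y (g v) := by
    intro v
    simp only [hg]
    split_ifs <;> assumption
  set f : V → V := fun v => if FalseTwins G x v then g v else v with hf
  have hfS : ∀ v, f v ∉ {y | FalseTwins G x y} := by
    intro v hv
    simp only [hf, Set.mem_ofPred_eq] at hv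
    split_ifs at hv with h
    · exact hxy _ hv (hgy v)
    · exact h hv
  have hfd : ∀ v, v ≠ d → (v = a ∨ v = b ∨ v = c ∨ v = d) → f d ≠ f v := by
    intro v hv hvP
    simp only [hf]
    split_ifs with h1 h2 h2
    · simpa [hg, hv] using hne.symm
    · rintro h3
      exact hyP v hvP (h3 ▸ hgy d)
    · rintro h3
      exact hyP d (by simp) (h3 ▸ hgy v)
    · exact hv.symm
  -- For a vertex in neither of the two twin classes, being near `x` or near `y` means being
  -- adjacent to it, and these two conditions coincide.
  have mixed : ∀ u v, (v = a ∨ v = b ∨ v = c ∨ v = d) → FalseTwins G x u → ¬ FalseTwins G x v →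
      (G.Adj (g u) v ↔ G.Adj u v) := by
    intro u v hv hu hxv
    rw [← hu v, ← hgy u v]
    have h1 := hy.2.1 v
    have h2 := hyP v hv
    simp only [NearOrTwin] at h1
    tauto
  refine ⟨f a, f b, f c, f d, hP.map f ?_ ?_ ?_, hfS _, hfS _, hfS _, hfS _⟩
  · exact hfd b hP.2.2.2.2.1.symm (by simp)
  · exact hfd c hP.2.2.2.2.2.1.symm (by simp)
  · intro u v huv hu hv
    simp only [SimpleGraph.deleteEdges_adj, Finset.mem_coe, hf]
    split_ifs with h1 h2 h2
    · have h3 : ¬ G.Adj u v := (h1.symm.trans h2).not_adj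
      have h4 : ¬ G.Adj (g u) (g v) := ((hgy u).symm.trans (hgy v)).not_adj
      tauto
    · have h3 := mixed u v hv h1 h2
      have h4 := hx u v h1
      have h5 := hyE (g u) v (hgy u)
      tauto
    · have h3 := mixed v u hu h2 h1
      have h4 := hx v u h2
      have h5 := hyE (g v) u (hgy v)
      rw [Sym2.eq_swap] at h4 h5
      rw [G.adj_comm, h3, G.adj_comm]
      tauto
    · rfl

/-- `x` is the centre of a paw whose triangle is `x p q`. -/
def PendantAt (G : SimpleGraph V) (p q x : V) : Prop :=
  G.Adj x p ∧ G.Adj x q ∧ ∃ r, G.Adj r x ∧ r ≠ p ∧ r ≠ q ∧ ¬ G.Adj r p ∧ ¬ G.Adj r q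

/-- The edge `p q` lies in every solution with at most `k` edges. -/
def Forced [Fintype V] (G : SimpleGraph V) (k : ℕ) (p q : V) : Prop :=
  G.Adj p q ∧ 1 ≤ k ∧ k < (Finset.univ.filter (PendantAt G p q)).card

/-- If `p q` survives, each centre `x` needs a deleted edge of its own paw at `x`. The other end of
that edge is `p`, `q` or a non-neighbour of `p`, hence never another centre. Different centres thus
need different edges, more than k in all. -/
theorem mem_of_many_pendants [Fintype V] {G : SimpleGraph V} {k : ℕ} {p q : V} (hpq : G.Adj p q)
    (h : k < (Finset.univ.filter (PendantAt G p q)).card) {E : Finset (Sym2 V)}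
    (hE : E.card ≤ k) (hfree : PawFree (G.deleteEdges (E : Set (Sym2 V)))) : s(p, q) ∈ E := by
  by_contra hcon
  rw [pawFree_iff] at hfree
  have hit : ∀ x, PendantAt G p q x → ∃ w, s(x, w) ∈ E ∧ (w = p ∨ w = q ∨ ¬ G.Adj w p) := by
    rintro x ⟨hxp, hxq, r, hrx, hrp, hrq, nrp, nrq⟩
    by_contra! hno
    have h1 : s(x, p) ∉ E := fun h => (hno p h).1 rfl
    have h2 : s(x, q) ∉ E := fun h => (hno q h).2.1 rfl
    have h3 : s(x, r) ∉ E := fun h => nrp (hno r h).2.2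
    refine hfree x p q r ⟨?_, ?_, ?_, ?_, hrp, hrq, ?_, ?_⟩ <;>
      simp only [SimpleGraph.deleteEdges_adj, Finset.mem_coe]
    · exact ⟨hxp, h1⟩
    · exact ⟨hxq, h2⟩
    · exact ⟨hpq, hcon⟩
    · exact ⟨hrx.symm, h3⟩
    · exact fun h => nrp h.1.symm
    · exact fun h => nrq h.1.symm
  choose! g hgE hg using hit
  refine absurd (Finset.card_le_card_of_injOn (s := Finset.univ.filter (PendantAt G p q)) (t := E)
    (fun y => s(y, g y)) ?_ ?_) (by omega)
  · intro y hy
    exact hgE y (by simpa using hy)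
  · intro y hy z hz hyz
    have hy : PendantAt G p q y := by simpa using hy
    have hz : PendantAt G p q z := by simpa using hz
    rcases Sym2.eq_iff.1 hyz with h | h
    · exact h.1
    · have h1 := hg z hz
      rw [← h.1] at h1
      rcases h1 with h1 | h1 | h1
      · exact absurd h1 hy.1.ne
      · exact absurd h1 hy.2.1.ne
      · exact absurd hy.1 h1

theorem Forced.deleteEdges_iff [Fintype V] {G : SimpleGraph V} {k : ℕ} {p q : V}
    (h : Forced G k p q) :
    PawFreeEdgeDeletion G k ↔ PawFreeEdgeDeletion (G.deleteEdges {s(p, q)}) (k - 1) := by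
  obtain ⟨hpq, hk, hcard⟩ := h
  rw [pawFreeEdgeDeletion_iff, pawFreeEdgeDeletion_iff]
  constructor
  · rintro ⟨E, hE, hfree⟩
    have hmem := mem_of_many_pendants hpq hcard hE hfree
    refine ⟨E.erase s(p, q), ?_, ?_⟩
    · rw [Finset.card_erase_of_mem hmem]
      omega
    · rw [SimpleGraph.deleteEdges_deleteEdges]
      convert hfree using 2
      rw [Finset.coe_erase, Set.singleton_union, Set.insert_sdiff_singleton,
        Set.insert_eq_of_mem (by simpa using hmem)]
  · rintro ⟨E, hE, hfree⟩
    refine ⟨insert s(p, q) E, ?_, ?_⟩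
    · have := Finset.card_insert_le s(p, q) E
      omega
    · rw [SimpleGraph.deleteEdges_deleteEdges] at hfree
      convert hfree using 2
      rw [Finset.coe_insert, Set.singleton_union]

end Rules

/-! ### The structure of paw-free graphs -/

section Structure

variable {V : Type*}

theorem PawFree.adj_or_adj {H : SimpleGraph V} (hH : PawFree H) {a b c d : V} (hab : H.Adj a b)
    (hac : H.Adj a c) (hbc : H.Adj b c) (had : H.Adj a d) (hdb : d ≠ b) (hdc : d ≠ c) :
    H.Adj b d ∨ H.Adj c d := by
  by_contra! hcon
  exact pawFree_iff.1 hH a b c d ⟨hab, hac, hbc, had, hdb, hdc, hcon.1, hcon.2⟩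

/-- The component of `x` contains a triangle. -/
def NearTriangle (H : SimpleGraph V) (x : V) : Prop :=
  ∃ a b c, H.Reachable x a ∧ H.Adj a b ∧ H.Adj a c ∧ H.Adj b c

theorem NearTriangle.congr {H : SimpleGraph V} {x y : V} (h : NearTriangle H x)
    (hxy : H.Reachable x y) : NearTriangle H y := by
  obtain ⟨a, b, c, h1, h2⟩ := h
  exact ⟨a, b, c, hxy.symm.trans h1, h2⟩

/-- A triangle travels along a path: a further neighbour of one corner must see a second corner, and
so lies in a triangle itself. -/
theorem PawFree.exists_triangle {H : SimpleGraph V} (hH : PawFree H) {x : V}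
    (hx : NearTriangle H x) : ∃ b c, H.Adj x b ∧ H.Adj x c ∧ H.Adj b c := by
  obtain ⟨a, b, c, hxa, hab, hac, hbc⟩ := hx
  replace hxa := (SimpleGraph.reachable_iff_reflTransGen _ _).1 hxa.symm
  induction hxa with
  | refl => exact ⟨b, c, hab, hac, hbc⟩
  | @tail y d _ hyd ih =>
    obtain ⟨b, c, hyb, hyc, hbc⟩ := ih
    by_cases hdb : d = b
    · exact ⟨y, c, hyd.symm, hdb ▸ hbc, hyc⟩
    by_cases hdc : d = c
    · exact ⟨y, b, hyd.symm, hdc ▸ hbc.symm, hyb⟩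
    rcases hH.adj_or_adj hyb hyc hbc hyd hdb hdc with h | h
    · exact ⟨y, b, hyd.symm, h.symm, hyb⟩
    · exact ⟨y, c, hyd.symm, h.symm, hyc⟩

theorem PawFree.exists_triangle_of_adj {H : SimpleGraph V} (hH : PawFree H) {x y : V}
    (hx : NearTriangle H x) (hxy : H.Adj x y) : ∃ c, H.Adj x c ∧ H.Adj y c := by
  obtain ⟨b, c, hxb, hxc, hbc⟩ := hH.exists_triangle hx
  by_cases hdb : y = b
  · exact ⟨c, hxc, hdb ▸ hbc⟩
  by_cases hdc : y = c
  · exact ⟨b, hxb, hdc ▸ hbc.symm⟩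
  rcases hH.adj_or_adj hxb hxc hbc hxy hdb hdc with h | h
  · exact ⟨b, hxb, h.symm⟩
  · exact ⟨c, hxc, h.symm⟩

/-- In a component with a triangle, every edge dominates. -/
theorem PawFree.dominating_edge {H : SimpleGraph V} (hH : PawFree H) {u w v : V}
    (hu : NearTriangle H u) (huw : H.Adj u w) (huv : H.Reachable u v) :
    v = u ∨ v = w ∨ H.Adj u v ∨ H.Adj w v := by
  -- Domination cannot fail one step beyond `z`. If `z w` is an edge, `v` hangs on the triangle `z u
  -- w`. Otherwise a common neighbour `p` of `u` and `z` is adjacent to `w` and then to `v`, and `v`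
  -- hangs on the triangle `p u w`.
  have key : ∀ u w z v, NearTriangle H u → H.Adj u w → H.Adj u z → H.Adj z v →
      v = u ∨ v = w ∨ H.Adj u v ∨ H.Adj w v := by
    intro u w z v hu huw huz hzv
    by_contra! hcon
    obtain ⟨h1, h2, h3, h4⟩ := hcon
    by_cases hzw : z = w
    · exact h4 (hzw ▸ hzv)
    by_cases hzw' : H.Adj z w
    · rcases hH.adj_or_adj huz.symm hzw' huw hzv h1 h2 with h | h
      · exact h3 h
      · exact h4 h
    obtain ⟨p, hup, hzp⟩ := hH.exists_triangle_of_adj hu huz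
    have hwp : w ≠ p := by
      rintro rfl
      exact hzw' hzp
    have hpw : H.Adj p w :=
      (hH.adj_or_adj huz hup hzp huw (Ne.symm hzw) hwp).resolve_left hzw'
    by_cases hvp : v = p
    · exact h3 (hvp ▸ hup)
    have hpv : H.Adj p v :=
      (hH.adj_or_adj huz.symm hzp hup hzv h1 hvp).resolve_left h3
    rcases hH.adj_or_adj hup.symm hpw huw hpv h1 h2 with h | h
    · exact h3 h
    · exact h4 h
  replace huv := (SimpleGraph.reachable_iff_reflTransGen _ _).1 huv
  induction huv with
  | refl => exact .inl rfl
  | @tail z v _ hzv ih =>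
    rcases ih with rfl | rfl | h | h
    · exact .inr (.inr (.inl hzv))
    · exact .inr (.inr (.inr hzv))
    · exact key u w z v hu huw h hzv
    · have := key w u z v (hu.congr huw.reachable) huw.symm h hzv
      tauto

/-- Components with a triangle of a paw-free graph are complete multipartite. -/
theorem PawFree.falseTwins {H : SimpleGraph V} (hH : PawFree H) {x y : V}
    (hx : NearTriangle H x) (hxy : H.Reachable x y) (hnot : ¬ H.Adj x y) : FalseTwins H x y := by
  have key : ∀ x y, NearTriangle H x → H.Reachable x y → ¬ H.Adj x y → ∀ z, H.Adj x z →
      H.Adj y z := by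
    intro x y hx hxy hnot z hz
    -- The edge `x z` dominates `y`, and `y` is not adjacent to `x`.
    rcases hH.dominating_edge hx hz hxy with rfl | rfl | h | h
    · exact hz
    · exact absurd hz hnot
    · exact absurd h hnot
    · exact h.symm
  exact fun z => ⟨key x y hx hxy hnot z,
    key y x (hx.congr hxy) hxy.symm (fun h => hnot h.symm) z⟩

end Structure

/-! ### Irreducible instances -/

section Irreducible

variable {V : Type*} [Fintype V]

/-- No reduction rule applies to `(G, k)`. -/
structure Irreducible (G : SimpleGraph V) (k : ℕ) : Prop where
  not_replaceable : ∀ x u, G.Adj x u → ¬ Replaceable G k x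
  not_inMultipartiteComponent : ∀ x u, G.Adj x u → ¬ InMultipartiteComponent G x
  not_inManyParts : ∀ x u, G.Adj x u → ¬ InManyParts G k x
  not_forced : ∀ p q, ¬ Forced G k p q

/-- Adjacency between `x` and `y` is left open, so that both true and false twins are covered. From
k + 5 candidates at most the four vertices `x a b c` are lost, which leaves more than k mimics. -/
theorem replaceable_of_twins {G : SimpleGraph V} {k : ℕ} {x : V} (S : Finset V)
    (hS : ∀ y ∈ S, ∀ w, w ≠ x → w ≠ y → (G.Adj y w ↔ G.Adj x w)) (hcard : k + 5 ≤ S.card) :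
    Replaceable G k x := by
  rintro a b c ⟨hb, hc, -, -, h⟩
  have ha : a ≠ x := by
    rintro rfl
    rcases h with h | h
    · exact h.1.ne rfl
    · exact h.2.2.2.ne rfl
  have hsub : S \ {x, a, b, c} ⊆ Finset.univ.filter (Mimics G x a b c) := by
    intro y hy
    simp only [Finset.mem_sdiff, Finset.mem_insert, Finset.mem_singleton, not_or] at hy
    obtain ⟨hy, h1, h2, h3, h4⟩ := hy
    simp only [Finset.mem_filter, Finset.mem_univ, true_and]
    exact ⟨h1, h2, h3, h4, hS y hy a ha (Ne.symm h2), hS y hy b hb (Ne.symm h3),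
      hS y hy c hc (Ne.symm h4)⟩
  have h1 := Finset.card_le_card hsub
  have h2 := Finset.le_card_sdiff {x, a, b, c} S
  have h3 : ({x, a, b, c} : Finset V).card ≤ 4 := Finset.card_le_four
  omega

theorem Irreducible.card_twins_le {G : SimpleGraph V} {k : ℕ} (hG : Irreducible G k)
    (S : Finset V) (hadj : ∀ x ∈ S, ∃ u, G.Adj x u)
    (hS : ∀ x ∈ S, ∀ y ∈ S, ∀ w, w ≠ x → w ≠ y → G.Adj x w → G.Adj y w) : S.card ≤ k + 4 := by
  by_contra! hcard
  obtain ⟨x, hx⟩ : S.Nonempty := Finset.card_pos.1 (by omega)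
  obtain ⟨u, hu⟩ := hadj x hx
  exact hG.not_replaceable x u hu (replaceable_of_twins S (fun y hy w h1 h2 =>
    ⟨hS y hy x hx w h2 h1, hS x hx y hy w h1 h2⟩) (by omega))

end Irreducible

/-! ### Irreducible instances with a solution -/

/-- `(G, k)` is irreducible, `E` is a solution, and `H` is the graph after the deletion of `E`. -/
structure Solved {V : Type*} [Fintype V] (G : SimpleGraph V) (k : ℕ) (E : Finset (Sym2 V))
    (H : SimpleGraph V) : Prop where
  irreducible : Irreducible G k
  card_le : E.card ≤ k
  adj_iff : ∀ u v, H.Adj u v ↔ G.Adj u v ∧ s(u, v) ∉ E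
  pawFree : PawFree H

/-! ### Components with triangles in the graph left by a solution -/

namespace Solved

variable {V : Type*} [Fintype V] {G : SimpleGraph V} {k : ℕ} {E : Finset (Sym2 V)}
  {H : SimpleGraph V}

theorem le (h : Solved G k E H) {u v : V} (huv : H.Adj u v) : G.Adj u v :=
  ((h.adj_iff u v).1 huv).1

theorem adj_left (h : Solved G k E H) {u v : V} (hu : u ∉ touched E) :
    G.Adj u v ↔ H.Adj u v := by
  rw [h.adj_iff, and_iff_left]
  exact fun he => hu (mem_touched_left he)

theorem adj_right (h : Solved G k E H) {u v : V} (hv : v ∉ touched E) :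
    G.Adj u v ↔ H.Adj u v := by
  rw [G.adj_comm, h.adj_left hv, H.adj_comm]

/-- `y` lies in the part of `x` in a complete multipartite component of `H`. -/
def InPart (H : SimpleGraph V) (x y : V) : Prop := H.Reachable x y ∧ ¬ H.Adj x y

theorem InPart.refl {V : Type*} (H : SimpleGraph V) (x : V) : InPart H x x :=
  ⟨.refl _, fun h => h.ne rfl⟩

theorem InPart.falseTwins (h : Solved G k E H) {x y : V} (hx : NearTriangle H x)
    (hxy : InPart H x y) : FalseTwins H x y := h.pawFree.falseTwins hx hxy.1 hxy.2

theorem falseTwins_of_inPart (h : Solved G k E H) {x y : V} (hx : NearTriangle H x)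
    (hxT : x ∉ touched E) (hyT : y ∉ touched E) (hxy : InPart H x y) : FalseTwins G x y := by
  intro z
  rw [h.adj_left hxT, h.adj_left hyT]
  exact InPart.falseTwins h hx hxy z

/-- In an untouched part next to an untouched vertex, false twins in `G` are the part. -/
theorem falseTwins_iff (h : Solved G k E H) {x y z : V} (hx : NearTriangle H x)
    (hpart : ∀ w, InPart H x w → w ∉ touched E) (hxy : H.Adj x y) (hy : y ∉ touched E) :
    FalseTwins G x z ↔ InPart H x z := by
  have hxT := hpart x (InPart.refl H x)
  constructor
  · intro hz
    -- The untouched neighbour `y` is shared by the twin `z`, and the edge `z y` survives in `H`,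
    -- which puts `z` into the component of `x`.
    have h1 : G.Adj z y := (hz y).1 (h.le hxy)
    rw [h.adj_right hy] at h1
    exact ⟨hxy.reachable.trans h1.symm.reachable, fun h2 => hz.not_adj (h.le h2)⟩
  · intro hz
    exact h.falseTwins_of_inPart hx hxT (hpart z hz) hz

/-- Translates the relation used by the rules into components of `H`: in a complete multipartite
component every vertex is a neighbour of `x` or lies in its part. -/
theorem nearOrTwin_iff (h : Solved G k E H) {x y z : V} (hx : NearTriangle H x)
    (hpart : ∀ w, InPart H x w → w ∉ touched E) (hxy : H.Adj x y) (hy : y ∉ touched E) :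
    NearOrTwin G x z ↔ H.Reachable x z := by
  have hxT := hpart x (InPart.refl H x)
  rw [NearOrTwin, h.falseTwins_iff hx hpart hxy hy, h.adj_left hxT, InPart]
  have : H.Adj x z → H.Reachable x z := fun h => h.reachable
  tauto

/-- Every component of `H` with a triangle has a vertex of an edge in `E`. -/
theorem exists_touched (h : Solved G k E H) {x : V} (hx : NearTriangle H x) :
    ∃ t ∈ touched E, H.Reachable x t := by
  by_contra! hcon
  have hcomp : ∀ y, H.Reachable x y → ∀ w, InPart H y w → w ∉ touched E :=
    fun y hxy w hw hwT => hcon w hwT (hxy.trans hw.1)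
  -- In an untouched component, nearness in `G` is reachability in `H`. It is therefore an
  -- equivalence there, and the rule for multipartite components would apply.
  have key : ∀ y, H.Reachable x y → ∀ z, (NearOrTwin G y z ↔ H.Reachable y z) := by
    intro y hxy z
    obtain ⟨b, c, hyb, -⟩ := h.pawFree.exists_triangle (hx.congr hxy)
    exact h.nearOrTwin_iff (hx.congr hxy) (hcomp y hxy) hyb
      fun hb => hcon b hb (hxy.trans hyb.reachable)
  obtain ⟨b, c, hxb, -⟩ := h.pawFree.exists_triangle hx
  refine h.irreducible.not_inMultipartiteComponent x b (h.le hxb) fun y hy z => ?_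
  have hxy := (key x (.refl _) y).1 hy
  rw [key x (.refl _) z, key y hxy z]
  exact ⟨fun hz => hxy.symm.trans hz, fun hz => hxy.trans hz⟩

theorem exists_adj (h : Solved G k E H) {x : V} (hx : NearTriangle H x) : ∃ u, G.Adj x u := by
  obtain ⟨b, c, hxb, -⟩ := h.pawFree.exists_triangle hx
  exact ⟨b, h.le hxb⟩

theorem card_part_le (h : Solved G k E H) (S : Finset V)
    (hS : ∀ x ∈ S, x ∉ touched E ∧ NearTriangle H x) (hpart : ∀ x ∈ S, ∀ y ∈ S, InPart H x y) :
    S.card ≤ k + 4 := by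
  refine h.irreducible.card_twins_le S (fun x hx => h.exists_adj (hS x hx).2) ?_
  intro x hx y hy w _ _ hxw
  exact (h.falseTwins_of_inPart (hS x hx).2 (hS x hx).1 (hS y hy).1 (hpart x hx y hy) w).1 hxw

theorem inPart_of_inPart (h : Solved G k E H) {t x y : V} (hx : NearTriangle H x)
    (hxt : InPart H t x) (hyt : InPart H t y) : InPart H x y := by
  have h1 : InPart H x t := ⟨hxt.1.symm, fun h => hxt.2 h.symm⟩
  refine ⟨h1.1.trans hyt.1, fun h2 => hyt.2 ?_⟩
  exact (InPart.falseTwins h hx h1 y).1 h2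

/-- Untouched vertices in the component of `t`, in the part of `t`. -/
def besidePart (E : Finset (Sym2 V)) (H : SimpleGraph V) (t : V) : Finset V :=
  Finset.univ.filter fun x => x ∉ touched E ∧ NearTriangle H x ∧ InPart H t x

theorem card_besidePart_le (h : Solved G k E H) (t : V) :
    (besidePart E H t).card ≤ k + 4 := by
  refine h.card_part_le _ ?_ ?_
  · intro x hx
    simp only [besidePart, Finset.mem_filter, Finset.mem_univ, true_and] at hx
    exact ⟨hx.1, hx.2.1⟩
  · intro x hx y hy
    simp only [besidePart, Finset.mem_filter, Finset.mem_univ, true_and] at hx hy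
    exact h.inPart_of_inPart hx.2.1 hx.2.2 hy.2.2

/-- Untouched vertices in the component of `t` that form a part on their own. -/
def singletonParts (E : Finset (Sym2 V)) (H : SimpleGraph V) (t : V) : Finset V :=
  Finset.univ.filter fun x => x ∉ touched E ∧ NearTriangle H x ∧ H.Reachable t x ∧
    ∀ y, InPart H x y → y = x

/-- Each such vertex is adjacent to all others of the component, so these vertices are pairwise true
twins, and the replacement rule bounds their number. -/
theorem card_singletonParts_le (h : Solved G k E H) (t : V) :
    (singletonParts E H t).card ≤ k + 4 := by
  refine h.irreducible.card_twins_le _ ?_ ?_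
  · intro x hx
    simp only [singletonParts, Finset.mem_filter, Finset.mem_univ, true_and] at hx
    exact h.exists_adj hx.2.1
  · intro x hx y hy w hwx hwy hxw
    simp only [singletonParts, Finset.mem_filter, Finset.mem_univ, true_and] at hx hy
    rw [h.adj_left hx.1] at hxw
    rw [h.adj_left hy.1]
    by_contra hyw
    exact hwy (hy.2.2.2 w ⟨hy.2.2.1.symm.trans (hx.2.2.1.trans hxw.reachable), hyw⟩)

/-- The vertices in the component of `t` in untouched parts with several vertices. -/
def largeParts (E : Finset (Sym2 V)) (H : SimpleGraph V) (t : V) : Finset V :=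
  Finset.univ.filter fun x => NearTriangle H x ∧ H.Reachable t x ∧
    (∀ y, InPart H x y → y ∉ touched E) ∧ ∃ y, InPart H x y ∧ y ≠ x

/-- Fix one vertex `x` of these parts. The others lie in the part of `x`, at most k + 4 vertices, or
in parts parallel to it, fewer than (2k + 5)(k + 5) vertices by the rule for many parts. -/
theorem card_largeParts_le (h : Solved G k E H) (t : V) :
    (largeParts E H t).card ≤ (2 * k + 6) * (k + 5) := by
  rcases (largeParts E H t).eq_empty_or_nonempty with h0 | ⟨x, hx⟩
  · simp [h0]
  have hmem : ∀ y ∈ largeParts E H t, NearTriangle H y ∧ H.Reachable t y ∧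
    (∀ z, InPart H y z → z ∉ touched E) ∧ ∃ z, InPart H y z ∧ z ≠ y := by
    intro y hy
    simpa [largeParts] using hy
  obtain ⟨xtri, htx, xpart, -⟩ := hmem x hx
  have hsub : largeParts E H t ⊆ besidePart E H x ∪ Finset.univ.filter (ParallelPart G k x) := by
    intro y hy
    obtain ⟨ytri, hty, ypart, y', hyy', hne⟩ := hmem y hy
    simp only [besidePart, Finset.mem_union, Finset.mem_filter, Finset.mem_univ, true_and]
    have hxT := xpart x (InPart.refl H x)
    have hyT := ypart y (InPart.refl H y)
    by_cases hxy : H.Adj x y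
    · refine .inr ⟨h.le hxy, ?_, ?_, ?_⟩
      · intro z
        rw [h.nearOrTwin_iff xtri xpart hxy hyT, h.nearOrTwin_iff ytri ypart hxy.symm hxT]
        exact ⟨fun hz => hxy.symm.reachable.trans hz, fun hz => hxy.reachable.trans hz⟩
      · refine Finset.one_lt_card.2 ⟨y, ?_, y', ?_, hne.symm⟩
        · simpa using FalseTwins.refl G y
        · simpa using (h.falseTwins_iff ytri ypart hxy.symm hxT).2 hyy'
      · refine (h.card_part_le _ ?_ ?_).trans (by omega : k + 4 ≤ k + 5)
        · intro z hz
          simp only [Finset.mem_filter, Finset.mem_univ, true_and,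
            h.falseTwins_iff ytri ypart hxy.symm hxT] at hz
          exact ⟨ypart z hz, ytri.congr hz.1⟩
        · intro z hz w hw
          simp only [Finset.mem_filter, Finset.mem_univ, true_and,
            h.falseTwins_iff ytri ypart hxy.symm hxT] at hz hw
          exact h.inPart_of_inPart (ytri.congr hz.1) hz hw
    · exact .inl ⟨hyT, ytri, htx.symm.trans hty, hxy⟩
  have h1 := (Finset.card_le_card hsub).trans (Finset.card_union_le _ _)
  have h2 := h.card_besidePart_le x
  obtain ⟨u, hu⟩ := h.exists_adj xtri
  have h3 := h.irreducible.not_inManyParts x u hu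
  simp only [InManyParts, not_le] at h3
  nlinarith

/-- The untouched vertices in components with triangles. -/
theorem card_nearTriangle_le (h : Solved G k E H) :
    (Finset.univ.filter fun x => x ∉ touched E ∧ NearTriangle H x).card ≤
      2 * k * ((k + 4) + ((k + 4) + (2 * k + 6) * (k + 5))) := by
  have hsub : (Finset.univ.filter fun x => x ∉ touched E ∧ NearTriangle H x) ⊆
      (touched E).biUnion fun t => besidePart E H t ∪
        (singletonParts E H t ∪ largeParts E H t) := by
    intro x hx
    simp only [Finset.mem_filter, Finset.mem_univ, true_and] at hx
    obtain ⟨hxT, hx⟩ := hx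
    simp only [Finset.mem_biUnion, Finset.mem_union, besidePart, singletonParts, largeParts,
      Finset.mem_filter, Finset.mem_univ, true_and]
    -- A vertex whose part is touched is charged to a touched vertex of that part. Any other vertex
    -- is charged to a touched vertex elsewhere in its component.
    by_cases hpart : ∀ y, InPart H x y → y ∉ touched E
    · obtain ⟨t, ht, hxt⟩ := h.exists_touched hx
      by_cases hone : ∀ y, InPart H x y → y = x
      · exact ⟨t, ht, .inr (.inl ⟨hxT, hx, hxt.symm, hone⟩)⟩
      · push Not at hone
        exact ⟨t, ht, .inr (.inr ⟨hx, hxt.symm, hpart, hone⟩)⟩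
    · push Not at hpart
      obtain ⟨t, hxt, ht⟩ := hpart
      exact ⟨t, ht, .inl ⟨hxT, hx, hxt.1.symm, fun h => hxt.2 h.symm⟩⟩
  refine (Finset.card_le_card hsub).trans
    ((Finset.card_biUnion_le_card_mul _ _ _ fun t _ => ?_).trans
      (Nat.mul_le_mul_right _ ((card_touched_le E).trans (Nat.mul_le_mul_left 2 h.card_le))))
  refine (Finset.card_union_le _ _).trans (Nat.add_le_add (h.card_besidePart_le t) ?_)
  exact (Finset.card_union_le _ _).trans
    (Nat.add_le_add (h.card_singletonParts_le t) (h.card_largeParts_le t))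

end Solved

/-! ### Triangle-free components of the graph left by a solution -/

namespace Solved

variable {V : Type*} {G : SimpleGraph V} {k : ℕ} {E : Finset (Sym2 V)} {H : SimpleGraph V}

/-- At most `k` vertices have the same neighbours among `p q r` as `x`. -/
def Few (G : SimpleGraph V) (k : ℕ) (x p q r : V) : Prop :=
  ∀ S : Finset V, (∀ y ∈ S, Mimics G x p q r y) → S.card ≤ k

theorem Few.swap_left {x p q r : V} (h : Few G k x p q r) : Few G k x q p r := by
  refine fun S hS => h S fun y hy => ?_
  have := hS y hy
  simp only [Mimics] at this ⊢
  tauto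

theorem Few.swap_right {x p q r : V} (h : Few G k x p q r) : Few G k x p r q := by
  refine fun S hS => h S fun y hy => ?_
  have := hS y hy
  simp only [Mimics] at this ⊢
  tauto

theorem no_triangle {x a b c : V} (hx : ¬ NearTriangle H x) (hxa : H.Reachable x a)
    (hab : H.Adj a b) (hac : H.Adj a c) : ¬ H.Adj b c :=
  fun hbc => hx ⟨a, b, c, hxa, hab, hac, hbc⟩

/-- The set `S` if it has at most `m` elements, and `∅` otherwise. -/
def cap (m : ℕ) (S : Finset V) : Finset V := if S.card ≤ m then S else ∅

theorem card_cap_le (m : ℕ) (S : Finset V) : (cap m S).card ≤ m := by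
  unfold cap
  split_ifs with h
  · exact h
  · simp

theorem mem_cap {m : ℕ} {S : Finset V} {x : V} (hS : S.card ≤ m) (hx : x ∈ S) : x ∈ cap m S := by
  rwa [cap, if_pos hS]

variable [Fintype V]

/-- Untouched vertices adjacent to `p` and `q`. -/
def common (E : Finset (Sym2 V)) (H : SimpleGraph V) (p q : V) : Finset V :=
  Finset.univ.filter fun x => x ∉ touched E ∧ H.Adj x p ∧ H.Adj x q

/-- Untouched vertices adjacent to `p` and not to `q`. -/
def onlyLeft (E : Finset (Sym2 V)) (H : SimpleGraph V) (p q : V) : Finset V :=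
  Finset.univ.filter fun x => x ∉ touched E ∧ H.Adj x p ∧ ¬ H.Adj x q

/-- Untouched neighbours of `r`. -/
def outer (E : Finset (Sym2 V)) (H : SimpleGraph V) (r : V) : Finset V :=
  Finset.univ.filter fun x => x ∉ touched E ∧ H.Adj x r

/-- The vertices of triangle-free components that the deleted edge `p q` accounts for. -/
def chargedTo (G : SimpleGraph V) (k : ℕ) (E : Finset (Sym2 V)) (H : SimpleGraph V) (p q : V) :
    Finset V :=
  cap k (Finset.univ.filter (PendantAt G p q)) ∪ (cap (k + 2) (common E H p q) ∪
    (cap (k + 1) (onlyLeft E H p q) ∪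
      (cap k (Finset.univ.filter (PendantAt G p q))).biUnion fun r => cap (k + 1) (outer E H r)))

theorem card_chargedTo_le (p q : V) :
    (chargedTo G k E H p q).card ≤ k + ((k + 2) + ((k + 1) + k * (k + 1))) := by
  refine (Finset.card_union_le _ _).trans (Nat.add_le_add (card_cap_le _ _) ?_)
  refine (Finset.card_union_le _ _).trans (Nat.add_le_add (card_cap_le _ _) ?_)
  refine (Finset.card_union_le _ _).trans (Nat.add_le_add (card_cap_le _ _) ?_)
  exact (Finset.card_biUnion_le_card_mul _ _ _ fun r _ => card_cap_le _ _).trans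
    (Nat.mul_le_mul_right _ (card_cap_le _ _))

/-- Otherwise `p q` would be forced. The side condition 1 ≤ k holds because `E` is not empty. -/
theorem card_pendantAt_le (h : Solved G k E H) {p q : V} (hE : s(p, q) ∈ E) (hpq : G.Adj p q) :
    (Finset.univ.filter (PendantAt G p q)).card ≤ k := by
  by_contra! hcon
  have h1 : 1 ≤ E.card := Finset.card_pos.2 ⟨_, hE⟩
  exact h.irreducible.not_forced p q ⟨hpq, h1.trans h.card_le, hcon⟩

/-- No common neighbour of `p` and `q` is adjacent to `r`, since it would close a triangle with `p
r`. Hence all untouched ones except `x` and `r` mimic `x`, and there are at most k + 2 of them. The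
cap in `chargedTo` then does not discard the set. -/
theorem mem_chargedTo_of_common (h : Solved G k E H) {x p q r : V} (hx : ¬ NearTriangle H x)
    (hxT : x ∉ touched E) (hxp : H.Adj x p) (hxq : H.Adj x q)
    (hrp : H.Adj r p) (few : Few G k x p q r) : x ∈ chargedTo G k E H p q := by
  refine Finset.mem_union_right _ (Finset.mem_union_left _ (mem_cap ?_ ?_))
  · have h1 : (common E H p q \ {x, r}).card ≤ k := by
      refine few _ fun y hy => ?_
      simp only [common, Finset.mem_sdiff, Finset.mem_filter, Finset.mem_univ, true_and,
        Finset.mem_insert, Finset.mem_singleton, not_or] at hy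
      obtain ⟨⟨hyT, hyp, hyq⟩, hyx, hyr⟩ := hy
      refine ⟨hyx, hyp.ne, hyq.ne, hyr, ?_⟩
      have n1 := no_triangle hx hxp.reachable hxp.symm hrp.symm
      have n2 := no_triangle hx hxp.reachable hyp.symm hrp.symm
      simp only [h.adj_left hxT, h.adj_left hyT]
      tauto
    have h2 := Finset.le_card_sdiff {x, r} (common E H p q)
    have h3 : ({x, r} : Finset V).card ≤ 2 := Finset.card_le_two
    omega
  · simpa [common] using ⟨hxT, hxp, hxq⟩

/-- If `x` is not adjacent to `q`, then all other untouched vertices that see `p` but not `q` mimic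
`x`. The neighbour `r` of `q` is not among them. -/
theorem mem_chargedTo_of_adj_left (h : Solved G k E H) {x p q r : V} (hx : ¬ NearTriangle H x)
    (hxT : x ∉ touched E) (hq : q ∈ touched E) (hxp : H.Adj x p)
    (hrp : H.Adj r p) (hrq : H.Adj r q) (few : Few G k x p q r) : x ∈ chargedTo G k E H p q := by
  by_cases hxq : H.Adj x q
  · exact h.mem_chargedTo_of_common hx hxT hxp hxq hrp few
  refine Finset.mem_union_right _ (Finset.mem_union_right _ (Finset.mem_union_left _
    (mem_cap ?_ ?_)))
  · have h1 : (onlyLeft E H p q \ {x}).card ≤ k := by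
      refine few _ fun y hy => ?_
      simp only [onlyLeft, Finset.mem_sdiff, Finset.mem_filter, Finset.mem_univ, true_and,
        Finset.mem_singleton] at hy
      obtain ⟨⟨hyT, hyp, hyq⟩, hyx⟩ := hy
      refine ⟨hyx, hyp.ne, ?_, ?_, ?_⟩
      · rintro rfl
        exact hyT hq
      · rintro rfl
        exact hyq hrq
      have n1 := no_triangle hx hxp.reachable hxp.symm hrp.symm
      have n2 := no_triangle hx hxp.reachable hyp.symm hrp.symm
      simp only [h.adj_left hxT, h.adj_left hyT]
      tauto
    have h2 := Finset.le_card_sdiff {x} (onlyLeft E H p q)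
    have h3 : ({x} : Finset V).card ≤ 1 := by simp
    omega
  · simpa [onlyLeft] using ⟨hxT, hxp, hxq⟩

/-- Here `r` is the centre of a paw of `G` with triangle `r p q` and pendant vertex `x`, so there
are at most k candidates for `r`. The untouched neighbours of `r` see neither `p` nor `q`, hence all
but `x` mimic `x`. -/
theorem mem_chargedTo_of_adj_right (h : Solved G k E H) {x p q r : V} (hx : ¬ NearTriangle H x)
    (hE : s(p, q) ∈ E) (hpq : G.Adj p q)
    (hxT : x ∉ touched E) (hxr : H.Adj x r)
    (hrp : H.Adj r p) (hrq : H.Adj r q) (few : Few G k x p q r) : x ∈ chargedTo G k E H p q := by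
  have hp := mem_touched_left hE
  have hq := mem_touched_right hE
  refine Finset.mem_union_right _ (Finset.mem_union_right _ (Finset.mem_union_right _
    (Finset.mem_biUnion.2 ⟨r, mem_cap (h.card_pendantAt_le hE hpq) ?_, mem_cap ?_ ?_⟩)))
  · have n1 := no_triangle hx hxr.reachable hxr.symm hrp
    have n2 := no_triangle hx hxr.reachable hxr.symm hrq
    simp only [Finset.mem_filter, Finset.mem_univ, true_and]
    refine ⟨h.le hrp, h.le hrq, x, h.le hxr, ?_, ?_, ?_, ?_⟩
    · rintro rfl
      exact hxT hp
    · rintro rfl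
      exact hxT hq
    · rwa [h.adj_left hxT]
    · rwa [h.adj_left hxT]
  · have h1 : (outer E H r \ {x}).card ≤ k := by
      refine few _ fun y hy => ?_
      simp only [outer, Finset.mem_sdiff, Finset.mem_filter, Finset.mem_univ, true_and,
        Finset.mem_singleton] at hy
      obtain ⟨⟨hyT, hyr⟩, hyx⟩ := hy
      refine ⟨hyx, ?_, ?_, hyr.ne, ?_⟩
      · rintro rfl
        exact hyT hp
      · rintro rfl
        exact hyT hq
      have n1 := no_triangle hx hxr.reachable hxr.symm hrp
      have n2 := no_triangle hx hxr.reachable hxr.symm hrq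
      have n3 := no_triangle hx hxr.reachable hyr.symm hrp
      have n4 := no_triangle hx hxr.reachable hyr.symm hrq
      simp only [h.adj_left hxT, h.adj_left hyT]
      tauto
    have h2 := Finset.le_card_sdiff {x} (outer E H r)
    have h3 : ({x} : Finset V).card ≤ 1 := by simp
    omega
  · simpa [outer] using ⟨hxT, hxr⟩

/-- Here `x` is itself a centre opposite to `p q`, with `r` as pendant vertex. -/
theorem mem_chargedTo_of_pendant (h : Solved G k E H) {x p q r : V} (hx : ¬ NearTriangle H x)
    (hE : s(p, q) ∈ E) (hpq : G.Adj p q) (hr : r ∉ touched E)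
    (hxr : H.Adj x r) (hxp : H.Adj x p) (hxq : H.Adj x q) : x ∈ chargedTo G k E H p q := by
  refine Finset.mem_union_left _ (mem_cap (h.card_pendantAt_le hE hpq) ?_)
  have n1 := no_triangle hx (.refl _) hxr hxp
  have n2 := no_triangle hx (.refl _) hxr hxq
  simp only [Finset.mem_filter, Finset.mem_univ, true_and]
  refine ⟨h.le hxp, h.le hxq, r, h.le hxr.symm, ?_, ?_, ?_, ?_⟩
  · rintro rfl
    exact hr (mem_touched_left hE)
  · rintro rfl
    exact hr (mem_touched_right hE)
  · rwa [h.adj_left hr]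
  · rwa [h.adj_left hr]

/-- Untouched vertices that have few companions with respect to `a b c`. -/
def rare (G : SimpleGraph V) (k : ℕ) (E : Finset (Sym2 V)) (a b c : V) : Finset V :=
  Finset.univ.filter fun x => x ∉ touched E ∧ Few G k x a b c

/-- There are eight adjacency patterns towards `a b c`. Untouched vertices with equal patterns mimic
each other, so each pattern occurs at most k + 1 times among rare vertices. -/
theorem card_rare_le {a b c : V} (ha : a ∈ touched E) (hb : b ∈ touched E) (hc : c ∈ touched E) :
    (rare G k E a b c).card ≤ (k + 1) * 8 := by
  have h8 : (Finset.univ : Finset (Prop × Prop × Prop)).card = 8 := by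
    simp [Fintype.card_prop]
  rw [← h8]
  refine Finset.card_le_mul_card_image_of_maps_to
    (f := fun x => ((G.Adj x a, G.Adj x b, G.Adj x c) : Prop × Prop × Prop))
    (fun x _ => Finset.mem_univ _) _ fun π _ => ?_
  rcases ((rare G k E a b c).filter fun x => (G.Adj x a, G.Adj x b, G.Adj x c) = π).eq_empty_or_nonempty
    with h0 | ⟨x, hx⟩
  · rw [h0]
    simp
  simp only [rare, Finset.mem_filter, Finset.mem_univ, true_and] at hx
  obtain ⟨⟨hxT, few⟩, rfl⟩ := hx
  rw [← Finset.card_erase_add_one (a := x) (by simp [rare, hxT, few])]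
  refine Nat.add_le_add_right (few _ fun y hy => ?_) 1
  simp only [rare, Finset.mem_erase, Finset.mem_filter, Finset.mem_univ, true_and,
    Prod.mk.injEq, eq_iff_iff] at hy
  obtain ⟨hyx, ⟨hyT, -⟩, hadj⟩ := hy
  refine ⟨hyx, ?_, ?_, ?_, hadj⟩ <;> rintro rfl <;> contradiction

/-- The triangle of the paw that makes `x` irreplaceable cannot survive in `H`. If one of `a b c` is
untouched, the ends of a deleted triangle edge are the other two, and the untouched one plays the
role of `r`. -/
theorem charged (h : Solved G k E H) {x u : V} (hxu : G.Adj x u) (hx : ¬ NearTriangle H x)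
    (hxT : x ∉ touched E) :
    (∃ a ∈ touched E, ∃ b ∈ touched E, ∃ c ∈ touched E, x ∈ rare G k E a b c) ∨
      ∃ p ∈ touched E, ∃ q ∈ touched E, x ∈ chargedTo G k E H p q := by
  have hrep := h.irreducible.not_replaceable x u hxu
  simp only [Replaceable, not_forall, not_lt] at hrep
  obtain ⟨a, b, c, ⟨hbx, hcx, hca, hcb, hspan⟩, hcard⟩ := hrep
  have few : Few G k x a b c := fun S hS =>
    (Finset.card_le_card fun y hy => by simpa using hS y hy).trans hcard
  by_cases hall : a ∈ touched E ∧ b ∈ touched E ∧ c ∈ touched E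
  · exact .inl ⟨a, hall.1, b, hall.2.1, c, hall.2.2, by simpa [rare] using ⟨hxT, few⟩⟩
  refine .inr ?_
  have inE : ∀ {u v : V}, G.Adj u v → ¬ H.Adj u v → s(u, v) ∈ E := by
    intro u v h1 h2
    rw [h.adj_iff] at h2
    tauto
  rcases hspan with ⟨hxa, hxb, hab, hc⟩ | ⟨hab, hbc, hac, hxa⟩
  -- The triangle is `x a b`. Edges at the untouched `x` survive, so `a b` is the deleted one.
  · rw [h.adj_left hxT] at hxa hxb
    have hE := inE hab (no_triangle hx (.refl _) hxa hxb)
    have ha := mem_touched_left hE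
    have hb := mem_touched_right hE
    have hcT : c ∉ touched E := by tauto
    rw [h.adj_left hcT, h.adj_left hcT] at hc
    by_cases hca : H.Adj c a
    · exact ⟨a, ha, b, hb, h.mem_chargedTo_of_common hx hxT hxa hxb hca few⟩
    · exact ⟨a, ha, b, hb, h.mem_chargedTo_of_pendant hx hE hab hcT
        (hc.resolve_right hca).symm hxa hxb⟩
  · rw [h.adj_left hxT] at hxa
    have hxaR := hxa.reachable
    have key : ∀ p q r, s(p, q) ∈ E → G.Adj p q → r ∉ touched E → H.Adj x p ∨ H.Adj x r →
        G.Adj r p → G.Adj r q → Few G k x p q r →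
        ∃ p ∈ touched E, ∃ q ∈ touched E, x ∈ chargedTo G k E H p q := by
      intro p q r hE hpq hr hx' hrp hrq few
      rw [h.adj_left hr] at hrp hrq
      refine ⟨p, mem_touched_left hE, q, mem_touched_right hE, ?_⟩
      rcases hx' with hxp | hxr
      · exact h.mem_chargedTo_of_adj_left hx hxT (mem_touched_right hE) hxp hrp hrq few
      · exact h.mem_chargedTo_of_adj_right hx hE hpq hxT hxr hrp hrq few
    -- The triangle is `a b c`, with `x` attached to `a`. Then `a` is an end of the deleted edge or
    -- the corner opposite to it.
    by_cases h1 : H.Adj a b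
    · by_cases h2 : H.Adj a c
      · have hE := inE hbc (no_triangle hx hxaR h1 h2)
        have hb := mem_touched_left hE
        have hc := mem_touched_right hE
        exact key b c a hE hbc (by tauto) (.inr hxa) hab hac few.swap_left.swap_right
      · have hE := inE hac h2
        have ha := mem_touched_left hE
        have hc := mem_touched_right hE
        exact key a c b hE hac (by tauto) (.inl hxa) hab.symm hbc few.swap_right
    · have hE := inE hab h1
      have ha := mem_touched_left hE
      have hb := mem_touched_right hE
      exact key a b c hE hab (by tauto) (.inl hxa) hac.symm hbc.symm few

/-- The untouched vertices in triangle-free components. -/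
theorem card_not_nearTriangle_le (h : Solved G k E H) :
    (Finset.univ.filter fun x => x ∉ touched E ∧ ¬ NearTriangle H x ∧ ∃ u, G.Adj x u).card ≤
      2 * k * (2 * k * (2 * k * ((k + 1) * 8))) +
        2 * k * (2 * k * (k + ((k + 2) + ((k + 1) + k * (k + 1))))) := by
  have hT : (touched E).card ≤ 2 * k :=
    (card_touched_le E).trans (Nat.mul_le_mul_left 2 h.card_le)
  have hsub : (Finset.univ.filter fun x => x ∉ touched E ∧ ¬ NearTriangle H x ∧ ∃ u, G.Adj x u) ⊆
      ((touched E).biUnion fun a => (touched E).biUnion fun b => (touched E).biUnion fun c =>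
        rare G k E a b c) ∪
      ((touched E).biUnion fun p => (touched E).biUnion fun q => chargedTo G k E H p q) := by
    intro x hx
    simp only [Finset.mem_filter, Finset.mem_univ, true_and] at hx
    obtain ⟨hxT, hx, u, hxu⟩ := hx
    simp only [Finset.mem_biUnion, Finset.mem_union]
    exact h.charged hxu hx hxT
  refine (Finset.card_le_card hsub).trans
    ((Finset.card_union_le _ _).trans (Nat.add_le_add ?_ ?_))
  · refine (Finset.card_biUnion_le_card_mul _ _ _ fun a ha => ?_).trans (Nat.mul_le_mul_right _ hT)
    refine (Finset.card_biUnion_le_card_mul _ _ _ fun b hb => ?_).trans (Nat.mul_le_mul_right _ hT)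
    refine (Finset.card_biUnion_le_card_mul _ _ _ fun c hc => ?_).trans (Nat.mul_le_mul_right _ hT)
    exact card_rare_le ha hb hc
  · refine (Finset.card_biUnion_le_card_mul _ _ _ fun a ha => ?_).trans (Nat.mul_le_mul_right _ hT)
    refine (Finset.card_biUnion_le_card_mul _ _ _ fun b hb => ?_).trans (Nat.mul_le_mul_right _ hT)
    exact card_chargedTo_le a b

end Solved

/-- Irreducible yes-instances have `O(k ^ 4)` vertices that are not isolated. -/
theorem Irreducible.card_le {V : Type*} [Fintype V] {G : SimpleGraph V} {k : ℕ}
    (hG : Irreducible G k) (hyes : PawFreeEdgeDeletion G k) :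
    (Finset.univ.filter fun x => ∃ u, G.Adj x u).card ≤ 278 * k ^ 4 := by
  obtain ⟨E, -, hE, hfree⟩ := hyes
  have h : Solved G k E (G.deleteEdges (E : Set (Sym2 V))) :=
    ⟨hG, hE, fun u v => by simp [SimpleGraph.deleteEdges_adj], hfree⟩
  have hsub : (Finset.univ.filter fun x => ∃ u, G.Adj x u) ⊆ touched E ∪
      ((Finset.univ.filter fun x => x ∉ touched E ∧
        NearTriangle (G.deleteEdges (E : Set (Sym2 V))) x) ∪
      (Finset.univ.filter fun x => x ∉ touched E ∧
        ¬ NearTriangle (G.deleteEdges (E : Set (Sym2 V))) x ∧ ∃ u, G.Adj x u)) := by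
    intro x hx
    simp only [Finset.mem_filter, Finset.mem_univ, true_and, Finset.mem_union] at hx ⊢
    tauto
  have hT : (touched E).card ≤ 2 * k := (card_touched_le E).trans (Nat.mul_le_mul_left 2 hE)
  have hle := (Finset.card_le_card hsub).trans ((Finset.card_union_le _ _).trans
    (Nat.add_le_add hT ((Finset.card_union_le _ _).trans
      (Nat.add_le_add h.card_nearTriangle_le h.card_not_nearTriangle_le))))
  refine hle.trans ?_
  rcases Nat.eq_zero_or_pos k with rfl | hk
  · simp
  -- The sum of all bounds is 68k^4 + 84k^3 + 48k^2 + 78k, and the coefficients add up to 278.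
  have h1 : k ≤ k ^ 4 := Nat.le_self_pow (by norm_num) k
  have h2 : k ^ 2 ≤ k ^ 4 := Nat.pow_le_pow_right hk (by norm_num)
  have h3 : k ^ 3 ≤ k ^ 4 := Nat.pow_le_pow_right hk (by norm_num)
  ring_nf
  omega

/-! ### The kernelization on graphs -/

/-- `iter f m a` applies `f 0, …, f (m - 1)` to `a`, one after the other. -/
def iter {α : Type*} (f : ℕ → α → α) : ℕ → α → α
  | 0, a => a
  | m + 1, a => f m (iter f m a)

section Reduction

variable {n : ℕ}

/-- Apply the first applicable rule for the pair `(p, q)`. -/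
def reduceAt (p q : Fin n) (I : SimpleGraph (Fin n) × ℕ) : SimpleGraph (Fin n) × ℕ :=
  if Replaceable I.1 I.2 p ∨ InMultipartiteComponent I.1 p then (isolate I.1 {p}, I.2)
  else if InManyParts I.1 I.2 p then (isolate I.1 {y | FalseTwins I.1 p y}, I.2)
  else if Forced I.1 I.2 p q then (I.1.deleteEdges {s(p, q)}, I.2 - 1)
  else I

theorem reduceAt_iff (p q : Fin n) (I : SimpleGraph (Fin n) × ℕ) :
    PawFreeEdgeDeletion (reduceAt p q I).1 (reduceAt p q I).2 ↔ PawFreeEdgeDeletion I.1 I.2 := by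
  unfold reduceAt
  split_ifs with h1 h2 h3
  · rcases h1 with h1 | h1
    · exact h1.isolate_iff.symm
    · exact h1.isolate_iff.symm
  · exact h2.isolate_iff.symm
  · exact h3.deleteEdges_iff.symm
  · rfl

/-- `J` is `I` or arises from `I` by deleting at least one edge. -/
def Shrunk (I J : SimpleGraph (Fin n) × ℕ) : Prop :=
  J = I ∨ (J.1 < I.1 ∧ J.2 ≤ I.2)

theorem Shrunk.trans {I J K : SimpleGraph (Fin n) × ℕ} (h : Shrunk I J) (h' : Shrunk J K) :
    Shrunk I K := by
  rcases h with rfl | ⟨h1, h2⟩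
  · exact h'
  rcases h' with rfl | ⟨h3, h4⟩
  · exact .inr ⟨h1, h2⟩
  · exact .inr ⟨h3.trans h1, h4.trans h2⟩

theorem Shrunk.antisymm {I J : SimpleGraph (Fin n) × ℕ} (h : Shrunk I J) (h' : Shrunk J I) :
    J = I := by
  rcases h with rfl | ⟨h1, -⟩
  · rfl
  rcases h' with rfl | ⟨h2, -⟩
  · rfl
  · exact absurd (h1.trans h2) (lt_irrefl _)

theorem Shrunk.snd_le {I J : SimpleGraph (Fin n) × ℕ} (h : Shrunk I J) : J.2 ≤ I.2 := by
  rcases h with rfl | h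
  · exact le_rfl
  · exact h.2

theorem shrunk_isolate (I : SimpleGraph (Fin n) × ℕ) (S : Set (Fin n)) :
    Shrunk I (isolate I.1 S, I.2) := by
  rcases (isolate_le I.1 S).eq_or_lt with h | h
  · exact .inl (Prod.ext h rfl)
  · exact .inr ⟨h, le_rfl⟩

theorem deleteEdges_singleton_lt {G : SimpleGraph (Fin n)} {p q : Fin n} (h : G.Adj p q) :
    G.deleteEdges {s(p, q)} < G := by
  refine lt_of_le_of_ne (SimpleGraph.deleteEdges_le _) fun heq => ?_
  rw [← heq, SimpleGraph.deleteEdges_adj] at h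
  exact h.2 rfl

theorem shrunk_reduceAt (p q : Fin n) (I : SimpleGraph (Fin n) × ℕ) :
    Shrunk I (reduceAt p q I) := by
  unfold reduceAt
  split_ifs with h1 h2 h3
  · exact shrunk_isolate _ _
  · exact shrunk_isolate _ _
  · exact .inr ⟨deleteEdges_singleton_lt h3.1, Nat.sub_le _ _⟩
  · exact .inl rfl

/-- A rule that applies at a non-isolated vertex removes an edge, so a fixed instance admits none.
The rules are excluded in the order in which they are tried. At an isolated vertex an earlier rule
may fire without effect, but a forced edge has no isolated end. -/
theorem irreducible_of_reduceAt_eq {I : SimpleGraph (Fin n) × ℕ}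
    (h : ∀ p q, reduceAt p q I = I) : Irreducible I.1 I.2 := by
  have h1 : ∀ p u, I.1.Adj p u → ¬ (Replaceable I.1 I.2 p ∨ InMultipartiteComponent I.1 p) := by
    intro p u hpu hp
    have := h p p
    rw [reduceAt, if_pos hp] at this
    rw [← this] at hpu
    exact hpu.2.1 rfl
  have h2 : ∀ p u, I.1.Adj p u → ¬ InManyParts I.1 I.2 p := by
    intro p u hpu hp
    have := h p p
    rw [reduceAt, if_neg (h1 p u hpu), if_pos hp] at this
    have hpu' := hpu
    rw [← this] at hpu'
    exact hpu'.2.1 (FalseTwins.refl _ _)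
  refine ⟨fun p u hpu hp => h1 p u hpu (.inl hp), fun p u hpu hp => h1 p u hpu (.inr hp), h2,
    fun p q hpq => ?_⟩
  have := h p q
  rw [reduceAt, if_neg (h1 p q hpq.1), if_neg (h2 p q hpq.1), if_pos hpq] at this
  exact (deleteEdges_singleton_lt hpq.1).ne (congrArg Prod.fst this)

theorem shrunk_iter {f : ℕ → SimpleGraph (Fin n) × ℕ → SimpleGraph (Fin n) × ℕ}
    (hf : ∀ j I, Shrunk I (f j I)) (m : ℕ) (I : SimpleGraph (Fin n) × ℕ) :
    Shrunk I (iter f m I) := by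
  induction m with
  | zero => exact .inl rfl
  | succ m ih => exact ih.trans (hf m _)

/-- A step that changes the instance strictly shrinks the graph, and nothing restores edges. A
sequence of steps that ends where it began has therefore not moved at all. -/
theorem eq_of_iter_eq {f : ℕ → SimpleGraph (Fin n) × ℕ → SimpleGraph (Fin n) × ℕ}
    (hf : ∀ j I, Shrunk I (f j I)) {m : ℕ} {I : SimpleGraph (Fin n) × ℕ}
    (h : iter f m I = I) {j : ℕ} (hj : j < m) : f j I = I := by
  induction m with
  | zero => omega
  | succ m ih =>
    have h1 : Shrunk (iter f m I) I := by
      have := hf m (iter f m I)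
      rwa [show f m (iter f m I) = I from h] at this
    have h2 : iter f m I = I := (shrunk_iter hf m I).antisymm h1
    rcases Nat.lt_succ_iff_lt_or_eq.1 hj with hj | rfl
    · exact ih h2 hj
    · conv_rhs => rw [← h]
      change _ = f j (iter f j I)
      rw [h2]

theorem iter_iff {f : ℕ → SimpleGraph (Fin n) × ℕ → SimpleGraph (Fin n) × ℕ}
    (hf : ∀ j I, PawFreeEdgeDeletion (f j I).1 (f j I).2 ↔ PawFreeEdgeDeletion I.1 I.2) (m : ℕ)
    (I : SimpleGraph (Fin n) × ℕ) :
    PawFreeEdgeDeletion (iter f m I).1 (iter f m I).2 ↔ PawFreeEdgeDeletion I.1 I.2 := by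
  induction m with
  | zero => rfl
  | succ m ih => exact (hf m _).trans ih

/-- The number of ordered pairs of adjacent vertices. -/
def dartCount (G : SimpleGraph (Fin n)) : ℕ :=
  (Finset.univ.filter fun e : Fin n × Fin n => G.Adj e.1 e.2).card

theorem dartCount_le (G : SimpleGraph (Fin n)) : dartCount G ≤ n * n :=
  (Finset.card_filter_le _ _).trans (by simp)

theorem dartCount_lt {G G' : SimpleGraph (Fin n)} (h : G < G') : dartCount G < dartCount G' := by
  refine Finset.card_lt_card ((Finset.ssubset_iff_of_subset ?_).2 ?_)
  · intro e he
    simp only [Finset.mem_filter, Finset.mem_univ, true_and] at he ⊢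
    exact h.le he
  · by_contra! hcon
    refine h.not_ge fun u v huv => ?_
    simpa using hcon (u, v) (by simpa using huv)

/-- Every round that is not stationary loses a dart, and there are at most n^2 darts. -/
theorem iter_fixed {g : SimpleGraph (Fin n) × ℕ → SimpleGraph (Fin n) × ℕ}
    (hg : ∀ I, Shrunk I (g I)) (I : SimpleGraph (Fin n) × ℕ) :
    g (iter (fun _ => g) (n * n) I) = iter (fun _ => g) (n * n) I := by
  have key : ∀ m, g (iter (fun _ => g) m I) = iter (fun _ => g) m I ∨
      dartCount (g (iter (fun _ => g) m I)).1 + m < dartCount I.1 := by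
    intro m
    induction m with
    | zero =>
      rcases hg I with h | h
      · exact .inl h
      · exact .inr (dartCount_lt h.1)
    | succ m ih =>
      rcases ih with ih | ih
      · left
        change g (g _) = g _
        rw [ih, ih]
      · rcases hg (iter (fun _ => g) (m + 1) I) with h | h
        · exact .inl h
        · right
          have h1 := dartCount_lt h.1
          change _ < dartCount (g (iter (fun _ => g) m I)).1 at h1
          omega
  rcases key (n * n) with h | h
  · exact h
  · have := dartCount_le I.1
    omega

/-- `reduceAt` for numbers instead of vertices. -/
def reduceNat (p q : ℕ) (I : SimpleGraph (Fin n) × ℕ) : SimpleGraph (Fin n) × ℕ :=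
  if h : p < n ∧ q < n then reduceAt ⟨p, h.1⟩ ⟨q, h.2⟩ I else I

theorem reduceNat_coe (p q : Fin n) (I : SimpleGraph (Fin n) × ℕ) :
    reduceNat p q I = reduceAt p q I := by
  simp [reduceNat]

/-- Try all rules at all pairs of vertices. -/
def sweep (I : SimpleGraph (Fin n) × ℕ) : SimpleGraph (Fin n) × ℕ :=
  iter (fun p => iter (fun q => reduceNat p q) n) n I

/-- The exhaustive application of the rules. -/
def reduce (I : SimpleGraph (Fin n) × ℕ) : SimpleGraph (Fin n) × ℕ :=
  iter (fun _ => sweep) (n * n) I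

theorem shrunk_reduceNat (p q : ℕ) (I : SimpleGraph (Fin n) × ℕ) :
    Shrunk I (reduceNat p q I) := by
  unfold reduceNat
  split_ifs
  · exact shrunk_reduceAt _ _ _
  · exact .inl rfl

theorem shrunk_sweep (I : SimpleGraph (Fin n) × ℕ) : Shrunk I (sweep I) :=
  shrunk_iter (fun p => shrunk_iter (shrunk_reduceNat p) n) n I

theorem shrunk_reduce (I : SimpleGraph (Fin n) × ℕ) : Shrunk I (reduce I) :=
  shrunk_iter (fun _ => shrunk_sweep) _ I

theorem reduce_iff (I : SimpleGraph (Fin n) × ℕ) :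
    PawFreeEdgeDeletion (reduce I).1 (reduce I).2 ↔ PawFreeEdgeDeletion I.1 I.2 := by
  refine iter_iff (fun _ => iter_iff (fun p => iter_iff (fun q I => ?_) n) n) _ I
  unfold reduceNat
  split_ifs
  · exact reduceAt_iff _ _ _
  · rfl

theorem irreducible_reduce (I : SimpleGraph (Fin n) × ℕ) :
    Irreducible (reduce I).1 (reduce I).2 := by
  refine irreducible_of_reduceAt_eq fun p q => ?_
  rw [← reduceNat_coe]
  exact eq_of_iter_eq (shrunk_reduceNat p)
    (eq_of_iter_eq (fun p => shrunk_iter (shrunk_reduceNat p) n) (iter_fixed shrunk_sweep I) p.2)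
    q.2

/-- More than `n * n` deletions are never needed. -/
theorem pawFreeEdgeDeletion_min (G : SimpleGraph (Fin n)) (k : ℕ) :
    PawFreeEdgeDeletion G (min k (n * n)) ↔ PawFreeEdgeDeletion G k := by
  refine ⟨fun h => h.mono (min_le_left _ _), ?_⟩
  rintro ⟨E, h1, h2, h3⟩
  refine ⟨E, h1, le_min h2 ?_, h3⟩
  have hle : E.card ≤ (Finset.univ : Finset (Fin n × Fin n)).card := by
    refine Finset.card_le_card_of_surjOn (fun e => s(e.1, e.2)) ?_
    intro e _
    induction e with
    | _ u v => exact ⟨(u, v), by simp, rfl⟩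
  simpa using hle

/-! ### Removing isolated vertices -/

/-- The vertices that are not isolated. -/
def support (G : SimpleGraph (Fin n)) : Finset (Fin n) :=
  Finset.univ.filter fun x => ∃ u, G.Adj x u

/-- The number of vertices before `u` that are not isolated. -/
def rank (G : SimpleGraph (Fin n)) (u : Fin n) : ℕ :=
  ((support G).filter (· < u)).card

/-- The graph without its isolated vertices. -/
def compress (G : SimpleGraph (Fin n)) : SimpleGraph (Fin (support G).card) where
  Adj i j := ∃ u v, G.Adj u v ∧ rank G u = i ∧ rank G v = j
  symm := ⟨fun _ _ ⟨u, v, h, hi, hj⟩ => ⟨v, u, h.symm, hj, hi⟩⟩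
  loopless := ⟨by
    rintro i ⟨u, v, h, hu, hv⟩
    -- A non-isolated `u` is counted in the rank of every later vertex, so adjacent vertices have
    -- different ranks.
    have key : ∀ u v w, G.Adj u w → u < v → rank G u < rank G v := by
      intro u v w huw huv
      refine Finset.card_lt_card ((Finset.ssubset_iff_of_subset ?_).2 ⟨u, ?_, ?_⟩)
      · intro x hx
        simp only [Finset.mem_filter] at hx ⊢
        exact ⟨hx.1, hx.2.trans huv⟩
      · simpa [support, huv] using ⟨w, huw⟩
      · simp
    rcases lt_trichotomy u v with h1 | h1 | h1
    · exact (key u v v h h1).ne (hu.trans hv.symm)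
    · exact h.ne h1
    · exact (key v u u h.symm h1).ne (hv.trans hu.symm)⟩

/-- Ranks, which the program finds by counting, invert the increasing enumeration of the
non-isolated vertices. This makes `compress` an induced subgraph. -/
theorem rank_orderEmbOfFin (G : SimpleGraph (Fin n)) (i : Fin (support G).card) :
    rank G ((support G).orderEmbOfFin rfl i) = i := by
  have : (support G).filter (· < (support G).orderEmbOfFin rfl i) =
      (Finset.Iio i).map ((support G).orderEmbOfFin rfl).toEmbedding := by
    ext x
    simp only [Finset.mem_filter, Finset.mem_map, Finset.mem_Iio]
    constructor
    · rintro ⟨hx, hlt⟩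
      obtain ⟨j, rfl⟩ : x ∈ Set.range ((support G).orderEmbOfFin rfl) := by
        rw [Finset.range_orderEmbOfFin]
        exact hx
      exact ⟨j, by simpa using hlt, rfl⟩
    · rintro ⟨j, hj, rfl⟩
      exact ⟨Finset.orderEmbOfFin_mem _ _ _, by simpa using hj⟩
  rw [rank, this, Finset.card_map, Fin.card_Iio]

theorem compress_iff (G : SimpleGraph (Fin n)) (k : ℕ) :
    PawFreeEdgeDeletion G k ↔ PawFreeEdgeDeletion (compress G) k := by
  have hsurj : ∀ u v, G.Adj u v → ∃ i, (support G).orderEmbOfFin rfl i = u := by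
    intro u v huv
    have : u ∈ Set.range ((support G).orderEmbOfFin rfl) := by
      rw [Finset.range_orderEmbOfFin]
      simpa [support] using ⟨v, huv⟩
    exact this
  refine pawFreeEdgeDeletion_of_embedding
    ⟨((support G).orderEmbOfFin rfl).toEmbedding, ?_⟩ hsurj
  intro i j
  constructor
  · intro h
    exact ⟨_, _, h, rank_orderEmbOfFin G i, rank_orderEmbOfFin G j⟩
  · rintro ⟨u, v, huv, hi, hj⟩
    obtain ⟨i', rfl⟩ := hsurj u v huv
    obtain ⟨j', rfl⟩ := hsurj v _ huv.symm
    rw [rank_orderEmbOfFin] at hi hj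
    obtain rfl := Fin.ext hi
    obtain rfl := Fin.ext hj
    exact huv

end Reduction

end PawKernel

namespace PawKernel

/-! ### Expressions -/

theorem State.setReg_reg (s : State) (r v x : ℕ) :
    (s.setReg r v).reg x = if x = r then v else s.reg x := by
  simp [State.setReg, Function.update_apply]

theorem State.setReg_arr (s : State) (r v : ℕ) : (s.setReg r v).arr = s.arr := rfl

theorem State.setArr_reg (s : State) (a i v : ℕ) : (s.setArr a i v).reg = s.reg := rfl

theorem State.setArr_arr (s : State) (a i v b j : ℕ) :
    (s.setArr a i v).arr b j = if b = a ∧ j = i then v else s.arr b j := by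
  by_cases hb : b = a
  · subst hb
    simp [State.setArr, Function.update_apply]
  · simp [State.setArr, hb]

/-- `s` and `s'` have the same arrays and the same registers below `d`. -/
def Agree (d : ℕ) (s s' : State) : Prop := s'.arr = s.arr ∧ ∀ r < d, s'.reg r = s.reg r

theorem Agree.refl (d : ℕ) (s : State) : Agree d s s := ⟨rfl, fun _ _ => rfl⟩

theorem Agree.trans {d : ℕ} {s s' s'' : State} (h : Agree d s s') (h' : Agree d s' s'') :
    Agree d s s'' :=
  ⟨h'.1.trans h.1, fun r hr => (h'.2 r hr).trans (h.2 r hr)⟩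

theorem Agree.mono {d e : ℕ} {s s' : State} (hde : d ≤ e) (h : Agree e s s') : Agree d s s' :=
  ⟨h.1, fun r hr => h.2 r (hr.trans_le hde)⟩

theorem Agree.setReg_right {d r v : ℕ} {s s' : State} (h : Agree d s s') (hr : d ≤ r) :
    Agree d s (s'.setReg r v) := by
  refine ⟨h.1, fun x hx => ?_⟩
  rw [State.setReg_reg, if_neg (by omega), h.2 x hx]

theorem Agree.setReg {d r v : ℕ} {s s' : State} (h : Agree d s s') :
    Agree d (s.setReg r v) (s'.setReg r v) := by
  refine ⟨h.1, fun x hx => ?_⟩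
  rw [State.setReg_reg, State.setReg_reg, h.2 x hx]

/-- Arithmetic expressions over the registers and arrays, with bounded sums. -/
inductive Expr where
  /-- a number -/
  | const (c : ℕ)
  /-- the content of a register -/
  | var (r : ℕ)
  /-- a sum -/
  | add (a b : Expr)
  /-- a truncated difference -/
  | sub (a b : Expr)
  /-- a cell of the array `a` -/
  | get (a : ℕ) (e : Expr)
  /-- `a` if `c` is not zero, and `b` otherwise -/
  | ite (c a b : Expr)
  /-- the sum of `e` over all values of register `i` below the content of register `r` -/
  | sum (i r : ℕ) (e : Expr)

namespace Expr

/-- The value of an expression. -/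
def eval : Expr → State → ℕ
  | const c, _ => c
  | var r, s => s.reg r
  | add a b, s => a.eval s + b.eval s
  | sub a b, s => a.eval s - b.eval s
  | get a e, s => s.arr a (e.eval s)
  | ite c a b, s => if c.eval s ≠ 0 then a.eval s else b.eval s
  | sum i r e, s => ∑ j ∈ Finset.range (s.reg r), e.eval (s.setReg i j)

/-- All registers mentioned are below `d`. -/
def Below (d : ℕ) : Expr → Prop
  | const _ => True
  | var r => r < d
  | add a b => a.Below d ∧ b.Below d
  | sub a b => a.Below d ∧ b.Below d
  | get _ e => e.Below d
  | ite c a b => c.Below d ∧ a.Below d ∧ b.Below d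
  | sum i r e => i < d ∧ r < d ∧ e.Below d

/-- A program that computes the expression into register `d`. -/
def compile : Expr → ℕ → Prog
  | const c, d => .instr (.const d c)
  | var r, d => .instr (.move d r)
  | add a b, d => .seq (a.compile d) (.seq (b.compile (d + 1)) (.instr (.add d d (d + 1))))
  | sub a b, d => .seq (a.compile d) (.seq (b.compile (d + 1)) (.instr (.sub d d (d + 1))))
  | get a e, d => .seq (e.compile d) (.instr (.load d a d))
  | ite c a b, d => .seq (c.compile d) (.cond d (a.compile d) (b.compile d))
  | sum i r e, d =>
    .seq (.instr (.const d 0)) (.seq (.instr (.move (d + 1) r)) (.seq (.instr (.move (d + 2) i))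
      (.seq (.instr (.const (d + 3) 1)) (.seq (.instr (.const i 0))
        (.seq (.loop (d + 1)
          (.seq (e.compile (d + 4)) (.seq (.instr (.add d d (d + 4)))
            (.seq (.instr (.add i i (d + 3))) (.instr (.sub (d + 1) (d + 1) (d + 3)))))))
          (.instr (.move i (d + 2))))))))

/-- A bound for the running time of `compile`, in terms of a bound for the registers. -/
def time : Expr → Polynomial ℕ
  | const _ => 1
  | var _ => 1
  | add a b => a.time + b.time + 1
  | sub a b => a.time + b.time + 1
  | get _ e => e.time + 1
  | ite c a b => c.time + (a.time + b.time) + 1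
  | sum _ _ e => Polynomial.X * (e.time + Polynomial.C 4) + Polynomial.C 7

theorem eval_congr {d : ℕ} : ∀ (e : Expr) {s s' : State}, e.Below d → Agree d s s' →
    e.eval s' = e.eval s
  | const _, _, _, _, _ => rfl
  | var r, _, _, h, hs => hs.2 r h
  | add a b, _, _, h, hs => by simp only [eval, a.eval_congr h.1 hs, b.eval_congr h.2 hs]
  | sub a b, _, _, h, hs => by simp only [eval, a.eval_congr h.1 hs, b.eval_congr h.2 hs]
  | get a e, _, _, h, hs => by simp only [eval, e.eval_congr h hs, hs.1]
  | ite c a b, _, _, h, hs => by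
    simp only [eval, c.eval_congr h.1 hs, a.eval_congr h.2.1 hs, b.eval_congr h.2.2 hs]
  | sum i r e, _, _, h, hs => by
    simp only [eval, hs.2 r h.2.1]
    exact Finset.sum_congr rfl fun j _ => e.eval_congr h.2.2 hs.setReg

/-- Structural induction. Intermediate results sit in registers from `d` upward, so nested code
leaves earlier ones intact. The number of rounds of each sum is a register below `D`, hence at most
`N`. -/
theorem compile_spec {D N : ℕ} : ∀ (e : Expr) {d : ℕ} {s : State}, e.Below D → D ≤ d →
    (∀ r < D, s.reg r ≤ N) → ∃ t s', Exec (e.compile d) s t s' ∧ t ≤ e.time.eval N ∧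
      s'.reg d = e.eval s ∧ Agree d s s'
  | const c, d, s, _, _, _ => ⟨1, _, .instr _ _, by simp [time],
      by simp [Instr.eval, State.setReg_reg, eval], (Agree.refl d s).setReg_right le_rfl⟩
  | var r, d, s, _, _, _ => ⟨1, _, .instr _ _, by simp [time],
      by simp [Instr.eval, State.setReg_reg, eval], (Agree.refl d s).setReg_right le_rfl⟩
  | add a b, d, s, h, hd, hN => by
    obtain ⟨t₁, s₁, e₁, ht₁, hr₁, ha₁⟩ := a.compile_spec h.1 hd hN
    obtain ⟨t₂, s₂, e₂, ht₂, hr₂, ha₂⟩ := b.compile_spec (d := d + 1) (s := s₁) h.2 (by omega)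
      fun r hr => by rw [ha₁.2 r (by omega)]; exact hN r hr
    refine ⟨_, _, .seq e₁ (.seq e₂ (.instr _ _)), ?_, ?_, ?_⟩
    · simp only [time, Polynomial.eval_add, Polynomial.eval_one]
      omega
    · simp only [Instr.eval, State.setReg_reg, if_true, eval]
      rw [hr₂, ha₂.2 d (by omega), hr₁, b.eval_congr h.2 (ha₁.mono hd)]
    · exact (ha₁.trans (ha₂.mono (by omega))).setReg_right le_rfl
  | sub a b, d, s, h, hd, hN => by
    obtain ⟨t₁, s₁, e₁, ht₁, hr₁, ha₁⟩ := a.compile_spec h.1 hd hN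
    obtain ⟨t₂, s₂, e₂, ht₂, hr₂, ha₂⟩ := b.compile_spec (d := d + 1) (s := s₁) h.2 (by omega)
      fun r hr => by rw [ha₁.2 r (by omega)]; exact hN r hr
    refine ⟨_, _, .seq e₁ (.seq e₂ (.instr _ _)), ?_, ?_, ?_⟩
    · simp only [time, Polynomial.eval_add, Polynomial.eval_one]
      omega
    · simp only [Instr.eval, State.setReg_reg, if_true, eval]
      rw [hr₂, ha₂.2 d (by omega), hr₁, b.eval_congr h.2 (ha₁.mono hd)]
    · exact (ha₁.trans (ha₂.mono (by omega))).setReg_right le_rfl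
  | get a e, d, s, h, hd, hN => by
    obtain ⟨t₁, s₁, e₁, ht₁, hr₁, ha₁⟩ := e.compile_spec h hd hN
    refine ⟨_, _, .seq e₁ (.instr _ _), ?_, ?_, ?_⟩
    · simp only [time, Polynomial.eval_add, Polynomial.eval_one]
      omega
    · simp only [Instr.eval, State.setReg_reg, if_true, eval]
      rw [hr₁, ha₁.1]
    · exact ha₁.setReg_right le_rfl
  | ite c a b, d, s, h, hd, hN => by
    obtain ⟨t₁, s₁, e₁, ht₁, hr₁, ha₁⟩ := c.compile_spec h.1 hd hN
    have hN₁ : ∀ r < D, s₁.reg r ≤ N := fun r hr => by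
      rw [ha₁.2 r (by omega)]; exact hN r hr
    by_cases hc : c.eval s = 0
    · obtain ⟨t₂, s₂, e₂, ht₂, hr₂, ha₂⟩ := b.compile_spec h.2.2 hd hN₁
      refine ⟨_, _, .seq e₁ (.cond_false (hr₁.trans hc) e₂), ?_, ?_, ha₁.trans ha₂⟩
      · simp only [time, Polynomial.eval_add, Polynomial.eval_one]
        omega
      · rw [hr₂, b.eval_congr h.2.2 (ha₁.mono hd), eval, if_neg (by simpa using hc)]
    · obtain ⟨t₂, s₂, e₂, ht₂, hr₂, ha₂⟩ := a.compile_spec h.2.1 hd hN₁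
      refine ⟨_, _, .seq e₁ (.cond_true (by rwa [hr₁]) e₂), ?_, ?_, ha₁.trans ha₂⟩
      · simp only [time, Polynomial.eval_add, Polynomial.eval_one]
        omega
      · rw [hr₂, a.eval_congr h.2.1 (ha₁.mono hd), eval, if_pos hc]
  | sum i r e, d, s, h, hd, hN => by
    obtain ⟨hi, hr, he⟩ := h
    -- With `m` rounds left, register `i` holds the summation index `j`, `d` the partial sum, `d +
    -- 1` the remaining rounds, `d + 2` the saved value of `i`, and `d + 3` the constant 1.
    have loop : ∀ (m j : ℕ) (s₁ : State), j + m ≤ s.reg r → s₁.reg (d + 1) = m →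
        s₁.reg (d + 3) = 1 → Agree D (s.setReg i j) s₁ →
        (∀ x < d, x ≠ i → s₁.reg x = s.reg x) →
        ∃ t s₂, Exec (.loop (d + 1)
          (.seq (e.compile (d + 4)) (.seq (.instr (.add d d (d + 4)))
            (.seq (.instr (.add i i (d + 3))) (.instr (.sub (d + 1) (d + 1) (d + 3))))))) s₁ t s₂ ∧
          t ≤ m * (e.time.eval N + 4) + 1 ∧
          s₂.reg d = s₁.reg d + ∑ l ∈ Finset.range m, e.eval (s.setReg i (j + l)) ∧
          s₂.reg (d + 2) = s₁.reg (d + 2) ∧ s₂.arr = s.arr ∧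
          ∀ x < d, x ≠ i → s₂.reg x = s.reg x := by
      intro m
      induction m with
      | zero =>
        intro j s₁ _ h1 _ h3 h4
        exact ⟨1, s₁, .loop_done h1, by simp, by simp, rfl, h3.1, h4⟩
      | succ m ih =>
        intro j s₁ hj h1 h2 h3 h4
        obtain ⟨t₁, s₂, e₁, ht₁, hr₁, ha₁⟩ := e.compile_spec (N := N) (d := d + 4) (s := s₁) he (by omega)
          fun x hx => by
            rw [h3.2 x hx, State.setReg_reg]
            split_ifs
            · have := hN r hr
              omega
            · exact hN x hx
        obtain ⟨t₂, s₃, e₂, ht₂, hr₂, hs₂, hs₃, hs₄⟩ := ih (j + 1)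
          (((s₂.setReg d (s₂.reg d + s₂.reg (d + 4))).setReg i (j + 1)).setReg (d + 1) m)
          (by omega) (by simp [State.setReg_reg])
          (by simp only [State.setReg_reg]
              rw [if_neg (by omega), if_neg (by omega), if_neg (by omega), ha₁.2 _ (by omega), h2])
          (by
            refine ⟨ha₁.1.trans h3.1, fun x hx => ?_⟩
            simp only [State.setReg_reg]
            rw [if_neg (by omega)]
            split_ifs with hxi hxd
            · rfl
            · omega
            · rw [ha₁.2 x (by omega), h3.2 x hx, State.setReg_reg, if_neg hxi])
          (by
            intro x hx hxi
            simp only [State.setReg_reg]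
            rw [if_neg (by omega), if_neg hxi, if_neg (by omega), ha₁.2 x (by omega), h4 x hx hxi])
        refine ⟨t₁ + (1 + (1 + 1)) + t₂ + 1, s₃, .loop_step (by omega)
          (.seq e₁ (.seq (.instr _ _) (.seq (.instr _ _) (.instr _ _)))) ?_, ?_, ?_, ?_, hs₃, hs₄⟩
        · have hi₁ : s₁.reg i = j := by
            rw [h3.2 i hi, State.setReg_reg, if_pos rfl]
          have hstate : (Instr.sub (d + 1) (d + 1) (d + 3)).eval ((Instr.add i i (d + 3)).eval
              ((Instr.add d d (d + 4)).eval s₂)) =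
              ((s₂.setReg d (s₂.reg d + s₂.reg (d + 4))).setReg i (j + 1)).setReg (d + 1) m := by
            have a1 : s₂.reg i = j := by rw [ha₁.2 i (by omega), hi₁]
            have a2 : s₂.reg (d + 3) = 1 := by rw [ha₁.2 _ (by omega), h2]
            have a3 : s₂.reg (d + 1) = m + 1 := by rw [ha₁.2 _ (by omega), h1]
            have b1 : i ≠ d := by omega
            have b2 : d + 1 ≠ i := by omega
            have b3 : d + 3 ≠ i := by omega
            simp [Instr.eval, State.setReg_reg, a1, a2, a3, b1, b2, b3]
          rw [hstate]
          exact e₂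
        · rw [Nat.add_mul]
          omega
        · rw [hr₂, Finset.sum_range_succ']
          simp only [State.setReg_reg, if_true]
          rw [if_neg (by omega), if_neg (by omega), ha₁.2 d (by omega), hr₁,
            e.eval_congr he h3]
          simp only [Nat.add_zero, Nat.add_assoc, Nat.add_comm 1]
          omega
        · rw [hs₂]
          simp only [State.setReg_reg]
          rw [if_neg (by omega), if_neg (by omega), if_neg (by omega), ha₁.2 _ (by omega)]
    set s₁ : State := ((((s.setReg d 0).setReg (d + 1) (s.reg r)).setReg (d + 2)
      (s.reg i)).setReg (d + 3) 1).setReg i 0 with hs₁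
    obtain ⟨t, s₂, ex, ht, hd₂, hi₂, ha₂, hx₂⟩ := loop (s.reg r) 0 s₁ (by omega)
      (by
        simp only [hs₁, State.setReg_reg]
        rw [if_neg (by omega), if_neg (by omega), if_neg (by omega), if_pos trivial])
      (by
        simp only [hs₁, State.setReg_reg]
        rw [if_neg (by omega), if_pos trivial])
      (by
        refine ⟨rfl, fun x hx => ?_⟩
        simp only [hs₁, State.setReg_reg]
        split_ifs <;> first | rfl | omega)
      (by
        intro x hx hxi
        simp only [hs₁, State.setReg_reg]
        rw [if_neg hxi, if_neg (by omega), if_neg (by omega), if_neg (by omega), if_neg (by omega)])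
    have hstate : (Instr.const i 0).eval ((Instr.const (d + 3) 1).eval ((Instr.move (d + 2) i).eval
        ((Instr.move (d + 1) r).eval ((Instr.const d 0).eval s)))) = s₁ := by
      have b1 : r ≠ d := by omega
      have b2 : i ≠ d := by omega
      have b3 : i ≠ d + 1 := by omega
      simp [hs₁, Instr.eval, State.setReg_reg, b1, b2, b3]
    rw [← hstate] at ex
    refine ⟨_, _, .seq (.instr _ _) (.seq (.instr _ _) (.seq (.instr _ _) (.seq (.instr _ _)
      (.seq (.instr _ _) (.seq ex (.instr _ _)))))), ?_, ?_, ?_⟩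
    · have h1 : s.reg r * (e.time.eval N + 4) ≤ N * (e.time.eval N + 4) :=
        Nat.mul_le_mul_right _ (hN r hr)
      simp only [time, Polynomial.eval_add, Polynomial.eval_mul, Polynomial.eval_X,
        Polynomial.eval_C]
      omega
    · have h0 : s₁.reg d = 0 := by
        simp only [hs₁, State.setReg_reg]
        rw [if_neg (by omega), if_neg (by omega), if_neg (by omega), if_neg (by omega), if_pos trivial]
      simp only [Instr.eval, State.setReg_reg, eval]
      rw [if_neg (by omega), hd₂, h0, Nat.zero_add]
      simp only [Nat.zero_add]
    · refine ⟨ha₂, fun x hx => ?_⟩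
      simp only [Instr.eval, State.setReg_reg]
      split_ifs with hxi
      · rw [hi₂, hxi]
        simp only [hs₁, State.setReg_reg]
        rw [if_neg (by omega), if_neg (by omega), if_pos trivial]
      · exact hx₂ x hx hxi

end Expr

/-! ### Statements -/

/-- Programs with assignments of expressions and bounded loops. -/
inductive Stmt where
  /-- `reg r := e` -/
  | assign (r : ℕ) (e : Expr)
  /-- `arr a i := e` -/
  | store (a : ℕ) (i e : Expr)
  /-- `p`, then `q` -/
  | seq (p q : Stmt)
  /-- `p` for all values of register `i` below the initial content of register `r` -/
  | loop (i r : ℕ) (p : Stmt)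

namespace Stmt

/-- The effect of a statement. -/
def run : Stmt → State → State
  | assign r e, s => s.setReg r (e.eval s)
  | store a i e, s => s.setArr a (i.eval s) (e.eval s)
  | seq p q, s => q.run (p.run s)
  | loop i r p, s => iter (fun j s => (p.run s).setReg i (j + 1)) (s.reg r) (s.setReg i 0)

/-- All values assigned to registers are at most `N`. -/
def Bounded (N : ℕ) : Stmt → State → Prop
  | assign _ e, s => e.eval s ≤ N
  | store _ _ _, _ => True
  | seq p q, s => p.Bounded N s ∧ q.Bounded N (p.run s)
  | loop i r p, s => ∀ j < s.reg r,
      p.Bounded N (iter (fun j s => (p.run s).setReg i (j + 1)) j (s.setReg i 0))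

/-- All registers mentioned are below `d`. -/
def Below (d : ℕ) : Stmt → Prop
  | assign r e => r < d ∧ e.Below d
  | store _ i e => i.Below d ∧ e.Below d
  | seq p q => p.Below d ∧ q.Below d
  | loop i r p => i < d ∧ r < d ∧ p.Below d

/-- A program for the statement, with auxiliary registers from `d` on. -/
def compile : Stmt → ℕ → Prog
  | assign r e, d => .seq (e.compile d) (.instr (.move r d))
  | store a i e, d => .seq (i.compile d) (.seq (e.compile (d + 1)) (.instr (.store a d (d + 1))))
  | seq p q, d => .seq (p.compile d) (q.compile d)
  | loop i r p, d =>
    .seq (.instr (.move d r)) (.seq (.instr (.const (d + 1) 1)) (.seq (.instr (.const (d + 2) 0))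
      (.seq (.instr (.move i (d + 2))) (.loop d (.seq (p.compile (d + 3))
        (.seq (.instr (.add (d + 2) (d + 2) (d + 1))) (.seq (.instr (.move i (d + 2)))
          (.instr (.sub d d (d + 1))))))))))

/-- A bound for the running time of `compile`, in terms of a bound for the registers. -/
def time : Stmt → Polynomial ℕ
  | assign _ e => e.time + 1
  | store _ i e => i.time + e.time + 1
  | seq p q => p.time + q.time
  | loop _ _ p => Polynomial.X * (p.time + Polynomial.C 4) + Polynomial.C 5

/-- The idealized state `s₀` is compared with the machine state `s` only below `D`. Registers from
`D` up to `d` are unchanged, which protects the control registers of enclosing loops and the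
original parameter in register 30. -/
theorem compile_spec {D N : ℕ} : ∀ (p : Stmt) {d : ℕ} {s s₀ : State}, p.Below D → D ≤ d →
    Agree D s₀ s → (∀ r < D, s₀.reg r ≤ N) → p.Bounded N s₀ →
    ∃ t s', Exec (p.compile d) s t s' ∧ t ≤ p.time.eval N ∧ Agree D (p.run s₀) s' ∧
      (∀ x, D ≤ x → x < d → s'.reg x = s.reg x) ∧ ∀ r < D, (p.run s₀).reg r ≤ N
  | assign r e, d, s, s₀, h, hd, hs, hN, hb => by
    obtain ⟨t₁, s₁, e₁, ht₁, hr₁, ha₁⟩ := e.compile_spec (N := N) (s := s) h.2 hd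
      fun x hx => by rw [hs.2 x hx]; exact hN x hx
    have hr := h.1
    refine ⟨_, _, .seq e₁ (.instr _ _), ?_, ⟨ha₁.1.trans hs.1, fun x hx => ?_⟩,
      fun x hx hxd => ?_, fun x hx => ?_⟩
    · simp only [time, Polynomial.eval_add, Polynomial.eval_one]
      omega
    · simp only [Instr.eval, State.setReg_reg, run]
      rw [hr₁, e.eval_congr h.2 hs, ha₁.2 x (by omega), hs.2 x hx]
    · simp only [Instr.eval, State.setReg_reg]
      rw [if_neg (by omega), ha₁.2 x hxd]
    · simp only [State.setReg_reg, run]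
      split_ifs
      · exact hb
      · exact hN x hx
  | store a i e, d, s, s₀, h, hd, hs, hN, _ => by
    obtain ⟨t₁, s₁, e₁, ht₁, hr₁, ha₁⟩ := i.compile_spec (N := N) (s := s) h.1 hd
      fun x hx => by rw [hs.2 x hx]; exact hN x hx
    obtain ⟨t₂, s₂, e₂, ht₂, hr₂, ha₂⟩ := e.compile_spec (N := N) (d := d + 1) (s := s₁) h.2
      (by omega) fun x hx => by rw [ha₁.2 x (by omega), hs.2 x hx]; exact hN x hx
    refine ⟨_, _, .seq e₁ (.seq e₂ (.instr _ _)), ?_, ⟨?_, fun x hx => ?_⟩,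
      fun x hx hxd => ?_, fun x hx => hN x hx⟩
    · simp only [time, Polynomial.eval_add, Polynomial.eval_one]
      omega
    · have hi : s₂.reg d = i.eval s₀ := by
        rw [ha₂.2 d (by omega), hr₁, i.eval_congr h.1 hs]
      have he : s₂.reg (d + 1) = e.eval s₀ := by
        rw [hr₂, e.eval_congr h.2 (hs.trans (ha₁.mono hd))]
      have ha : s₂.arr = s₀.arr := ha₂.1.trans (ha₁.1.trans hs.1)
      simp only [Instr.eval, run, State.setArr, hi, he, ha]
    · simp only [Instr.eval, State.setArr_reg, run]
      rw [ha₂.2 x (by omega), ha₁.2 x (by omega), hs.2 x hx]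
    · simp only [Instr.eval, State.setArr_reg]
      rw [ha₂.2 x (by omega), ha₁.2 x (by omega)]
  | seq p q, d, s, s₀, h, hd, hs, hN, hb => by
    obtain ⟨t₁, s₁, e₁, ht₁, ha₁, hx₁, hN₁⟩ := p.compile_spec h.1 hd hs hN hb.1
    obtain ⟨t₂, s₂, e₂, ht₂, ha₂, hx₂, hN₂⟩ := q.compile_spec h.2 hd ha₁ hN₁ hb.2
    refine ⟨_, _, .seq e₁ e₂, ?_, ha₂, fun x hx hxd => ?_, hN₂⟩
    · simp only [time, Polynomial.eval_add]
      omega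
    · rw [hx₂ x hx hxd, hx₁ x hx hxd]
  | loop i r p, d, s, s₀, h, hd, hs, hN, hb => by
    obtain ⟨hi, hr, hp⟩ := h
    set st : ℕ → State := fun j => iter (fun j s => (p.run s).setReg i (j + 1)) j (s₀.setReg i 0)
      with hst
    have hst₁ : ∀ j, st (j + 1) = (p.run (st j)).setReg i (j + 1) := fun j => rfl
    -- The index is kept in `d + 2` and copied to `i` each round, because the body may overwrite
    -- `i`.
    have loop : ∀ (m j : ℕ) (s₁ : State), j + m = s₀.reg r → s₁.reg d = m →
        s₁.reg (d + 1) = 1 → s₁.reg (d + 2) = j → Agree D (st j) s₁ →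
        (∀ x < D, (st j).reg x ≤ N) →
        ∃ t s₂, Exec (.loop d (.seq (p.compile (d + 3))
          (.seq (.instr (.add (d + 2) (d + 2) (d + 1))) (.seq (.instr (.move i (d + 2)))
            (.instr (.sub d d (d + 1))))))) s₁ t s₂ ∧
          t ≤ m * (p.time.eval N + 4) + 1 ∧ Agree D (st (j + m)) s₂ ∧
          (∀ x, D ≤ x → x < d → s₂.reg x = s₁.reg x) ∧ ∀ x < D, (st (j + m)).reg x ≤ N := by
      intro m
      induction m with
      | zero =>
        intro j s₁ _ h1 _ _ h3 h4
        exact ⟨1, s₁, .loop_done h1, by simp, h3, fun _ _ _ => rfl, h4⟩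
      | succ m ih =>
        intro j s₁ hj h1 h2 h3 h4 h5
        obtain ⟨t₁, s₂, e₁, ht₁, ha₁, hx₁, hN₁⟩ := p.compile_spec (d := d + 3) hp (by omega) h4 h5
          (hb j (by omega))
        have a1 : s₂.reg (d + 1) = 1 := by rw [hx₁ _ (by omega) (by omega), h2]
        have a2 : s₂.reg (d + 2) = j := by rw [hx₁ _ (by omega) (by omega), h3]
        have a3 : s₂.reg d = m + 1 := by rw [hx₁ _ (by omega) (by omega), h1]
        have hle := hN r hr
        obtain ⟨t₂, s₃, e₂, ht₂, ha₂, hx₂, hN₂⟩ := ih (j + 1)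
          (((s₂.setReg (d + 2) (j + 1)).setReg i (j + 1)).setReg d m) (by omega)
          (by simp [State.setReg_reg])
          (by simp only [State.setReg_reg]
              rw [if_neg (by omega), if_neg (by omega), if_neg (by omega), a1])
          (by simp only [State.setReg_reg]
              rw [if_neg (by omega), if_neg (by omega), if_pos trivial])
          (by
            rw [hst₁]
            refine ⟨ha₁.1, fun x hx => ?_⟩
            simp only [State.setReg_reg]
            rw [if_neg (by omega : x ≠ d), if_neg (by omega : x ≠ d + 2), ha₁.2 x hx])
          (by
            intro x hx
            rw [hst₁, State.setReg_reg]
            split_ifs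
            · omega
            · exact hN₁ x hx)
        have hstate : (Instr.sub d d (d + 1)).eval ((Instr.move i (d + 2)).eval
              ((Instr.add (d + 2) (d + 2) (d + 1)).eval s₂)) =
              ((s₂.setReg (d + 2) (j + 1)).setReg i (j + 1)).setReg d m := by
          have b1 : d ≠ i := by omega
          have b2 : d + 1 ≠ i := by omega
          simp [Instr.eval, State.setReg_reg, a1, a2, a3, b1, b2]
        rw [← hstate] at e₂
        refine ⟨_, s₃, .loop_step (by omega)
          (.seq e₁ (.seq (.instr _ _) (.seq (.instr _ _) (.instr _ _)))) e₂, ?_, ?_, ?_, ?_⟩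
        · rw [Nat.add_mul]
          omega
        · rwa [show j + (m + 1) = j + 1 + m by omega]
        · intro x hx hxd
          rw [hx₂ x hx hxd]
          simp only [State.setReg_reg]
          rw [if_neg (by omega), if_neg (by omega), if_neg (by omega), hx₁ x hx (by omega)]
        · rwa [show j + (m + 1) = j + 1 + m by omega]
    set s₁ : State := (((s.setReg d (s₀.reg r)).setReg (d + 1) 1).setReg (d + 2) 0).setReg i 0
      with hs₁
    obtain ⟨t, s₂, ex, ht, ha₂, hx₂, hN₂⟩ := loop (s₀.reg r) 0 s₁ (by omega)
      (by
        simp only [hs₁, State.setReg_reg]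
        rw [if_neg (by omega), if_neg (by omega), if_neg (by omega), if_pos trivial])
      (by
        simp only [hs₁, State.setReg_reg]
        rw [if_neg (by omega), if_neg (by omega), if_pos trivial])
      (by
        simp only [hs₁, State.setReg_reg]
        rw [if_neg (by omega), if_pos trivial])
      (by
        refine ⟨hs.1, fun x hx => ?_⟩
        simp only [hs₁, hst, iter, State.setReg_reg]
        rw [if_neg (by omega : x ≠ d + 2), if_neg (by omega : x ≠ d + 1),
          if_neg (by omega : x ≠ d), hs.2 x hx])
      (by
        intro x hx
        simp only [hst, iter, State.setReg_reg]
        split_ifs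
        · omega
        · exact hN x hx)
    have hstate : (Instr.move i (d + 2)).eval ((Instr.const (d + 2) 0).eval
        ((Instr.const (d + 1) 1).eval ((Instr.move d r).eval s))) = s₁ := by
      simp [hs₁, Instr.eval, State.setReg_reg, hs.2 r hr]
    rw [← hstate] at ex
    rw [Nat.zero_add] at ha₂ hN₂
    refine ⟨_, _, .seq (.instr _ _) (.seq (.instr _ _) (.seq (.instr _ _) (.seq (.instr _ _) ex))),
      ?_, ha₂, fun x hx hxd => ?_, hN₂⟩
    · have h1 : s₀.reg r * (p.time.eval N + 4) ≤ N * (p.time.eval N + 4) :=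
        Nat.mul_le_mul_right _ (hN r hr)
      simp only [time, Polynomial.eval_add, Polynomial.eval_mul, Polynomial.eval_X,
        Polynomial.eval_C]
      omega
    · rw [hx₂ x hx hxd]
      simp only [hs₁, State.setReg_reg]
      rw [if_neg (by omega), if_neg (by omega), if_neg (by omega), if_neg (by omega)]

/-- The statement keeps its assignments below `N` and establishes `Q`. -/
def Ensures (N : ℕ) (p : Stmt) (s : State) (Q : State → Prop) : Prop :=
  p.Bounded N s ∧ Q (p.run s)

theorem Ensures.mono {N : ℕ} {p : Stmt} {s : State} {Q Q' : State → Prop}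
    (h : p.Ensures N s Q) (hQ : ∀ s', Q s' → Q' s') : p.Ensures N s Q' :=
  ⟨h.1, hQ _ h.2⟩

theorem Ensures.seq {N : ℕ} {p q : Stmt} {s : State} {Q Q' : State → Prop}
    (hp : p.Ensures N s Q) (hq : ∀ s', Q s' → q.Ensures N s' Q') :
    (p.seq q).Ensures N s Q' :=
  ⟨⟨hp.1, (hq _ hp.2).1⟩, (hq _ hp.2).2⟩

theorem Ensures.loop {N i r : ℕ} {p : Stmt} {s : State} (Inv : ℕ → State → Prop)
    (h0 : Inv 0 (s.setReg i 0))
    (hp : ∀ j < s.reg r, ∀ s', Inv j s' → s'.reg i = j →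
      p.Ensures N s' fun s'' => Inv (j + 1) (s''.setReg i (j + 1))) :
    (loop i r p).Ensures N s (Inv (s.reg r)) := by
  have key : ∀ j, j ≤ s.reg r →
      Inv j (iter (fun j s => (p.run s).setReg i (j + 1)) j (s.setReg i 0)) ∧
        (iter (fun j s => (p.run s).setReg i (j + 1)) j (s.setReg i 0)).reg i = j := by
    intro j
    induction j with
    | zero => exact fun _ => ⟨h0, by simp [iter, State.setReg_reg]⟩
    | succ j ih =>
      intro hj
      obtain ⟨h1, h2⟩ := ih (by omega)
      exact ⟨(hp j hj _ h1 h2).2, by simp [iter, State.setReg_reg]⟩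
  exact ⟨fun j hj => (hp j hj _ (key j hj.le).1 (key j hj.le).2).1, (key _ le_rfl).1⟩

end Stmt

end PawKernel

namespace PawKernel

open Classical

/-! ### Formulas about the graph in memory -/

/-- The memory holds the graph `G` in array `0`, its order in register `0`, and `k` in
register `1`. -/
structure Env {n : ℕ} (G : SimpleGraph (Fin n)) (k : ℕ) (s : State) : Prop where
  reg_zero : s.reg 0 = n
  reg_one : s.reg 1 = k
  arr_zero : ∀ a b : Fin n, s.arr 0 (n * a + b) = if G.Adj a b then 1 else 0

theorem State.reg_setReg_self (s : State) (r v : ℕ) : (s.setReg r v).reg r = v := by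
  simp [State.setReg_reg]

theorem State.reg_setReg_of_ne {s : State} {x v r w : ℕ} (h : s.reg x = v) (hx : x ≠ r) :
    (s.setReg r w).reg x = v := by
  rw [State.setReg_reg, if_neg hx, h]

theorem Env.setReg {n : ℕ} {G : SimpleGraph (Fin n)} {k : ℕ} {s : State} (h : Env G k s)
    {r v : ℕ} (hr : 2 ≤ r) : Env G k (s.setReg r v) :=
  ⟨State.reg_setReg_of_ne h.reg_zero (by omega), State.reg_setReg_of_ne h.reg_one (by omega),
    h.arr_zero⟩

namespace Expr

/-- An expression as a formula. -/
def Holds (e : Expr) (s : State) : Prop := e.eval s ≠ 0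

/-- Negation. -/
def not (a : Expr) : Expr := ite a (const 0) (const 1)

/-- Conjunction. -/
def and (a b : Expr) : Expr := ite a b (const 0)

/-- Disjunction. -/
def or (a b : Expr) : Expr := ite a (const 1) b

/-- Equivalence. -/
def iff (a b : Expr) : Expr := ite a b b.not

/-- `a < b` -/
def lt (a b : Expr) : Expr := sub b a

/-- `a ≤ b` -/
def le (a b : Expr) : Expr := sub (add b (const 1)) a

/-- `a = b` -/
def eq (a b : Expr) : Expr := and (le a b) (le b a)

/-- The number of vertices `z` that satisfy `a`. -/
def count (z : ℕ) (a : Expr) : Expr := sum z 0 (ite a (const 1) (const 0))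

/-- All vertices `z` satisfy `a`. -/
def all (z : ℕ) (a : Expr) : Expr := not (count z a.not)

theorem holds_not (a : Expr) (s : State) : a.not.Holds s ↔ ¬ a.Holds s := by
  simp [Holds, not, eval]

theorem holds_and (a b : Expr) (s : State) : (a.and b).Holds s ↔ a.Holds s ∧ b.Holds s := by
  simp only [Holds, and, eval]
  split_ifs with h <;> simp [h]

theorem holds_or (a b : Expr) (s : State) : (a.or b).Holds s ↔ a.Holds s ∨ b.Holds s := by
  simp only [Holds, or, eval]
  split_ifs with h <;> simp [h]

theorem holds_iff (a b : Expr) (s : State) :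
    (a.iff b).Holds s ↔ (a.Holds s ↔ b.Holds s) := by
  by_cases h : a.eval s = 0 <;> by_cases h' : b.eval s = 0 <;>
    simp [Holds, iff, not, eval, h, h']

theorem holds_lt (a b : Expr) (s : State) : (a.lt b).Holds s ↔ a.eval s < b.eval s := by
  simp only [Holds, lt, eval]
  omega

theorem holds_le (a b : Expr) (s : State) : (a.le b).Holds s ↔ a.eval s ≤ b.eval s := by
  simp only [Holds, le, eval]
  omega

theorem holds_eq (a b : Expr) (s : State) : (a.eq b).Holds s ↔ a.eval s = b.eval s := by
  simp only [eq, holds_and, holds_le]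
  omega

theorem eval_indicator (a : Expr) (s : State) :
    (ite a (const 1) (const 0)).eval s = if a.Holds s then 1 else 0 := by
  by_cases h : a.eval s = 0 <;> simp [Holds, eval, h]

section

variable {n k : ℕ} {G : SimpleGraph (Fin n)} {s : State}

theorem eval_count (h : s.reg 0 = n) (z : ℕ) (a : Expr) : (count z a).eval s =
    (Finset.univ.filter fun c : Fin n => a.Holds (s.setReg z c)).card := by
  rw [count, eval, h, Finset.sum_range, Finset.card_filter]
  simp only [eval_indicator]

theorem holds_count (h : s.reg 0 = n) (z : ℕ) (a : Expr) :
    (count z a).Holds s ↔ ∃ c : Fin n, a.Holds (s.setReg z c) := by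
  rw [Holds, eval_count h, Finset.card_ne_zero]
  simp [Finset.Nonempty]

theorem holds_all (h : s.reg 0 = n) (z : ℕ) (a : Expr) :
    (all z a).Holds s ↔ ∀ c : Fin n, a.Holds (s.setReg z c) := by
  simp only [all, holds_not, holds_count h, not_exists, not_not]

/-- The index `reg m * reg x + reg y`. -/
def index (m x y : ℕ) : Expr := add (sum 29 m (var x)) (var y)

/-- Multiplication is repeated addition with the dummy register 29. Here and below, upper bounds on
register numbers prevent capture by the bound variables of a formula. -/
theorem eval_index {m x y : ℕ} (hx : x < 29) :
    (index m x y).eval s = s.reg m * s.reg x + s.reg y := by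
  have : ∀ j, (s.setReg 29 j).reg x = s.reg x := fun j =>
    State.reg_setReg_of_ne rfl (by omega)
  simp [index, eval, this]

/-- `x` and `y` are adjacent. -/
def adj (x y : ℕ) : Expr := get 0 (index 0 x y)

theorem eval_adj (h : Env G k s) {x y : ℕ} {a b : Fin n} (hx : s.reg x = a) (hy : s.reg y = b)
    (hx' : x < 28) : (adj x y).eval s = if G.Adj a b then 1 else 0 := by
  rw [adj, eval, eval_index (by omega), hx, hy, h.reg_zero, h.arr_zero]

theorem holds_adj (h : Env G k s) {x y : ℕ} {a b : Fin n} (hx : s.reg x = a) (hy : s.reg y = b)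
    (hx' : x < 28) : (adj x y).Holds s ↔ G.Adj a b := by
  rw [Holds, eval_adj h hx hy hx']
  simp

theorem holds_eq_var {x y : ℕ} {a b : Fin n} (hx : s.reg x = a) (hy : s.reg y = b) :
    ((var x).eq (var y)).Holds s ↔ a = b := by
  rw [holds_eq, eval, eval, hx, hy, Fin.val_inj]

/-- `x` and `y` are false twins. -/
def twins (x y : ℕ) : Expr := all 28 ((adj x 28).iff (adj y 28))

theorem holds_twins (h : Env G k s) {x y : ℕ} {a b : Fin n} (hx : s.reg x = a)
    (hy : s.reg y = b) (hx' : x < 28) (hy' : y < 28) :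
    (twins x y).Holds s ↔ FalseTwins G a b := by
  rw [twins, holds_all h.reg_zero]
  refine forall_congr' fun c => ?_
  have h' : Env G k (s.setReg 28 c) := h.setReg (by norm_num)
  have hc := s.reg_setReg_self 28 c
  rw [holds_iff, holds_adj h' (State.reg_setReg_of_ne hx (by omega)) hc hx',
    holds_adj h' (State.reg_setReg_of_ne hy (by omega)) hc hy']

/-- `x` and `y` are adjacent or false twins. -/
def near (x y : ℕ) : Expr := (adj x y).or (twins x y)

theorem holds_near (h : Env G k s) {x y : ℕ} {a b : Fin n} (hx : s.reg x = a)
    (hy : s.reg y = b) (hx' : x < 28) (hy' : y < 28) :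
    (near x y).Holds s ↔ NearOrTwin G a b := by
  rw [near, holds_or, holds_adj h hx hy hx', holds_twins h hx hy hx' hy', NearOrTwin]

/-- `x a b c` span a paw. -/
def spansPaw (x a b c : ℕ) : Expr :=
  ((var b).eq (var x)).not.and (((var c).eq (var x)).not.and (((var c).eq (var a)).not.and
    (((var c).eq (var b)).not.and
      (((adj x a).and ((adj x b).and ((adj a b).and ((adj c x).or (adj c a))))).or
        ((adj a b).and ((adj b c).and ((adj a c).and (adj x a))))))))

theorem holds_spansPaw (h : Env G k s) {x y z w : ℕ} {a b c d : Fin n} (hx : s.reg x = a)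
    (hy : s.reg y = b) (hz : s.reg z = c) (hw : s.reg w = d) (hx' : x < 28) (hy' : y < 28)
    (hz' : z < 28) (hw' : w < 28) :
    (spansPaw x y z w).Holds s ↔ SpansPaw G a b c d := by
  simp only [spansPaw, SpansPaw, holds_and, holds_or, holds_not]
  rw [holds_eq_var hz hx, holds_eq_var hw hx, holds_eq_var hw hy, holds_eq_var hw hz,
    holds_adj h hx hy hx', holds_adj h hx hz hx', holds_adj h hy hz hy', holds_adj h hw hx hw',
    holds_adj h hw hy hw', holds_adj h hz hw hz', holds_adj h hy hw hy']

/-- `y` has the same neighbours among `a b c` as `x`. -/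
def mimics (x a b c y : ℕ) : Expr :=
  ((var y).eq (var x)).not.and (((var y).eq (var a)).not.and (((var y).eq (var b)).not.and
    (((var y).eq (var c)).not.and (((adj y a).iff (adj x a)).and (((adj y b).iff (adj x b)).and
      ((adj y c).iff (adj x c)))))))

theorem holds_mimics (h : Env G k s) {x y z w v : ℕ} {a b c d e : Fin n} (hx : s.reg x = a)
    (hy : s.reg y = b) (hz : s.reg z = c) (hw : s.reg w = d) (hv : s.reg v = e)
    (hx' : x < 28) (hv' : v < 28) :
    (mimics x y z w v).Holds s ↔ Mimics G a b c d e := by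
  simp only [mimics, Mimics, holds_and, holds_iff, holds_not]
  rw [holds_eq_var hv hx, holds_eq_var hv hy, holds_eq_var hv hz, holds_eq_var hv hw,
    holds_adj h hv hy hv', holds_adj h hv hz hv', holds_adj h hv hw hv',
    holds_adj h hx hy hx', holds_adj h hx hz hx', holds_adj h hx hw hx']

/-- `x` is replaceable. -/
def replaceable (x : ℕ) : Expr :=
  all 11 (all 12 (all 13 ((spansPaw x 11 12 13).not.or
    ((var 1).lt (count 14 (mimics x 11 12 13 14))))))

theorem holds_replaceable (h : Env G k s) {x : ℕ} {a : Fin n} (hx : s.reg x = a) (hx' : x < 11) :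
    (replaceable x).Holds s ↔ Replaceable G k a := by
  rw [replaceable, holds_all h.reg_zero]
  refine forall_congr' fun b => ?_
  have h1 : Env G k (s.setReg 11 b) := h.setReg (by norm_num)
  have x1 := State.reg_setReg_of_ne (r := 11) (w := b) hx (by omega)
  have b1 := s.reg_setReg_self 11 b
  rw [holds_all h1.reg_zero]
  refine forall_congr' fun c => ?_
  have h2 := h1.setReg (r := 12) (v := c) (by norm_num)
  have x2 := State.reg_setReg_of_ne (r := 12) (w := c) x1 (by omega)
  have b2 := State.reg_setReg_of_ne (r := 12) (w := c) b1 (by norm_num)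
  have c2 := (s.setReg 11 b).reg_setReg_self 12 c
  rw [holds_all h2.reg_zero]
  refine forall_congr' fun d => ?_
  have h3 := h2.setReg (r := 13) (v := d) (by norm_num)
  have x3 := State.reg_setReg_of_ne (r := 13) (w := d) x2 (by omega)
  have b3 := State.reg_setReg_of_ne (r := 13) (w := d) b2 (by norm_num)
  have c3 := State.reg_setReg_of_ne (r := 13) (w := d) c2 (by norm_num)
  have d3 := ((s.setReg 11 b).setReg 12 c).reg_setReg_self 13 d
  rw [holds_or, holds_not, holds_lt, eval, h3.reg_one, eval_count h3.reg_zero,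
    holds_spansPaw h3 x3 b3 c3 d3 (by omega) (by norm_num) (by norm_num) (by norm_num),
    ← imp_iff_not_or]
  have : ∀ e : Fin n, (mimics x 11 12 13 14).Holds
      ((((s.setReg 11 b).setReg 12 c).setReg 13 d).setReg 14 e) ↔ Mimics G a b c d e := fun e =>
    holds_mimics (h3.setReg (by norm_num)) (State.reg_setReg_of_ne x3 (by omega))
      (State.reg_setReg_of_ne b3 (by norm_num)) (State.reg_setReg_of_ne c3 (by norm_num))
      (State.reg_setReg_of_ne d3 (by norm_num)) (State.reg_setReg_self _ _ _) (by omega)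
      (by norm_num)
  simp only [this]

/-- `x` lies in a complete multipartite component. -/
def multipartite (x : ℕ) : Expr :=
  all 11 ((near x 11).not.or (all 12 ((near x 12).iff (near 11 12))))

theorem holds_multipartite (h : Env G k s) {x : ℕ} {a : Fin n} (hx : s.reg x = a)
    (hx' : x < 11) : (multipartite x).Holds s ↔ InMultipartiteComponent G a := by
  rw [multipartite, holds_all h.reg_zero]
  refine forall_congr' fun b => ?_
  have h1 : Env G k (s.setReg 11 b) := h.setReg (by norm_num)
  have x1 := State.reg_setReg_of_ne (r := 11) (w := b) hx (by omega)
  have b1 := s.reg_setReg_self 11 b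
  rw [holds_or, holds_not, holds_near h1 x1 b1 (by omega) (by norm_num), ← imp_iff_not_or,
    holds_all h1.reg_zero]
  refine imp_congr_right fun _ => forall_congr' fun c => ?_
  have h2 := h1.setReg (r := 12) (v := c) (by norm_num)
  have x2 := State.reg_setReg_of_ne (r := 12) (w := c) x1 (by omega)
  have b2 := State.reg_setReg_of_ne (r := 12) (w := c) b1 (by norm_num)
  have c2 := (s.setReg 11 b).reg_setReg_self 12 c
  rw [holds_iff, holds_near h2 x2 c2 (by omega) (by norm_num),
    holds_near h2 b2 c2 (by norm_num) (by norm_num)]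

/-- The number of false twins of `x`. -/
def twinNumber (x : ℕ) : Expr := count 27 (twins x 27)

theorem eval_twinNumber (h : Env G k s) {x : ℕ} {a : Fin n} (hx : s.reg x = a) (hx' : x < 27) :
    (twinNumber x).eval s = twinCount G a := by
  rw [twinNumber, eval_count h.reg_zero, twinCount]
  have : ∀ e : Fin n, (twins x 27).Holds (s.setReg 27 e) ↔ FalseTwins G a e := fun e =>
    holds_twins (h.setReg (by norm_num)) (State.reg_setReg_of_ne hx (by omega))
      (State.reg_setReg_self _ _ _) (by omega) (by norm_num)
  simp only [this]

/-- The part of `y` is parallel to that of `x`. -/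
def parallel (x y : ℕ) : Expr :=
  (adj x y).and ((all 12 ((near x 12).iff (near y 12))).and
    (((const 2).le (twinNumber y)).and ((twinNumber y).le ((var 1).add (const 5)))))

theorem holds_parallel (h : Env G k s) {x y : ℕ} {a b : Fin n} (hx : s.reg x = a)
    (hy : s.reg y = b) (hx' : x < 12) (hy' : y < 12) :
    (parallel x y).Holds s ↔ ParallelPart G k a b := by
  rw [parallel, holds_and, holds_and, holds_and, holds_adj h hx hy (by omega),
    holds_all h.reg_zero, holds_le, holds_le, eval_twinNumber h hy (by omega), ParallelPart]
  simp only [eval, h.reg_one]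
  refine and_congr_right fun _ => and_congr_left fun _ => forall_congr' fun c => ?_
  have h1 : Env G k (s.setReg 12 c) := h.setReg (by norm_num)
  have x1 := State.reg_setReg_of_ne (r := 12) (w := c) hx (by omega)
  have y1 := State.reg_setReg_of_ne (r := 12) (w := c) hy (by omega)
  have c1 := s.reg_setReg_self 12 c
  rw [holds_iff, holds_near h1 x1 c1 (by omega) (by norm_num),
    holds_near h1 y1 c1 (by omega) (by norm_num)]

/-- There are many parts parallel to that of `x`. -/
def manyParts (x : ℕ) : Expr :=
  ((sum 29 1 (add (var 1) (add (var 1) (const 15)))).add (const 25)).le (count 11 (parallel x 11))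

theorem holds_manyParts (h : Env G k s) {x : ℕ} {a : Fin n} (hx : s.reg x = a) (hx' : x < 11) :
    (manyParts x).Holds s ↔ InManyParts G k a := by
  have h1 : ∀ j, (s.setReg 29 j).reg 1 = k := fun j =>
    State.reg_setReg_of_ne h.reg_one (by norm_num)
  have h2 : ∀ b : Fin n, (parallel x 11).Holds (s.setReg 11 b) ↔ ParallelPart G k a b := fun b =>
    holds_parallel (h.setReg (by norm_num)) (State.reg_setReg_of_ne hx (by omega))
      (State.reg_setReg_self _ _ _) (by omega) (by norm_num)
  -- The threshold is expanded so that a single sum over register 1 computes it.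
  have h3 : k * (k + (k + 15)) + 25 = (2 * k + 5) * (k + 5) := by ring
  rw [manyParts, holds_le, eval_count h.reg_zero, InManyParts, ← h3]
  simp only [eval, h1, h2, h.reg_one, Finset.sum_const, Finset.card_range, smul_eq_mul]

/-- `x` is the centre of a paw whose triangle is `x p q`. -/
def pendantAt (p q x : ℕ) : Expr :=
  (adj x p).and ((adj x q).and (count 12 ((adj 12 x).and (((var 12).eq (var p)).not.and
    (((var 12).eq (var q)).not.and ((adj 12 p).not.and (adj 12 q).not))))))

theorem holds_pendantAt (h : Env G k s) {p q x : ℕ} {a b c : Fin n} (hp : s.reg p = a)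
    (hq : s.reg q = b) (hx : s.reg x = c) (hp' : p < 12) (hq' : q < 12) (hx' : x < 12) :
    (pendantAt p q x).Holds s ↔ PendantAt G a b c := by
  rw [pendantAt, holds_and, holds_and, holds_adj h hx hp (by omega),
    holds_adj h hx hq (by omega), holds_count h.reg_zero, PendantAt]
  refine and_congr_right fun _ => and_congr_right fun _ => exists_congr fun d => ?_
  have h1 : Env G k (s.setReg 12 d) := h.setReg (by norm_num)
  have p1 := State.reg_setReg_of_ne (r := 12) (w := d) hp (by omega)
  have q1 := State.reg_setReg_of_ne (r := 12) (w := d) hq (by omega)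
  have x1 := State.reg_setReg_of_ne (r := 12) (w := d) hx (by omega)
  have d1 := s.reg_setReg_self 12 d
  simp only [holds_and, holds_not]
  rw [holds_adj h1 d1 x1 (by norm_num), holds_adj h1 d1 p1 (by norm_num),
    holds_adj h1 d1 q1 (by norm_num), holds_eq_var d1 p1, holds_eq_var d1 q1]

/-- The edge `p q` is forced. -/
def forced (p q : ℕ) : Expr :=
  (adj p q).and (((const 1).le (var 1)).and ((var 1).lt (count 11 (pendantAt p q 11))))

theorem holds_forced (h : Env G k s) {p q : ℕ} {a b : Fin n} (hp : s.reg p = a)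
    (hq : s.reg q = b) (hp' : p < 11) (hq' : q < 11) :
    (forced p q).Holds s ↔ Forced G k a b := by
  have h1 : ∀ c : Fin n, (pendantAt p q 11).Holds (s.setReg 11 c) ↔ PendantAt G a b c := fun c =>
    holds_pendantAt (h.setReg (by norm_num)) (State.reg_setReg_of_ne hp (by omega))
      (State.reg_setReg_of_ne hq (by omega)) (State.reg_setReg_self _ _ _) (by omega) (by omega)
      (by norm_num)
  rw [forced, holds_and, holds_and, holds_adj h hp hq (by omega), holds_le, holds_lt,
    eval_count h.reg_zero, Forced]
  simp only [eval, h.reg_one, h1]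

/-- `x` is not isolated. -/
def nonisolated (x : ℕ) : Expr := count 28 (adj x 28)

theorem holds_nonisolated (h : Env G k s) {x : ℕ} {a : Fin n} (hx : s.reg x = a)
    (hx' : x < 28) : (nonisolated x).Holds s ↔ a ∈ support G := by
  rw [nonisolated, holds_count h.reg_zero]
  simp only [support, Finset.mem_filter, Finset.mem_univ, true_and]
  exact exists_congr fun c => holds_adj (h.setReg (by norm_num))
    (State.reg_setReg_of_ne hx (by omega)) (State.reg_setReg_self _ _ _) hx'

/-- The rank of `x` among the vertices that are not isolated. -/
def rankOf (x : ℕ) : Expr := sum 27 x (ite (nonisolated 27) (const 1) (const 0))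

theorem eval_rankOf (h : Env G k s) {x : ℕ} {a : Fin n} (hx : s.reg x = a) :
    (rankOf x).eval s = rank G a := by
  rw [rankOf, eval, hx, rank, Finset.card_filter, support, Finset.sum_filter]
  rw [← Finset.sum_filter, ← Finset.sum_filter, Finset.filter_filter, ← Finset.card_eq_sum_ones]
  have h1 : ∀ j ∈ Finset.range a,
      (ite (nonisolated 27) (const 1) (const 0)).eval (s.setReg 27 j) =
        if (nonisolated 27).Holds (s.setReg 27 j) then 1 else 0 := fun j _ => eval_indicator _ _
  rw [Finset.sum_congr rfl h1, ← Finset.sum_filter, ← Finset.card_eq_sum_ones]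
  symm
  refine Finset.card_bij (fun (c : Fin n) _ => (c : ℕ)) ?_ ?_ ?_
  · intro c hc
    simp only [Finset.mem_filter, Finset.mem_univ, true_and, Finset.mem_range] at hc ⊢
    refine ⟨hc.2, (holds_nonisolated (h.setReg (by norm_num)) (s.reg_setReg_self 27 c)
      (by norm_num)).2 ?_⟩
    simpa [support] using hc.1
  · exact fun c _ d _ hcd => Fin.ext hcd
  · intro j hj
    simp only [Finset.mem_filter, Finset.mem_range] at hj
    refine ⟨⟨j, hj.1.trans a.2⟩, ?_, rfl⟩
    have := (holds_nonisolated (h.setReg (by norm_num))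
      (s.reg_setReg_self 27 (⟨j, hj.1.trans a.2⟩ : Fin n)) (by norm_num)).1 hj.2
    simp only [support, Finset.mem_filter, Finset.mem_univ, true_and] at this ⊢
    exact ⟨this, hj.1⟩

end

end Expr

/-! ### The program -/

namespace Stmt

/-- Fill a square matrix in array `a`, whose order is in register `r`, with the values of `e`,
where registers `6` and `7` hold the row and the column. -/
def fill (a r : ℕ) (e : Expr) : Stmt :=
  loop 6 r (loop 7 r (store a (.index r 6 7) e))

/-- The entry formula has to evaluate correctly whatever array `a` currently holds. This is why new
matrices are first built in array 1 from the graph in array 0. -/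
theorem ensures_fill {N a r m : ℕ} {e : Expr} {s : State} {F : ℕ → ℕ → ℕ} (hr : r < 6)
    (hm : s.reg r = m)
    (he : ∀ s' : State, (∀ x, x ≠ 6 → x ≠ 7 → s'.reg x = s.reg x) →
      (∀ b, b ≠ a → s'.arr b = s.arr b) →
      ∀ i < m, ∀ j < m, s'.reg 6 = i → s'.reg 7 = j → e.eval s' = F i j) :
    (fill a r e).Ensures N s fun s' => (∀ x, x ≠ 6 → x ≠ 7 → s'.reg x = s.reg x) ∧
      (∀ b, b ≠ a → s'.arr b = s.arr b) ∧ ∀ i < m, ∀ j < m, s'.arr a (m * i + j) = F i j := by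
  have h := Ensures.loop (N := N) (i := 6) (r := r) (p := loop 7 r (store a (.index r 6 7) e))
    (s := s) (fun u s' => (∀ x, x ≠ 6 → x ≠ 7 → s'.reg x = s.reg x) ∧
      (∀ b, b ≠ a → s'.arr b = s.arr b) ∧ ∀ i < u, ∀ j < m, s'.arr a (m * i + j) = F i j)
    ⟨fun x h6 _ => State.reg_setReg_of_ne rfl h6, fun _ _ => rfl, fun i hi => by omega⟩ ?_
  · rwa [hm] at h
  rintro u hu s₁ ⟨h1, h2, h3⟩ hu₁
  rw [hm] at hu
  have hm₁ : s₁.reg r = m := by rw [h1 r (by omega) (by omega), hm]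
  have h' := Ensures.loop (N := N) (i := 7) (r := r) (p := store a (.index r 6 7) e)
    (s := s₁) (fun v s' => s'.reg 6 = u ∧ (∀ x, x ≠ 6 → x ≠ 7 → s'.reg x = s.reg x) ∧
      (∀ b, b ≠ a → s'.arr b = s.arr b) ∧ (∀ i < u, ∀ j < m, s'.arr a (m * i + j) = F i j) ∧
      ∀ j < v, s'.arr a (m * u + j) = F u j)
    ⟨State.reg_setReg_of_ne hu₁ (by norm_num), fun x h6 h7 => State.reg_setReg_of_ne (h1 x h6 h7) h7,
      h2, h3, fun i hi => by omega⟩ ?_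
  · refine h'.mono ?_
    rintro s₂ ⟨-, h4, h5, h6, h7⟩
    refine ⟨fun x x6 x7 => State.reg_setReg_of_ne (h4 x x6 x7) x6, h5, fun i hi j hj => ?_⟩
    rcases Nat.lt_succ_iff_lt_or_eq.1 hi with hi | rfl
    · exact h6 i hi j hj
    · exact h7 j (by omega)
  rintro v hv s₂ ⟨h4, h5, h6, h7, h8⟩ hv₂
  rw [hm₁] at hv
  have hval := he s₂ h5 h6 u hu v hv h4 hv₂
  have hidx : (Expr.index r 6 7).eval s₂ = m * u + v := by
    rw [Expr.eval_index (by norm_num), h4, hv₂, h5 r (by omega) (by omega), hm]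
  refine ⟨trivial, ?_⟩
  simp only [run, hidx, hval]
  refine ⟨State.reg_setReg_of_ne h4 (by norm_num),
    fun x x6 x7 => State.reg_setReg_of_ne (h5 x x6 x7) x7, fun b hb => ?_, fun i hi j hj => ?_,
    fun j hj => ?_⟩
  · rw [State.setReg_arr]
    funext j
    rw [State.setArr_arr, if_neg (by tauto), h6 b hb]
  · rw [State.setReg_arr, State.setArr_arr, if_neg, h7 i hi j hj]
    rintro ⟨-, h⟩
    -- An earlier row ends before row `u` begins, so its entries are not overwritten.
    have : m * (i + 1) ≤ m * u := Nat.mul_le_mul_left m hi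
    rw [Nat.mul_add] at this
    omega
  · rw [State.setReg_arr, State.setArr_arr]
    rcases Nat.lt_succ_iff_lt_or_eq.1 hj with hj | rfl
    · rw [if_neg (by omega), h8 j hj]
    · rw [if_pos ⟨rfl, rfl⟩]

theorem ensures_assign {N r : ℕ} {e : Expr} {s : State} {v : ℕ} (he : e.eval s = v) (hv : v ≤ N) :
    (assign r e).Ensures N s fun s' => s' = s.setReg r v := by
  subst he
  exact ⟨hv, rfl⟩

/-- Copy a square matrix, whose order is in register `r`, from array `1` to array `0`. -/
def copy (r : ℕ) : Stmt := fill 0 r (.get 1 (.index r 6 7))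

theorem ensures_copy {N r m : ℕ} {s : State} (hr : r < 6) (hm : s.reg r = m) :
    (copy r).Ensures N s fun s' => (∀ x, x ≠ 6 → x ≠ 7 → s'.reg x = s.reg x) ∧
      ∀ i < m, ∀ j < m, s'.arr 0 (m * i + j) = s.arr 1 (m * i + j) := by
  refine (ensures_fill (F := fun i j => s.arr 1 (m * i + j)) hr hm ?_).mono
    fun s' h => ⟨h.1, h.2.2⟩
  intro s' h1 h2 i _ j _ hi hj
  rw [Expr.eval, Expr.eval_index (by norm_num), h2 1 (by norm_num), hi, hj,
    h1 r (by omega) (by omega), hm]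

end Stmt

/-! ### Formulas for the reduction step and for the output -/

namespace Expr

theorem eval_ite (c a b : Expr) (s : State) :
    (ite c a b).eval s = if c.Holds s then a.eval s else b.eval s := by
  by_cases h : c.eval s = 0 <;> simp [Holds, eval, h]

/-- The adjacency of `6` and `7` after the application of a rule at `4` and `5`. -/
def reducedAdj : Expr :=
  ite ((replaceable 4).or (multipartite 4))
    (ite (((var 6).eq (var 4)).or ((var 7).eq (var 4))) (const 0) (adj 6 7))
    (ite (manyParts 4) (ite ((twins 4 6).or (twins 4 7)) (const 0) (adj 6 7))
      (ite (forced 4 5)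
        (ite ((((var 6).eq (var 4)).and ((var 7).eq (var 5))).or
          (((var 6).eq (var 5)).and ((var 7).eq (var 4)))) (const 0) (adj 6 7))
        (adj 6 7)))

/-- The parameter after the application of a rule at `4` and `5`. -/
def reducedParam : Expr :=
  ite ((replaceable 4).or (multipartite 4)) (var 1)
    (ite (manyParts 4) (var 1) (ite (forced 4 5) (sub (var 1) (const 1)) (var 1)))

variable {n : ℕ} {I : SimpleGraph (Fin n) × ℕ} {s : State} {p q : Fin n}

theorem eval_reducedAdj (h : Env I.1 I.2 s) (hp : s.reg 4 = p) (hq : s.reg 5 = q) {u v : Fin n}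
    (hu : s.reg 6 = u) (hv : s.reg 7 = v) :
    reducedAdj.eval s = if (reduceAt p q I).1.Adj u v then 1 else 0 := by
  have n1 : 4 < 28 := by norm_num
  simp only [reducedAdj, eval_ite, holds_or, holds_and, holds_replaceable h hp (by norm_num),
    holds_multipartite h hp (by norm_num), holds_manyParts h hp (by norm_num),
    holds_forced h hp hq (by norm_num) (by norm_num),
    holds_twins h hp hu (by norm_num) (by norm_num),
    holds_twins h hp hv (by norm_num) (by norm_num), eval_adj h hu hv (by norm_num),
    holds_eq_var hu hp, holds_eq_var hv hp, holds_eq_var hu hq, holds_eq_var hv hq, reduceAt]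
  by_cases h1 : Replaceable I.1 I.2 p ∨ InMultipartiteComponent I.1 p
  · simp only [if_pos h1, isolate, Set.mem_singleton_iff, eval]
    split_ifs <;> first | rfl | tauto
  by_cases h2 : InManyParts I.1 I.2 p
  · simp only [if_neg h1, if_pos h2, isolate, Set.mem_ofPred_eq, eval]
    split_ifs <;> first | rfl | tauto
  by_cases h3 : Forced I.1 I.2 p q
  · simp only [if_neg h1, if_neg h2, if_pos h3, SimpleGraph.deleteEdges_adj,
      Set.mem_singleton_iff, Sym2.eq_iff, eval]
    split_ifs <;> first | rfl | tauto
  · simp only [if_neg h1, if_neg h2, if_neg h3]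

theorem eval_reducedParam (h : Env I.1 I.2 s) (hp : s.reg 4 = p) (hq : s.reg 5 = q) :
    reducedParam.eval s = (reduceAt p q I).2 := by
  simp only [reducedParam, eval_ite, holds_or, holds_replaceable h hp (by norm_num),
    holds_multipartite h hp (by norm_num), holds_manyParts h hp (by norm_num),
    holds_forced h hp hq (by norm_num) (by norm_num), reduceAt]
  simp only [eval, h.reg_one]
  split_ifs <;> rfl

/-- There are too many vertices for a yes-instance. -/
def tooLarge : Expr :=
  (sum 22 1 (sum 23 1 (sum 24 1 (sum 25 1 (const 278))))).lt (count 11 (nonisolated 11))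

theorem eval_count_nonisolated (h : Env I.1 I.2 s) :
    (count 11 (nonisolated 11)).eval s = (support I.1).card := by
  rw [eval_count h.reg_zero]
  congr 1
  ext a
  simp only [Finset.mem_filter, Finset.mem_univ, true_and]
  exact holds_nonisolated (h.setReg (by norm_num)) (State.reg_setReg_self _ _ _) (by norm_num)

theorem holds_tooLarge (h : Env I.1 I.2 s) :
    tooLarge.Holds s ↔ 278 * I.2 ^ 4 < (support I.1).card := by
  have h1 : I.2 * (I.2 * (I.2 * (I.2 * 278))) = 278 * I.2 ^ 4 := by ring
  rw [tooLarge, holds_lt, eval_count_nonisolated h, ← h1]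
  simp [eval, h.reg_one, State.setReg_reg]

/-- The number of vertices of the output. -/
def outputOrder : Expr := ite tooLarge (const 4) (count 11 (nonisolated 11))

/-- The parameter of the output. -/
def outputParam : Expr := ite tooLarge (const 0) (var 1)

/-- The adjacency of `6` and `7` in the output. -/
def outputAdj : Expr :=
  ite tooLarge
    (ite (((var 6).eq (var 7)).not.and (((var 6).eq (const 0)).or (((var 7).eq (const 0)).or
      (((var 6).add (var 7)).eq (const 3))))) (const 1) (const 0))
    (ite (count 12 (count 13 ((adj 12 13).and (((rankOf 12).eq (var 6)).and
      ((rankOf 13).eq (var 7)))))) (const 1) (const 0))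

/-- Vertex 0 is adjacent to all others, and the only remaining edge, 12, is recognized by its sum 3.
-/
theorem paw_adj_iff : ∀ i j : Fin 4,
    (¬ (i : ℕ) = j ∧ ((i : ℕ) = 0 ∨ (j : ℕ) = 0 ∨ (i : ℕ) + j = 3)) ↔ paw.Adj i j := by
  simp only [paw_adj]
  decide

theorem eval_outputAdj_paw (h : Env I.1 I.2 s) (hl : 278 * I.2 ^ 4 < (support I.1).card)
    {i j : Fin 4} (hi : s.reg 6 = i) (hj : s.reg 7 = j) :
    outputAdj.eval s = if paw.Adj i j then 1 else 0 := by
  rw [outputAdj, eval_ite, if_pos ((holds_tooLarge h).2 hl), eval_indicator]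
  simp only [holds_and, holds_or, holds_not, holds_eq, eval, hi, hj]
  simp only [paw_adj_iff]

theorem eval_outputAdj_compress (h : Env I.1 I.2 s) (hl : ¬ 278 * I.2 ^ 4 < (support I.1).card)
    {i j : Fin (support I.1).card} (hi : s.reg 6 = i) (hj : s.reg 7 = j) :
    outputAdj.eval s = if (compress I.1).Adj i j then 1 else 0 := by
  rw [outputAdj, eval_ite, if_neg (mt (holds_tooLarge h).1 hl), eval_indicator]
  have : (count 12 (count 13 ((adj 12 13).and (((rankOf 12).eq (var 6)).and
      ((rankOf 13).eq (var 7)))))).Holds s ↔ (compress I.1).Adj i j := by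
    rw [holds_count h.reg_zero]
    refine exists_congr fun u => ?_
    have h1 : Env I.1 I.2 (s.setReg 12 u) := h.setReg (by norm_num)
    rw [holds_count h1.reg_zero]
    refine exists_congr fun v => ?_
    have h2 := h1.setReg (r := 13) (v := v) (by norm_num)
    have u2 := State.reg_setReg_of_ne (r := 13) (w := v) (s.reg_setReg_self 12 u) (by norm_num)
    have v2 := (s.setReg 12 u).reg_setReg_self 13 v
    rw [holds_and, holds_and, holds_adj h2 u2 v2 (by norm_num), holds_eq, holds_eq,
      eval_rankOf h2 u2, eval_rankOf h2 v2]
    simp [eval, State.setReg_reg, hi, hj]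
  simp only [this]

end Expr

/-! ### Correctness of the reduction and output statements -/

namespace Stmt

/-- Apply a rule at the vertices in registers `4` and `5`. -/
def reduceStep : Stmt :=
  (fill 1 0 Expr.reducedAdj).seq ((assign 1 Expr.reducedParam).seq (copy 0))

/-- Apply all rules exhaustively; register `3` holds the number of rounds. -/
def reduceAll : Stmt := loop 8 3 (loop 4 0 (loop 5 0 reduceStep))

/-- Replace the graph by the output. -/
def output : Stmt :=
  (assign 3 Expr.outputOrder).seq ((fill 1 3 Expr.outputAdj).seq
    ((assign 1 Expr.outputParam).seq ((copy 3).seq (assign 0 (.var 3)))))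

variable {n N : ℕ}

/-- Matrix and parameter are both computed from the old instance: the matrix before register 1
changes, the parameter before array 0 does. -/
theorem ensures_reduceStep {I : SimpleGraph (Fin n) × ℕ} {s : State} (h : Env I.1 I.2 s)
    {p q : ℕ} (hp : s.reg 4 = p) (hq : s.reg 5 = q) (hpn : p < n) (hqn : q < n) (hN : I.2 ≤ N) :
    reduceStep.Ensures N s fun s' => Env (reduceNat p q I).1 (reduceNat p q I).2 s' ∧
      s'.reg 3 = s.reg 3 ∧ s'.reg 4 = p := by
  lift p to Fin n using hpn
  lift q to Fin n using hqn
  rw [reduceNat_coe]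
  refine Ensures.seq (ensures_fill (m := n) (F := fun u v => if huv : u < n ∧ v < n then
    (if (reduceAt p q I).1.Adj ⟨u, huv.1⟩ ⟨v, huv.2⟩ then 1 else 0) else 0) (by norm_num)
      h.reg_zero ?_) ?_
  · intro s' h1 h2 u hu v hv hu' hv'
    have h' : Env I.1 I.2 s' := ⟨by rw [h1 0 (by norm_num) (by norm_num), h.reg_zero],
      by rw [h1 1 (by norm_num) (by norm_num), h.reg_one], by
        rw [h2 0 (by norm_num)]
        exact h.arr_zero⟩
    rw [dif_pos ⟨hu, hv⟩]
    exact Expr.eval_reducedAdj h' (by rw [h1 4 (by norm_num) (by norm_num), hp])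
      (by rw [h1 5 (by norm_num) (by norm_num), hq]) hu' hv'
  rintro s₁ ⟨h1, h2, h3⟩
  have h' : Env I.1 I.2 s₁ := ⟨by rw [h1 0 (by norm_num) (by norm_num), h.reg_zero],
      by rw [h1 1 (by norm_num) (by norm_num), h.reg_one], by
        rw [h2 0 (by norm_num)]
        exact h.arr_zero⟩
  refine Ensures.seq (ensures_assign (Expr.eval_reducedParam h'
    (by rw [h1 4 (by norm_num) (by norm_num), hp])
    (by rw [h1 5 (by norm_num) (by norm_num), hq]))
    ((shrunk_reduceAt p q I).snd_le.trans hN)) ?_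
  rintro s₂ rfl
  have h0 : (s₁.setReg 1 (reduceAt p q I).2).reg 0 = n :=
    State.reg_setReg_of_ne h'.reg_zero (by norm_num)
  refine (ensures_copy (by norm_num) h0).mono ?_
  rintro s₃ ⟨h4, h5⟩
  have hreg : ∀ x, x ≠ 1 → x ≠ 6 → x ≠ 7 → s₃.reg x = s.reg x := by
    intro x x1 x6 x7
    rw [h4 x x6 x7, State.setReg_reg, if_neg x1, h1 x x6 x7]
  refine ⟨⟨?_, ?_, fun a b => ?_⟩, hreg 3 (by norm_num) (by norm_num) (by norm_num), ?_⟩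
  · rw [hreg 0 (by norm_num) (by norm_num) (by norm_num), h.reg_zero]
  · rw [h4 1 (by norm_num) (by norm_num), State.reg_setReg_self]
  · rw [h5 a a.2 b b.2, State.setReg_arr, h3 a a.2 b b.2, dif_pos ⟨a.2, b.2⟩]
  · rw [hreg 4 (by norm_num) (by norm_num) (by norm_num), hp]

theorem ensures_reduceAll {I : SimpleGraph (Fin n) × ℕ} {s : State} (h : Env I.1 I.2 s)
    (hs : s.reg 3 = n * n) (hN : I.2 ≤ N) :
    reduceAll.Ensures N s fun s' => Env (reduce I).1 (reduce I).2 s' := by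
  have h8 := Ensures.loop (N := N) (i := 8) (r := 3) (p := loop 4 0 (loop 5 0 reduceStep))
    (s := s) (fun j s' => Env (iter (fun _ => sweep) j I).1 (iter (fun _ => sweep) j I).2 s')
    (h.setReg (by norm_num)) ?_
  · rwa [hs] at h8
  intro j _ s₁ h1 _
  have hN₁ := (shrunk_iter (fun _ => shrunk_sweep) j I).snd_le.trans hN
  generalize hJ : iter (fun _ => sweep) j I = J at h1 hN₁
  have hJ' : iter (fun _ => sweep) (j + 1) I = sweep J := by rw [← hJ]; rfl
  rw [hJ']
  have h4 := Ensures.loop (N := N) (i := 4) (r := 0) (p := loop 5 0 reduceStep)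
    (s := s₁) (fun p s' => Env (iter (fun p => iter (fun q => reduceNat p q) n) p J).1
      (iter (fun p => iter (fun q => reduceNat p q) n) p J).2 s') (h1.setReg (by norm_num)) ?_
  · rw [h1.reg_zero] at h4
    exact h4.mono fun s' hs' => hs'.setReg (by norm_num)
  intro p hp s₂ h2 hp₂
  rw [h1.reg_zero] at hp
  have hN₂ := (shrunk_iter (fun p => shrunk_iter (shrunk_reduceNat p) n) p J).snd_le.trans hN₁
  generalize hK : iter (fun p => iter (fun q => reduceNat p q) n) p J = K at h2 hN₂
  have hK' : iter (fun p => iter (fun q => reduceNat p q) n) (p + 1) J =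
      iter (fun q => reduceNat p q) n K := by rw [← hK]; rfl
  rw [hK']
  have h5 := Ensures.loop (N := N) (i := 5) (r := 0) (p := reduceStep)
    (s := s₂) (fun q s' => Env (iter (fun q => reduceNat p q) q K).1
      (iter (fun q => reduceNat p q) q K).2 s' ∧ s'.reg 4 = p)
    ⟨h2.setReg (by norm_num), State.reg_setReg_of_ne hp₂ (by norm_num)⟩ ?_
  · rw [h2.reg_zero] at h5
    exact h5.mono fun s' hs' => hs'.1.setReg (by norm_num)
  rintro q hq s₃ ⟨h3, hp₃⟩ hq₃
  rw [h2.reg_zero] at hq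
  have hN₃ := (shrunk_iter (shrunk_reduceNat p) q K).snd_le.trans hN₂
  exact (ensures_reduceStep h3 hp₃ hq₃ hp hq hN₃).mono fun s' hs' =>
    ⟨hs'.1.setReg (by norm_num), State.reg_setReg_of_ne hs'.2.2 (by norm_num)⟩

/-- Treats both outcomes at once. Register 0 is overwritten last, because the formulas read the
order of the old graph there. -/
theorem ensures_output_of_adj {I : SimpleGraph (Fin n) × ℕ} {s : State} (h : Env I.1 I.2 s)
    {m k : ℕ} {G : SimpleGraph (Fin m)}
    (hm : ∀ s', Env I.1 I.2 s' → Expr.outputOrder.eval s' = m)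
    (hk : ∀ s', Env I.1 I.2 s' → Expr.outputParam.eval s' = k)
    (hG : ∀ s', Env I.1 I.2 s' → ∀ i j : Fin m, s'.reg 6 = i → s'.reg 7 = j →
      Expr.outputAdj.eval s' = if G.Adj i j then 1 else 0)
    (hmN : m ≤ N) (hkN : k ≤ N) : output.Ensures N s fun s' => s'.Outputs G k := by
  refine Ensures.seq (ensures_assign (hm s h) hmN) ?_
  rintro _ rfl
  replace h : Env I.1 I.2 (s.setReg 3 m) := h.setReg (by norm_num)
  have h3 := s.reg_setReg_self 3 m
  generalize s.setReg 3 m = s at h h3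
  have henv : ∀ s' : State, (∀ x, x ≠ 6 → x ≠ 7 → s'.reg x = s.reg x) →
      (∀ b, b ≠ 1 → s'.arr b = s.arr b) → Env I.1 I.2 s' := by
    intro s' h1 h2
    exact ⟨by rw [h1 0 (by norm_num) (by norm_num), h.reg_zero],
      by rw [h1 1 (by norm_num) (by norm_num), h.reg_one], by
        rw [h2 0 (by norm_num)]
        exact h.arr_zero⟩
  refine Ensures.seq (ensures_fill (m := m) (F := fun u v => if huv : u < m ∧ v < m then
    (if G.Adj ⟨u, huv.1⟩ ⟨v, huv.2⟩ then 1 else 0) else 0) (by norm_num) h3 ?_) ?_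
  · intro s' h1 h2 u hu v hv hu' hv'
    rw [dif_pos ⟨hu, hv⟩]
    exact hG s' (henv s' h1 h2) _ _ hu' hv'
  rintro s₁ ⟨h1, h2, h4⟩
  refine Ensures.seq (ensures_assign (hk s₁ (henv s₁ h1 h2)) hkN) ?_
  rintro _ rfl
  have h5 : (s₁.setReg 1 k).reg 3 = m :=
    State.reg_setReg_of_ne (by rw [h1 3 (by norm_num) (by norm_num), h3]) (by norm_num)
  refine Ensures.seq (ensures_copy (by norm_num) h5) ?_
  rintro s₂ ⟨h6, h7⟩
  have h8 : s₂.reg 3 = m := by rw [h6 3 (by norm_num) (by norm_num), h5]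
  refine (ensures_assign (e := .var 3) h8 hmN).mono ?_
  rintro _ rfl
  refine ⟨State.reg_setReg_self _ _ _, ?_, fun i j => ?_⟩
  · refine State.reg_setReg_of_ne ?_ (by norm_num)
    rw [h6 1 (by norm_num) (by norm_num), State.reg_setReg_self]
  · rw [State.setReg_arr, Nat.mul_comm, h7 i i.2 j j.2, State.setReg_arr, h4 i i.2 j j.2,
      dif_pos ⟨i.2, j.2⟩]

/-- If more than 278k^4 vertices are not isolated, `Irreducible.card_le` shows that the answer is
no, and the paw with parameter 0 is equivalent. The summand 4 in the bound accounts for the paw. -/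
theorem ensures_output {I : SimpleGraph (Fin n) × ℕ} {s : State} (h : Env I.1 I.2 s)
    (hI : Irreducible I.1 I.2) (hn : n ≤ N) (h4 : 4 ≤ N) (hN : I.2 ≤ N) :
    output.Ensures N s fun s' => ∃ (m : ℕ) (G : SimpleGraph (Fin m)) (k : ℕ), s'.Outputs G k ∧
      (PawFreeEdgeDeletion I.1 I.2 ↔ PawFreeEdgeDeletion G k) ∧ k ≤ I.2 ∧
        m ≤ 278 * I.2 ^ 4 + 4 := by
  by_cases hl : 278 * I.2 ^ 4 < (support I.1).card
  · refine (ensures_output_of_adj h (m := 4) (k := 0) (G := paw) ?_ ?_ ?_ h4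
      (Nat.zero_le _)).mono fun s' hs' => ⟨4, paw, 0, hs', ?_, Nat.zero_le _, Nat.le_add_left _ _⟩
    · intro s' h'
      rw [Expr.outputOrder, Expr.eval_ite, if_pos ((Expr.holds_tooLarge h').2 hl), Expr.eval]
    · intro s' h'
      rw [Expr.outputParam, Expr.eval_ite, if_pos ((Expr.holds_tooLarge h').2 hl), Expr.eval]
    · intro s' h' i j hi hj
      exact Expr.eval_outputAdj_paw h' hl hi hj
    · refine iff_of_false (fun hyes => ?_) not_pawFreeEdgeDeletion_paw
      refine absurd (le_of_eq_of_le ?_ (hI.card_le hyes)) (not_le.2 hl)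
      unfold support
      congr
  · have hle : (support I.1).card ≤ n := (Finset.card_le_univ _).trans (by simp)
    refine (ensures_output_of_adj h (m := (support I.1).card) (k := I.2) (G := compress I.1)
      ?_ ?_ ?_ (hle.trans hn) hN).mono fun s' hs' =>
        ⟨_, _, _, hs', compress_iff _ _, le_rfl, by omega⟩
    · intro s' h'
      rw [Expr.outputOrder, Expr.eval_ite, if_neg (mt (Expr.holds_tooLarge h').1 hl),
        Expr.eval_count_nonisolated h']
    · intro s' h'
      rw [Expr.outputParam, Expr.eval_ite, if_neg (mt (Expr.holds_tooLarge h').1 hl), Expr.eval,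
        h'.reg_one]
    · intro s' h' i j hi hj
      exact Expr.eval_outputAdj_compress h' hl hi hj

/-- Compute the square of the number of vertices in register `3`. -/
def square : Stmt := assign 3 (.sum 29 0 (.var 0))

theorem below_square : square.Below 30 := by
  simp [square, Below, Expr.Below]

theorem below_main : (reduceAll.seq output).Below 30 := by
  simp [reduceAll, output, reduceStep, copy, fill, Below, Expr.Below, Expr.index,
    Expr.reducedAdj, Expr.reducedParam, Expr.outputAdj, Expr.outputOrder, Expr.outputParam,
    Expr.tooLarge, Expr.replaceable, Expr.multipartite, Expr.manyParts, Expr.forced, Expr.twins,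
    Expr.near, Expr.adj, Expr.spansPaw, Expr.mimics, Expr.twinNumber, Expr.parallel,
    Expr.pendantAt, Expr.nonisolated, Expr.rankOf, Expr.all, Expr.count, Expr.not, Expr.and,
    Expr.or, Expr.iff, Expr.lt, Expr.le, Expr.eq]

end Stmt

/-! ### The complete kernelization and its running time -/

theorem env_inputState {n : ℕ} (G : SimpleGraph (Fin n)) (k : ℕ) :
    Env G k (inputState G k) := by
  refine ⟨by simp [inputState], by simp [inputState], fun a b => ?_⟩
  have : (∃ i j : Fin n, G.Adj i j ∧ n * (a : ℕ) + b = (i : ℕ) * n + j) ↔ G.Adj a b := by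
    constructor
    · rintro ⟨i, j, hij, h⟩
      have hn : 0 < n := a.pos
      rw [Nat.mul_comm (i : ℕ)] at h
      -- Quotient and remainder by n recover row and column from the index.
      have h1 := congrArg (· / n) h
      have h2 := congrArg (· % n) h
      simp only [Nat.mul_add_div hn, Nat.mul_add_mod, Nat.mod_eq_of_lt b.2, Nat.mod_eq_of_lt j.2,
        Nat.div_eq_of_lt b.2, Nat.div_eq_of_lt j.2, Nat.add_zero] at h1 h2
      rwa [Fin.ext h1, Fin.ext h2]
    · exact fun h => ⟨a, b, h, by rw [Nat.mul_comm]⟩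
  simp only [inputState, true_and, this]

/-- The kernelization. The parameter is kept in register `30` until it has been capped. -/
def kernelization : Prog :=
  .seq (.instr (.move 30 1)) (.seq (.instr (.const 1 0)) (.seq (Stmt.square.compile 40)
    (.seq (.instr (.sub 31 30 3)) (.seq (.instr (.sub 1 30 31))
      ((Stmt.reduceAll.seq Stmt.output).compile 40)))))

theorem polynomial_eval_mono (P : Polynomial ℕ) {a b : ℕ} (h : a ≤ b) :
    P.eval a ≤ P.eval b := by
  rw [Polynomial.eval_eq_sum_range, Polynomial.eval_eq_sum_range]
  exact Finset.sum_le_sum fun i _ => Nat.mul_le_mul_left _ (Nat.pow_le_pow_left h i)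

/-- The parameter may be exponential in its bit length, while loops run over its value. Capping it
at n^2, which is harmless by `pawFreeEdgeDeletion_min`, keeps the running time polynomial. -/
theorem hasVertexKernel :
    HasVertexKernel (fun {_} G k => PawFreeEdgeDeletion G k) (fun k => 278 * k ^ 4 + 4) := by
  refine ⟨kernelization, (Stmt.square.time + (Stmt.reduceAll.seq Stmt.output).time +
    Polynomial.C 4).comp (Polynomial.X + Polynomial.C 4), fun n G k => ?_⟩
  -- This bounds n, n^2, the capped parameter and the order 4 of the paw.
  set N := n * n + 4 with hN
  have hnN : n ≤ N := by nlinarith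
  have hin := env_inputState G k
  set s₀ := ((inputState G k).setReg 30 k).setReg 1 0 with hs₀
  have hs₀' : (Instr.const 1 0).eval ((Instr.move 30 1).eval (inputState G k)) = s₀ := by
    simp [Instr.eval, hin.reg_one, hs₀]
  have hreg : ∀ r, r ≠ 0 → r ≠ 30 → s₀.reg r = 0 := by
    intro r h0 h30
    simp only [hs₀, State.setReg_reg, inputState]
    split_ifs <;> rfl
  have h0 : s₀.reg 0 = n :=
    State.reg_setReg_of_ne (State.reg_setReg_of_ne hin.reg_zero (by norm_num)) (by norm_num)
  have h30 : s₀.reg 30 = k := State.reg_setReg_of_ne (State.reg_setReg_self _ _ _) (by norm_num)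
  -- Register 1 has been cleared, so the uncapped k does not violate the bound while n^2 is
  -- computed.
  have hb₀ : ∀ r < 30, s₀.reg r ≤ N := by
    intro r hr
    by_cases hr0 : r = 0
    · rw [hr0, h0]
      exact hnN
    · rw [hreg r hr0 (by omega)]
      exact Nat.zero_le _
  have hsq : (Expr.sum 29 0 (.var 0)).eval s₀ = n * n := by
    simp [Expr.eval, State.setReg_reg, h0]
  obtain ⟨t₁, s₁, e₁, ht₁, ha₁, hx₁, -⟩ := Stmt.square.compile_spec (d := 40) Stmt.below_square
    (by norm_num) (Agree.refl 30 s₀) hb₀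
    (show (Expr.sum 29 0 (.var 0)).eval s₀ ≤ N by rw [hsq]; omega)
  have hrun : Stmt.square.run s₀ = s₀.setReg 3 (n * n) := by rw [Stmt.square, Stmt.run, hsq]
  rw [hrun] at ha₁
  set s₂ := (s₁.setReg 31 (k - n * n)).setReg 1 (min k (n * n)) with hs₂
  have h1_30 : s₁.reg 30 = k := by rw [hx₁ 30 (by norm_num) (by norm_num), h30]
  have h1_3 : s₁.reg 3 = n * n := by
    rw [ha₁.2 3 (by norm_num), State.reg_setReg_self]
  have hs₂' : (Instr.sub 1 30 31).eval ((Instr.sub 31 30 3).eval s₁) = s₂ := by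
    -- Two truncated subtractions compute the minimum.
    have : k - (k - n * n) = min k (n * n) := by omega
    simp [Instr.eval, hs₂, State.setReg_reg, h1_30, h1_3, this]
  have hs₂r : ∀ x < 30, x ≠ 1 → s₂.reg x = (s₀.setReg 3 (n * n)).reg x := by
    intro x hx h1
    rw [hs₂, State.setReg_reg, if_neg h1, State.setReg_reg, if_neg (by omega), ha₁.2 x hx]
  have henv : Env G (min k (n * n)) s₂ := by
    refine ⟨?_, State.reg_setReg_self _ _ _, fun a b => ?_⟩
    · rw [hs₂r 0 (by norm_num) (by norm_num)]
      exact State.reg_setReg_of_ne h0 (by norm_num)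
    · have : s₂.arr = (inputState G k).arr := ha₁.1
      rw [this]
      exact hin.arr_zero a b
  have hcap : min k (n * n) ≤ N := (min_le_right _ _).trans (by omega)
  have hb₂ : ∀ r < 30, s₂.reg r ≤ N := by
    intro r hr
    by_cases hr1 : r = 1
    · rw [hr1, henv.reg_one]
      exact hcap
    rw [hs₂r r hr hr1, State.setReg_reg]
    split_ifs
    · omega
    · exact hb₀ r hr
  set I : SimpleGraph (Fin n) × ℕ := (G, min k (n * n)) with hI
  have hens : (Stmt.reduceAll.seq Stmt.output).Ensures N s₂ _ :=
    Stmt.Ensures.seq (Stmt.ensures_reduceAll (I := I) henv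
      (by rw [hs₂r 3 (by norm_num) (by norm_num), State.reg_setReg_self]) hcap) fun s' hs' =>
        Stmt.ensures_output hs' (irreducible_reduce I) hnN (by omega)
          ((shrunk_reduce I).snd_le.trans hcap)
  obtain ⟨t₂, s₃, e₂, ht₂, ha₂, -, -⟩ := Stmt.compile_spec (d := 40) _ Stmt.below_main
    (by norm_num) (Agree.refl 30 s₂) hb₂ hens.1
  obtain ⟨m, G', k', hout, hiff, hk', hm⟩ := hens.2
  have hkI : (reduce I).2 ≤ k := (shrunk_reduce I).snd_le.trans (min_le_left _ _)
  rw [← hs₂'] at e₂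
  rw [← hs₀'] at e₁
  refine ⟨_, s₃, m, G', k', .seq (.instr _ _) (.seq (.instr _ _) (.seq e₁ (.seq (.instr _ _)
    (.seq (.instr _ _) e₂)))), ?_, ?_, ?_, hk'.trans hkI, ?_⟩
  · rw [Polynomial.eval_comp]
    simp only [Polynomial.eval_add, Polynomial.eval_X, Polynomial.eval_C]
    have hle : N ≤ inputLength n k + 4 := by
      rw [hN, inputLength]
      omega
    have h1 := polynomial_eval_mono Stmt.square.time hle
    have h2 := polynomial_eval_mono (Stmt.reduceAll.seq Stmt.output).time hle
    omega
  · obtain ⟨o1, o2, o3⟩ := hout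
    exact ⟨by rw [ha₂.2 0 (by norm_num), o1], by rw [ha₂.2 1 (by norm_num), o2],
      fun i j => by rw [ha₂.1, o3]⟩
  · change PawFreeEdgeDeletion G k ↔ PawFreeEdgeDeletion G' k'
    rw [← pawFreeEdgeDeletion_min, ← hiff]
    exact (reduce_iff I).symm
  · refine hm.trans ?_
    exact Nat.add_le_add_right (Nat.mul_le_mul_left _ (Nat.pow_le_pow_left hkI 4)) 4

theorem isBigO_bound : Asymptotics.IsBigO Filter.atTop
    (fun k : ℕ => ((278 * k ^ 4 + 4 : ℕ) : ℝ)) (fun k : ℕ => (k : ℝ) ^ 4) := by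
  -- For k ≥ 1 the constant 4 is at most 4k^4, and 278 + 4 = 282.
  refine Asymptotics.IsBigO.of_bound 282 (Filter.eventually_atTop.2 ⟨1, fun k hk => ?_⟩)
  have h1 : (1 : ℝ) ≤ (k : ℝ) ^ 4 := one_le_pow₀ (by exact_mod_cast hk)
  rw [Real.norm_of_nonneg (by positivity), Real.norm_of_nonneg (by positivity)]
  push_cast
  linarith

end PawKernel


end

theorem theorem2 :
    ∃ f : ℕ → ℕ,
      Asymptotics.IsBigO Filter.atTop (fun k : ℕ => (f k : ℝ)) (fun k : ℕ => (k : ℝ) ^ 4) ∧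
      PawKernel.HasVertexKernel (fun {_} G k => PawKernel.PawFreeEdgeDeletion G k) f :=
  ⟨fun k => 278 * k ^ 4 + 4, PawKernel.isBigO_bound, PawKernel.hasVertexKernel⟩
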